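/- Notation. Let $\mathbb H=\{z\in\mathbb C:\operatorname{Im}z>0\}$. An *attenuation coefficient* is a non-zero $\kappa\in C^\infty(\mathbb R;\overline{\mathbb H})$ such that all derivatives of $\kappa$ are polynomially bounded; $\kappa$ has a polynomially bounded extension $\tilde\kappa\in C(\overline{\mathbb H};\overline{\mathbb H})$ that is holomorphic on $\mathbb H$; and $\kappa(-\omega)=-\overline{\kappa(\omega)}$ for all $\omega\in\mathbb R$. It is *strong* if $\operatorname{Im}\kappa(\omega)\ge\kappa_0|\omega|^\beta$ for all $|\omega|\ge\omega_0$, for some constants $\kappa_0>0$, $\beta>0$, $\omega_0\ge0$. It is *weak* if $$\kappa(\omega)=\frac\omega c+i\kappa_\infty+\kappa_*(\omega),\qquad \omega\in\mathbb R,$$ for some constants $c>0$, $\kappa_\infty\ge0$ and some bounded $\kappa_*\in C^\infty(\mathbb R)\cap L^2(\mathbb R)$. Let $\Omega\subset\mathbb R^3$ be a non-empty bounded open convex set with $C^\infty$ boundary, with outer unit normal $\nu$ and surface measure $dS$ on $\partial\Omega$. Let $\varepsilon>0$, let $\Omega_\varepsilon=\{x\in\Omega:\operatorname{dist}(x,\partial\Omega)>\varepsilon\}$,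 and let $\kappa$ be a weak or a strong attenuation coefficient. All $L^2$ spaces are complex. An integral $\int_{-\infty}^\infty\int_{\partial\Omega}\cdots\,dS(\xi)\,d\omega$ below is an iterated integral, in which $\int_{-\infty}^\infty$ is the improper integral $\lim_{a\to-\infty,\,b\to\infty}\int_a^b$. Statement. (1) The integrated photoacoustic operator $$\check{\mathcal P}_\kappa h(\omega,\xi)=\frac1{4\pi\sqrt{2\pi}}\int_{\Omega_\varepsilon}\frac{e^{i\kappa(\omega)|\xi-y|}}{|\xi-y|}h(y)\,dy$$ is a well-defined bounded linear operator $L^2(\Omega_\varepsilon)\to L^2(\mathbb R\times\partial\Omega)$. (2) For $x,y\in\Omega_\varepsilon$ with $x\ne y$ the integral $$F_\kappa(x,y)=\frac1{32\pi^3}\int_{-\infty}^\infty\int_{\partial\Omega}\frac{e^{i\kappa(\omega)|\xi-y|-i\overline{\kappa(\omega)}|\xi-x|}}{|\xi-y|\,|\xi-x|}\,dS(\xi)\,d\omega$$ converges, and $F_\kappa\in L^2(\Omega_\varepsilon\times\Omega_\varepsilon)$. If $\kappa$ is strong, the integral converges absolutely for all $x,y\in\Omega_\varepsilon$. (3) The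 operator $\check{\mathcal P}_\kappa^*\check{\mathcal P}_\kappa$ on $L^2(\Omega_\varepsilon)$ is self-adjoint and is the integral operator with kernel $F_\kappa$: for every $h\in L^2(\Omega_\varepsilon)$, $$\check{\mathcal P}_\kappa^*\check{\mathcal P}_\kappa h(x)=\int_{\Omega_\varepsilon}F_\kappa(x,y)h(y)\,dy\qquad\text{for almost every }x\in\Omega_\varepsilon.$$ It is a Hilbert–Schmidt operator and hence compact. (4) Suppose that $\kappa$ is weak, $\kappa(\omega)=\frac\omega c+i\kappa_\infty+\kappa_*(\omega)$ as above. For $j=0,1,2$ and $x\neq y$ in $\Omega_\varepsilon$ the integrals $$F_\kappa^{(j)}(x,y)=\frac1{32\pi^3}\int_{-\infty}^\infty\int_{\partial\Omega}\frac{e^{i\frac\omega c(|\xi-y|-|\xi-x|)}}{|\xi-y|\,|\xi-x|}e^{-\kappa_\infty(|\xi-y|+|\xi-x|)}f^{(j)}(\omega,\xi,x,y)\,dS(\xi)\,d\omega$$ converge, where $f^{(0)}=1$, $f^{(1)}=i\kappa_*(\omega)|\xi-y|-i\overline{\kappa_*(\omega)}|\xi-x|$ and $f^{(2)}=e^{f^{(1)}}-f^{(1)}-1$.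 Moreover $F_\kappa=F^{(0)}_\kappa+F^{(1)}_\kappa+F^{(2)}_\kappa$ off the diagonal, and each $F_\kappa^{(j)}$ is in $L^2(\Omega_\varepsilon\times\Omega_\varepsilon)$. The principal part $F_\kappa^{(0)}$ satisfies, for all $x\ne y$ in $\Omega_\varepsilon$, $$F_\kappa^{(0)}(x,y)=\frac c{16\pi^2|y-x|}\int_{\gamma_{x,y}}\frac{e^{-2\kappa_\infty|\xi-x|}}{|\xi-x|}\left|\nu(\xi)-\left\langle\tfrac{y-x}{|y-x|},\nu(\xi)\right\rangle\tfrac{y-x}{|y-x|}\right|^{-1}ds(\xi),$$ where $\gamma_{x,y}=\{\xi\in\partial\Omega:\langle\xi-\frac12(x+y),y-x\rangle=0\}$ is the section of $\partial\Omega$ by the bisecting plane of $x$ and $y$, and $ds$ is arc length; the line integral converges absolutely. There is a constant $A>0$ such that $|F_\kappa^{(0)}(x,y)|\le\frac A{|x-y|}$ for all $x\ne y$ in $\Omega_\varepsilon$. -/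

import Mathlib

open MeasureTheory Filter Topology
open scoped InnerProductSpace ComplexConjugate

noncomputable section

namespace AttenuatedPAT

/-- Three-dimensional Euclidean space. -/
abbrev E3 : Type := EuclideanSpace ℝ (Fin 3)

/-! ### Attenuation coefficients -/

/-- An attenuation coefficient: a nonzero smooth function on the real line with values in the
closed upper half plane, all of whose derivatives are polynomially bounded, which has a
polynomially bounded continuation to the closed upper half plane (continuous there, holomorphic in
the open half plane, with values in the closed half plane), and which satisfies
`κ (-ω) = - conj (κ ω)`. -/
structure IsAttenuationCoefficient (κ : ℝ → ℂ) : Prop where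
  ne_zero : κ ≠ 0
  smooth : ContDiff ℝ ((⊤ : ℕ∞) : WithTop ℕ∞) κ
  im_nonneg : ∀ ω, 0 ≤ (κ ω).im
  poly_bdd : ∀ l : ℕ, ∃ κ₁ : ℝ, 0 < κ₁ ∧ ∃ N : ℕ, ∀ ω : ℝ,
    ‖iteratedDeriv l κ ω‖ ≤ κ₁ * (1 + |ω|) ^ N
  hol_ext : ∃ κt : ℂ → ℂ,
    ContinuousOn κt {z | 0 ≤ z.im} ∧
    Set.MapsTo κt {z | 0 ≤ z.im} {z | 0 ≤ z.im} ∧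
    (∀ ω : ℝ, κt (ω : ℂ) = κ ω) ∧
    DifferentiableOn ℂ κt {z | 0 < z.im} ∧
    ∃ κ₁ : ℝ, 0 < κ₁ ∧ ∃ N : ℕ, ∀ z : ℂ, 0 ≤ z.im → ‖κt z‖ ≤ κ₁ * (1 + ‖z‖) ^ N
  symm : ∀ ω, κ (-ω) = -conj (κ ω)

/-- A strong attenuation coefficient. -/
def IsStrongAttenuation (κ : ℝ → ℂ) : Prop :=
  IsAttenuationCoefficient κ ∧
    ∃ κ₀ β ω₀ : ℝ, 0 < κ₀ ∧ 0 < β ∧ 0 ≤ ω₀ ∧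
      ∀ ω : ℝ, ω₀ ≤ |ω| → κ₀ * |ω| ^ β ≤ (κ ω).im

/-- The representation `κ ω = ω / c + i κ_∞ + κ_* ω` with `c > 0`, `κ_∞ ≥ 0` and `κ_*` smooth,
bounded and square integrable. -/
structure IsWeakRepresentation (κ : ℝ → ℂ) (c κinf : ℝ) (κs : ℝ → ℂ) : Prop where
  c_pos : 0 < c
  κinf_nonneg : 0 ≤ κinf
  smooth : ContDiff ℝ ((⊤ : ℕ∞) : WithTop ℕ∞) κs
  bounded : ∃ M : ℝ, ∀ ω, ‖κs ω‖ ≤ M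
  square_integrable : MemLp κs 2 volume
  eq : ∀ ω : ℝ, κ ω = ((ω / c : ℝ) : ℂ) + Complex.I * (κinf : ℂ) + κs ω

/-- A weak attenuation coefficient. -/
def IsWeakAttenuation (κ : ℝ → ℂ) : Prop :=
  IsAttenuationCoefficient κ ∧ ∃ (c κinf : ℝ) (κs : ℝ → ℂ), IsWeakRepresentation κ c κinf κs

/-! ### Domains with smooth boundary -/

/-- `ρ` is, on the open neighbourhood `U` of `ξ`, a smooth function without critical points such
that `Ω` coincides in `U` with the set where `ρ` is negative. -/
structure IsLocalDefiningFunction (Ω : Set E3) (ξ : E3) (U : Set E3) (ρ : E3 → ℝ) : Prop where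
  isOpen : IsOpen U
  mem : ξ ∈ U
  smooth : ContDiffOn ℝ ((⊤ : ℕ∞) : WithTop ℕ∞) ρ U
  regular : ∀ z ∈ U, fderiv ℝ ρ z ≠ 0
  eq_neg : Ω ∩ U = {z | z ∈ U ∧ ρ z < 0}

/-- `Ω` has a smooth boundary and lies locally on one side of it. -/
def HasSmoothBoundary (Ω : Set E3) : Prop :=
  ∀ ξ ∈ frontier Ω, ∃ (U : Set E3) (ρ : E3 → ℝ), IsLocalDefiningFunction Ω ξ U ρ

/-- `n` is the normalized gradient at `ξ` of a local defining function. -/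
def IsOuterUnitNormal (Ω : Set E3) (ξ n : E3) : Prop :=
  ∃ (U : Set E3) (ρ : E3 → ℝ), IsLocalDefiningFunction Ω ξ U ρ ∧
    n = ‖gradient ρ ξ‖⁻¹ • gradient ρ ξ

open Classical in
/-- The outer unit normal to `∂Ω` (set to `0` where there is none). -/
def outerUnitNormal (Ω : Set E3) (ξ : E3) : E3 :=
  if h : ∃ n, IsOuterUnitNormal Ω ξ n then h.choose else 0

/-- Surface measure on `∂Ω`, as a measure on the ambient space: the two-dimensional Hausdorff
measure, normalized to be Lebesgue measure on planes, restricted to `∂Ω`. -/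
def surfaceMeasure (Ω : Set E3) : Measure E3 :=
  (Measure.euclideanHausdorffMeasure 2 : Measure E3).restrict (frontier Ω)

/-- `Ω_ε`, the points of `Ω` of distance more than `ε` to `∂Ω`. -/
def innerDomain (Ω : Set E3) (ε : ℝ) : Set E3 :=
  {x | x ∈ Ω ∧ ε < Metric.infDist x (frontier Ω)}

/-! ### The integrated photoacoustic operator -/

/-- The complex Hilbert space `L²(Ω_ε)`. -/
abbrev L2Inner (Ω : Set E3) (ε : ℝ) : Type :=
  Lp ℂ 2 ((volume : Measure E3).restrict (innerDomain Ω ε))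

/-- The complex Hilbert space `L²(ℝ × ∂Ω)`. -/
abbrev L2Data (Ω : Set E3) : Type :=
  Lp ℂ 2 ((volume : Measure ℝ).prod (surfaceMeasure Ω))

/-- `P` is the integrated photoacoustic operator of `κ` in frequency domain, as a bounded operator
from `L²(Ω_ε)` to `L²(ℝ × ∂Ω)`. -/
def IsIntegratedPhotoacousticOperator (Ω : Set E3) (ε : ℝ) (κ : ℝ → ℂ)
    (P : L2Inner Ω ε →L[ℂ] L2Data Ω) : Prop :=
  ∀ h : L2Inner Ω ε,
    (P h : ℝ × E3 → ℂ) =ᵐ[(volume : Measure ℝ).prod (surfaceMeasure Ω)] fun p =>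
      ((1 / (4 * Real.pi * Real.sqrt (2 * Real.pi)) : ℝ) : ℂ) *
        ∫ y in innerDomain Ω ε,
          Complex.exp (Complex.I * κ p.1 * (‖p.2 - y‖ : ℂ)) / (‖p.2 - y‖ : ℂ) * h y

/-- A bounded operator on a Hilbert space is Hilbert-Schmidt if the squares of the norms of the
images of the members of an orthonormal basis are summable, whatever the basis. -/
def IsHilbertSchmidt.{u} {H : Type u} [NormedAddCommGroup H] [InnerProductSpace ℂ H]
    [CompleteSpace H] (T : H →L[ℂ] H) : Prop :=
  ∀ (ι : Type u) (b : HilbertBasis ι ℂ H), Summable fun i => ‖T (b i)‖ ^ 2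

/-! ### Iterated integrals over `∂Ω` and over the frequencies

The frequency integral is in general only conditionally convergent, and is read as the improper
integral `lim ∫ ω in p..q` for `p → -∞` and `q → ∞` independently. -/

/-- `∫ ω in p..q, ∫ ξ in ∂Ω, a ω ξ`. -/
def truncatedIntegral (Ω : Set E3) (a : ℝ → E3 → ℂ) (p : ℝ × ℝ) : ℂ :=
  ∫ ω in p.1..p.2, ∫ ξ, a ω ξ ∂(surfaceMeasure Ω)

/-- The surface integrals exist, are locally integrable in the frequency, and the improper
frequency integral converges. -/
def IteratedIntegralConverges (Ω : Set E3) (a : ℝ → E3 → ℂ) : Prop :=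
  (∀ ω, Integrable (a ω) (surfaceMeasure Ω)) ∧
  (∀ p q : ℝ, IntervalIntegrable (fun ω => ∫ ξ, a ω ξ ∂(surfaceMeasure Ω)) volume p q) ∧
  ∃ l : ℂ, Tendsto (truncatedIntegral Ω a) (atBot ×ˢ atTop) (𝓝 l)

/-- The value of the improper iterated integral. -/
def iteratedIntegral (Ω : Set E3) (a : ℝ → E3 → ℂ) : ℂ :=
  limUnder (atBot ×ˢ atTop) (truncatedIntegral Ω a)

/-! ### The kernel and its parts -/

/-- The integrand of the kernel of `P* P`. -/
def kernelIntegrand (κ : ℝ → ℂ) (x y : E3) (ω : ℝ) (ξ : E3) : ℂ :=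
  Complex.exp (Complex.I * κ ω * (‖ξ - y‖ : ℂ) - Complex.I * conj (κ ω) * (‖ξ - x‖ : ℂ)) /
    ((‖ξ - y‖ : ℂ) * (‖ξ - x‖ : ℂ))

/-- The kernel `F_κ`. -/
def kernel (Ω : Set E3) (κ : ℝ → ℂ) (x y : E3) : ℂ :=
  ((1 / (32 * Real.pi ^ 3) : ℝ) : ℂ) * iteratedIntegral Ω (kernelIntegrand κ x y)

/-- The term linear in `κ_*` of the expansion of the exponential. -/
def linearTerm (κs : ℝ → ℂ) (x y : E3) (ω : ℝ) (ξ : E3) : ℂ :=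
  Complex.I * κs ω * (‖ξ - y‖ : ℂ) - Complex.I * conj (κs ω) * (‖ξ - x‖ : ℂ)

/-- The factors `f⁽⁰⁾`, `f⁽¹⁾`, `f⁽²⁾`. -/
def splitFactor (κs : ℝ → ℂ) (x y : E3) (ω : ℝ) (ξ : E3) : Fin 3 → ℂ :=
  ![1, linearTerm κs x y ω ξ,
    Complex.exp (linearTerm κs x y ω ξ) - linearTerm κs x y ω ξ - 1]

/-- The integrand of the part `F_κ⁽ʲ⁾` of the kernel. -/
def splitIntegrand (c κinf : ℝ) (κs : ℝ → ℂ) (j : Fin 3) (x y : E3) (ω : ℝ) (ξ : E3) : ℂ :=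
  Complex.exp (Complex.I * ((ω / c * (‖ξ - y‖ - ‖ξ - x‖) : ℝ) : ℂ)) /
      ((‖ξ - y‖ : ℂ) * (‖ξ - x‖ : ℂ)) *
    ((Real.exp (-κinf * (‖ξ - y‖ + ‖ξ - x‖)) : ℝ) : ℂ) * splitFactor κs x y ω ξ j

/-- The part `F_κ⁽ʲ⁾` of the kernel; `j = 0` is the principal part. -/
def splitKernel (Ω : Set E3) (c κinf : ℝ) (κs : ℝ → ℂ) (j : Fin 3) (x y : E3) : ℂ :=
  ((1 / (32 * Real.pi ^ 3) : ℝ) : ℂ) * iteratedIntegral Ω (splitIntegrand c κinf κs j x y)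

/-- The intersection of `∂Ω` with the plane bisecting the segment from `x` to `y`. -/
def bisectingSection (Ω : Set E3) (x y : E3) : Set E3 :=
  {ξ | ξ ∈ frontier Ω ∧ ⟪ξ - (1 / 2 : ℝ) • (x + y), y - x⟫_ℝ = 0}

/-- Arc length on the bisecting section. -/
def sectionMeasure (Ω : Set E3) (x y : E3) : Measure E3 :=
  (Measure.euclideanHausdorffMeasure 1 : Measure E3).restrict (bisectingSection Ω x y)

/-- The unit vector from `x` towards `y`. -/
def direction (x y : E3) : E3 := ‖y - x‖⁻¹ • (y - x)

/-- The integrand of the line integral over the bisecting section. -/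
def sectionIntegrand (Ω : Set E3) (κinf : ℝ) (x y ξ : E3) : ℝ :=
  Real.exp (-2 * κinf * ‖ξ - x‖) / ‖ξ - x‖ *
    ‖outerUnitNormal Ω ξ - ⟪direction x y, outerUnitNormal Ω ξ⟫_ℝ • direction x y‖⁻¹

end AttenuatedPAT

end

open AttenuatedPAT

/-! The whole argument rests on one choice of coordinates. For x ≠ y in the inner domain, put
prolate spheroidal coordinates (s, t, θ) on space with foci x and y, so that |ξ - x| = a (cosh s +
t) and |ξ - y| = a (cosh s - t) with 2a = |y - x|. The phase |ξ - y| - |ξ - x| is then -2at, a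
function of t alone. Convexity makes every coordinate curve in s cross ∂Ω exactly once, so (t, θ)
parametrizes ∂Ω up to two poles, and the surface integral at frequency ω becomes the Fourier
transform, at 2aω/c, of a density on -1 < t < 1 (`layer`, `amplitude`).

Two facts about this density carry the estimates. It is bounded independently of x and y
(`BipolarFrame.weight_le`): the product |ξ - x| |ξ - y| in the denominator cancels against the
Jacobian, and the transversality of the coordinate curves to ∂Ω is quantified by ε, because x and y
lie at distance at least ε from every supporting plane. It is also Lipschitz at t = 0, so Fourier
inversion at 0 holds for the improper integral (`tendsto_integral_wave`). The value at t = 0 is an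
integral over the bisecting section, and the factor 2π / (2a/c) produces the singularity 1/|x - y|.
This settles the principal part.

For the linear part, κ_* leaves the surface integral and is paired with Fourier transforms of
bounded densities. An L² estimate of these of order 1/|x - y| (`lintegral_sq_wave_le`) together with
κ_* ∈ L² gives an absolutely integrable frequency density. The quadratic remainder is dominated by
|κ_*|². For strong attenuation the factor exp(-2ε Im κ) is integrable outright. In all cases the
kernel is O(1/|x - y|), which is square integrable over bounded sets of pairs in dimension three.

The frequency integral of the kernel need not converge absolutely, so Fubini cannot be applied to P*
P directly. Gaussian cutoffs in ω bridge the gap: `HasRegularizedIntegral` records that improper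
integral and Gaussian limit agree and that all regularizations are O(1/|x - y|). Fubini holds for
each cutoff; Fatou then gives boundedness of P, and dominated convergence identifies the kernel of
P* P (`IsRegularizable`). Square integrability of the kernel yields the Hilbert-Schmidt property
through Bessel's inequality, and compactness through finite rank approximation. -/

noncomputable section

namespace AttenuatedPAT

/-! ### The area formula for immersions -/

section AreaFormula

open Module Set

open scoped ENNReal NNReal

/-- Sets parametrized by two maps, the first of which contracts distances by `K` relative to the
second, have comparable Hausdorff measures. -/
theorem euclideanHausdorffMeasure_image_le_of_edist_le {X Y Z : Type*}
    [EMetricSpace Y] [MeasurableSpace Y] [BorelSpace Y]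
    [EMetricSpace Z] [MeasurableSpace Z] [BorelSpace Z] {f : X → Y} {g : X → Z} {t : Set X}
    {K : ℝ≥0} (h : ∀ y ∈ t, ∀ z ∈ t, edist (f y) (f z) ≤ K * edist (g y) (g z)) (d : ℕ) :
    (Measure.euclideanHausdorffMeasure d : Measure Y) (f '' t) ≤
      (K : ℝ≥0∞) ^ d * (Measure.euclideanHausdorffMeasure d : Measure Z) (g '' t) := by
  rcases t.eq_empty_or_nonempty with rfl | ⟨x₀, hx₀⟩
  · simp
  have : Nonempty X := ⟨x₀⟩
  have hinv : ∀ z ∈ g '' t, Function.invFunOn g t z ∈ t ∧ g (Function.invFunOn g t z) = z :=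
    fun z hz => ⟨Function.invFunOn_mem hz, Function.invFunOn_eq hz⟩
  have hlip : LipschitzOnWith K (f ∘ Function.invFunOn g t) (g '' t) := by
    intro y hy z hz
    have := h _ (hinv y hy).1 _ (hinv z hz).1
    rwa [(hinv y hy).2, (hinv z hz).2] at this
  have himg : (f ∘ Function.invFunOn g t) '' (g '' t) = f '' t := by
    apply Subset.antisymm
    · rintro _ ⟨z, hz, rfl⟩
      exact ⟨_, (hinv z hz).1, rfl⟩
    · rintro _ ⟨y, hy, rfl⟩
      refine ⟨g y, ⟨y, hy, rfl⟩, ?_⟩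
      have h0 := h _ (hinv (g y) ⟨y, hy, rfl⟩).1 _ hy
      rw [(hinv (g y) ⟨y, hy, rfl⟩).2, edist_self, mul_zero] at h0
      exact edist_le_zero.1 h0
  have hle := hlip.hausdorffMeasure_image_le (Nat.cast_nonneg d)
  rw [himg, ENNReal.rpow_natCast] at hle
  simp only [Measure.euclideanHausdorffMeasure_def, Measure.smul_apply, Measure.nnreal_smul_coe_apply]
  calc _ ≤ _ * ((K : ℝ≥0∞) ^ d * _) := by gcongr
    _ = _ := by ring

variable {U V : Type*} [NormedAddCommGroup U] [InnerProductSpace ℝ U] [FiniteDimensional ℝ U]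
  [NormedAddCommGroup V] [InnerProductSpace ℝ V] [CompleteSpace V]

/-- The Gram form √det(A* A) of the Jacobian depends on A only through continuous operations. -/
theorem continuous_normDet : Continuous fun A : U →L[ℝ] V => A.toLinearMap.normDet := by
  have h : (fun A : U →L[ℝ] V => A.toLinearMap.normDet) =
      fun A => Real.sqrt ((ContinuousLinearMap.adjoint A ∘L A).det) := by
    ext A
    have := A.normDet_sq
    simp only [RCLike.ofReal_real_eq_id, id] at this
    rw [← this, Real.sqrt_sq (LinearMap.normDet_nonneg _)]
  rw [h]
  refine Real.continuous_sqrt.comp (ContinuousLinearMap.continuous_det.comp ?_)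
  exact (ContinuousLinearMap.adjoint.continuous).clm_comp continuous_id

variable [MeasurableSpace U] [BorelSpace U] [MeasurableSpace V] [BorelSpace V]

/-- Near a point where the derivative is injective, the Hausdorff measure of the image and the
integral of the Jacobian agree up to a factor close to one. -/
theorem exists_nhds_image_measure_comparable {f : U → V} {f' : U → U →L[ℝ] V} {s : Set U} {x : U}
    (hf : HasStrictFDerivAt f (f' x) x) (hc : ContinuousWithinAt f' s x)
    (hinj : Function.Injective (f' x)) {θ : ℝ≥0} (hθ : 1 < θ) :
    ∃ N ∈ 𝓝[s] x, ∀ t ⊆ s ∩ N, MeasurableSet t →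
      (Measure.euclideanHausdorffMeasure (finrank ℝ U) : Measure V) (f '' t) ≤
        (θ : ℝ≥0∞) ^ (finrank ℝ U + 1) * ∫⁻ y in t, ENNReal.ofReal (f' y).toLinearMap.normDet ∧
      ∫⁻ y in t, ENNReal.ofReal (f' y).toLinearMap.normDet ≤
        (θ : ℝ≥0∞) ^ (finrank ℝ U + 1) *
          (Measure.euclideanHausdorffMeasure (finrank ℝ U) : Measure V) (f '' t) := by
  have hθ' : (1 : ℝ) < θ := by exact_mod_cast hθ
  obtain ⟨c, hc0, hcA⟩ : ∃ c : ℝ, 0 < c ∧ ∀ v, c * ‖v‖ ≤ ‖f' x v‖ := by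
    obtain ⟨K, hK0, hK⟩ := (f' x).toLinearMap.exists_antilipschitzWith
      (LinearMap.ker_eq_bot.2 hinj)
    refine ⟨(K : ℝ)⁻¹, by positivity, fun v => ?_⟩
    have := hK.le_mul_dist v 0
    simp only [dist_zero_right, map_zero, ContinuousLinearMap.coe_coe] at this
    rw [inv_mul_le_iff₀ (by exact_mod_cast hK0)]
    exact this
  -- With this δ the linearization error is at most (1 - θ⁻¹) times the length of the linear
  -- increment, by the lower bound c. Since 1 - θ⁻¹ ≤ θ - 1, increments of `f` and of `f' x` then
  -- agree up to the factor θ in both directions.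
  set δ : ℝ := c * (1 - (θ : ℝ)⁻¹) with hδ
  have hθinv : (θ : ℝ)⁻¹ < 1 := inv_lt_one_of_one_lt₀ hθ'
  have hθpos : (0 : ℝ) < θ := by linarith
  have hδ0 : 0 < δ := mul_pos hc0 (by linarith)
  have hη : 1 - (θ : ℝ)⁻¹ ≤ θ - 1 := by
    have : (2 : ℝ) ≤ θ + (θ : ℝ)⁻¹ := by
      have h1 : (θ : ℝ) * (θ : ℝ)⁻¹ = 1 := mul_inv_cancel₀ hθpos.ne'
      nlinarith [sq_nonneg ((θ : ℝ) - 1), inv_pos.2 hθpos]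
    linarith
  obtain ⟨N₁, hN₁, hN₁f⟩ := hf.approximates_deriv_on_nhds (c := ⟨δ, hδ0.le⟩) (Or.inr hδ0)
  have hJ0 : 0 < (f' x).toLinearMap.normDet := by
    refine lt_of_le_of_ne (LinearMap.normDet_nonneg _) (Ne.symm ?_)
    rw [Ne, LinearMap.normDet_eq_zero_iff_ker_ne_bot, not_not]
    exact LinearMap.ker_eq_bot.2 hinj
  have hJc : ContinuousWithinAt (fun y => (f' y).toLinearMap.normDet) s x :=
    continuous_normDet.continuousAt.comp_continuousWithinAt hc
  have hN₂ : ∀ᶠ y in 𝓝[s] x, (θ : ℝ)⁻¹ * (f' x).toLinearMap.normDet <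
      (f' y).toLinearMap.normDet ∧
      (f' y).toLinearMap.normDet < θ * (f' x).toLinearMap.normDet := by
    refine (hJc.eventually (lt_mem_nhds ?_)).and (hJc.eventually (gt_mem_nhds ?_))
    · nlinarith
    · nlinarith
  refine ⟨N₁ ∩ {y | (θ : ℝ)⁻¹ * (f' x).toLinearMap.normDet < (f' y).toLinearMap.normDet ∧
      (f' y).toLinearMap.normDet < θ * (f' x).toLinearMap.normDet},
    inter_mem (mem_nhdsWithin_of_mem_nhds hN₁) hN₂, fun t ht htm => ?_⟩
  have hcomp : ∀ y ∈ t, ∀ z ∈ t, ‖f y - f z‖ ≤ θ * ‖f' x y - f' x z‖ ∧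
      ‖f' x y - f' x z‖ ≤ θ * ‖f y - f z‖ := by
    intro y hy z hz
    have h1 := hN₁f y (ht hy).2.1 z (ht hz).2.1
    have h2 := hcA (y - z)
    have h3 : ‖f y - f z - f' x (y - z)‖ ≤ (1 - (θ : ℝ)⁻¹) * ‖f' x (y - z)‖ := by
      refine h1.trans ?_
      change δ * ‖y - z‖ ≤ _
      rw [hδ, mul_comm c, mul_assoc]
      exact mul_le_mul_of_nonneg_left h2 (by linarith)
    rw [map_sub] at h3
    have h4 := norm_le_norm_add_norm_sub' (f y - f z) (f' x y - f' x z)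
    have h5 := norm_le_norm_add_norm_sub' (f' x y - f' x z) (f y - f z)
    rw [norm_sub_rev (f' x y - f' x z)] at h5
    refine ⟨by nlinarith [norm_nonneg (f' x y - f' x z)], ?_⟩
    have h6 : (θ : ℝ)⁻¹ * ‖f' x y - f' x z‖ ≤ ‖f y - f z‖ := by linarith
    rwa [inv_mul_le_iff₀ hθpos] at h6
  have hed : ∀ (a b : V) (a' b' : V), ‖a - b‖ ≤ θ * ‖a' - b'‖ → edist a b ≤ θ * edist a' b' := by
    intro a b a' b' h
    rw [edist_nndist, edist_nndist, ← ENNReal.coe_mul, ENNReal.coe_le_coe, ← NNReal.coe_le_coe]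
    simpa [dist_eq_norm] using h
  have hle₁ := euclideanHausdorffMeasure_image_le_of_edist_le (f := f) (g := f' x) (t := t) (K := θ)
    (fun y hy z hz => hed _ _ _ _ (hcomp y hy z hz).1) (finrank ℝ U)
  have hle₂ := euclideanHausdorffMeasure_image_le_of_edist_le (f := f' x) (g := f) (t := t) (K := θ)
    (fun y hy z hz => hed _ _ _ _ (hcomp y hy z hz).2) (finrank ℝ U)
  have hlin := (f' x).toLinearMap.euclideanHausdorffMeasure_image_eq_normDet_mul_volume t
  simp only [ContinuousLinearMap.coe_coe] at hlin
  rw [hlin] at hle₁ hle₂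
  have hof : ∀ r : ℝ, (θ : ℝ≥0∞) * ENNReal.ofReal r = ENNReal.ofReal (θ * r) := by
    intro r
    rw [ENNReal.ofReal_mul hθpos.le, ENNReal.ofReal_coe_nnreal]
  have hI₁ : ENNReal.ofReal (f' x).toLinearMap.normDet * volume t ≤
      θ * ∫⁻ y in t, ENNReal.ofReal (f' y).toLinearMap.normDet := by
    rw [← setLIntegral_const, ← lintegral_const_mul' _ _ ENNReal.coe_ne_top]
    refine setLIntegral_mono' htm fun y hy => ?_
    rw [hof]
    refine ENNReal.ofReal_le_ofReal ?_
    have := (ht hy).2.2.1.le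
    rwa [inv_mul_le_iff₀ hθpos] at this
  have hI₂ : ∫⁻ y in t, ENNReal.ofReal (f' y).toLinearMap.normDet ≤
      θ * (ENNReal.ofReal (f' x).toLinearMap.normDet * volume t) := by
    rw [← mul_assoc, hof, ← setLIntegral_const]
    exact setLIntegral_mono' htm fun y hy => ENNReal.ofReal_le_ofReal (ht hy).2.2.2.le
  constructor
  · calc _ ≤ _ := hle₁
      _ ≤ (θ : ℝ≥0∞) ^ finrank ℝ U *
          (θ * ∫⁻ y in t, ENNReal.ofReal (f' y).toLinearMap.normDet) := by gcongr
      _ = _ := by rw [pow_succ, mul_assoc]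
  · calc _ ≤ _ := hI₂
      _ ≤ θ * ((θ : ℝ≥0∞) ^ finrank ℝ U *
          (Measure.euclideanHausdorffMeasure (finrank ℝ U) : Measure V) (f '' t)) := by gcongr
      _ = _ := by rw [pow_succ]; ring

theorem le_of_forall_one_lt_le_pow_mul {a b : ℝ≥0∞} (n : ℕ)
    (h : ∀ θ : ℝ≥0, 1 < θ → a ≤ (θ : ℝ≥0∞) ^ n * b) : a ≤ b := by
  rcases eq_or_ne b ∞ with rfl | hb
  · exact le_top
  have hT : Tendsto (fun θ : ℝ≥0 => (θ : ℝ≥0∞) ^ n * b) (𝓝[>] 1) (𝓝 ((1 : ℝ≥0) ^ n * b)) := by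
    refine Tendsto.mono_left ?_ nhdsWithin_le_nhds
    refine ENNReal.Tendsto.mul_const ?_ (Or.inr hb)
    have : Continuous fun θ : ℝ≥0 => ((θ ^ n : ℝ≥0) : ℝ≥0∞) := by fun_prop
    simpa using this.tendsto 1
  have := ge_of_tendsto hT (eventually_nhdsWithin_of_forall fun θ hθ => h θ hθ)
  simpa using this

/-- The area formula for an injective immersion. -/
theorem lintegral_normDet_fderiv_eq_image {f : U → V} {f' : U → U →L[ℝ] V} {s : Set U}
    [SecondCountableTopology V]
    (hs : MeasurableSet s) (hf : ∀ x ∈ s, HasStrictFDerivAt f (f' x) x) (hc : ContinuousOn f' s)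
    (hinj : ∀ x ∈ s, Function.Injective (f' x)) (hfi : InjOn f s) :
    (Measure.euclideanHausdorffMeasure (finrank ℝ U) : Measure V) (f '' s) =
      ∫⁻ y in s, ENNReal.ofReal (f' y).toLinearMap.normDet := by
  set H : Measure V := Measure.euclideanHausdorffMeasure (finrank ℝ U)
  have hcont : ContinuousOn f s := fun x hx => (hf x hx).continuousAt.continuousWithinAt
  have key : ∀ θ : ℝ≥0, 1 < θ →
      H (f '' s) ≤ (θ : ℝ≥0∞) ^ (finrank ℝ U + 1) *
        ∫⁻ y in s, ENNReal.ofReal (f' y).toLinearMap.normDet ∧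
      ∫⁻ y in s, ENNReal.ofReal (f' y).toLinearMap.normDet ≤
        (θ : ℝ≥0∞) ^ (finrank ℝ U + 1) * H (f '' s) := by
    intro θ hθ
    rcases s.eq_empty_or_nonempty with rfl | hne
    · simp
    choose! N hN hNt using fun x (hx : x ∈ s) =>
      exists_nhds_image_measure_comparable (hf x hx) (hc x hx) (hinj x hx) hθ
    have hO : ∀ x ∈ s, ∃ O : Set U, IsOpen O ∧ x ∈ O ∧ O ∩ s ⊆ N x := fun x hx => by
      obtain ⟨O, hO, hxO, hsub⟩ := mem_nhdsWithin.1 (hN x hx)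
      exact ⟨O, hO, hxO, hsub⟩
    choose! O hOo hxO hOs using hO
    -- By the Lindelöf property countably many neighbourhoods suffice. Making them disjoint renders
    -- the local estimates additive; injectivity of `f` keeps the images disjoint as well.
    obtain ⟨T, hTs, hTc, hTcov⟩ := TopologicalSpace.countable_cover_nhdsWithin
      (f := O) (s := s) fun x hx => mem_nhdsWithin_of_mem_nhds ((hOo x hx).mem_nhds (hxO x hx))
    have hTne : T.Nonempty := by
      obtain ⟨x, hx⟩ := hne
      obtain ⟨i, hi, -⟩ := mem_iUnion₂.1 (hTcov hx)
      exact ⟨i, hi⟩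
    obtain ⟨u, hu⟩ := hTc.exists_eq_range hTne
    have hus : ∀ n, u n ∈ s := fun n => hTs (hu ▸ mem_range_self n)
    set t : ℕ → Set U := disjointed fun n => O (u n) with ht
    have htm : ∀ n, MeasurableSet (t n) :=
      fun n => MeasurableSet.disjointed (fun n => (hOo _ (hus n)).measurableSet) n
    have htd : Pairwise (Function.onFun Disjoint t) := disjoint_disjointed _
    have hcov : s = ⋃ n, s ∩ t n := by
      rw [← inter_iUnion, iUnion_disjointed, eq_comm, inter_eq_left]
      intro x hx
      obtain ⟨i, hi, hxi⟩ := mem_iUnion₂.1 (hTcov hx)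
      rw [hu] at hi
      obtain ⟨n, rfl⟩ := hi
      exact mem_iUnion.2 ⟨n, hxi⟩
    have hpiece : ∀ n, _ := fun n => hNt (u n) (hus n) (s ∩ t n)
      (fun y hy => ⟨hy.1, hOs _ (hus n) ⟨disjointed_subset (fun n => O (u n)) n hy.2, hy.1⟩⟩) (hs.inter (htm n))
    have hint : ∫⁻ y in s, ENNReal.ofReal (f' y).toLinearMap.normDet =
        ∑' n, ∫⁻ y in s ∩ t n, ENNReal.ofReal (f' y).toLinearMap.normDet := by
      conv_lhs => rw [hcov]
      rw [lintegral_iUnion (fun n => hs.inter (htm n))]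
      exact pairwise_disjoint_mono htd fun n => inter_subset_right
    constructor
    · calc H (f '' s) ≤ ∑' n, H (f '' (s ∩ t n)) := by
            conv_lhs => rw [hcov, image_iUnion]
            exact measure_iUnion_le _
        _ ≤ ∑' n, (θ : ℝ≥0∞) ^ (finrank ℝ U + 1) *
            ∫⁻ y in s ∩ t n, ENNReal.ofReal (f' y).toLinearMap.normDet :=
          ENNReal.tsum_le_tsum fun n => (hpiece n).1
        _ = _ := by rw [ENNReal.tsum_mul_left, hint]
    · calc _ = _ := hint
        _ ≤ ∑' n, (θ : ℝ≥0∞) ^ (finrank ℝ U + 1) * H (f '' (s ∩ t n)) :=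
          ENNReal.tsum_le_tsum fun n => (hpiece n).2
        _ = (θ : ℝ≥0∞) ^ (finrank ℝ U + 1) * H (f '' s) := by
          rw [ENNReal.tsum_mul_left]
          conv_rhs => rw [hcov, image_iUnion]
          rw [measure_iUnion]
          · intro i j hij
            exact Disjoint.image (Disjoint.mono inter_subset_right inter_subset_right (htd hij))
              hfi inter_subset_left inter_subset_left
          · intro n
            exact (hs.inter (htm n)).image_of_continuousOn_injOn (hcont.mono inter_subset_left)
              (hfi.mono inter_subset_left)
  exact le_antisymm (le_of_forall_one_lt_le_pow_mul _ fun θ hθ => (key θ hθ).1)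
    (le_of_forall_one_lt_le_pow_mul _ fun θ hθ => (key θ hθ).2)

/-- The area formula as an identity between measures. -/
theorem map_withDensity_normDet_fderiv {f : U → V} {f' : U → U →L[ℝ] V} {s : Set U}
    [SecondCountableTopology V]
    (hs : MeasurableSet s) (hf : ∀ x ∈ s, HasStrictFDerivAt f (f' x) x) (hc : ContinuousOn f' s)
    (hinj : ∀ x ∈ s, Function.Injective (f' x)) (hfi : InjOn f s) :
    Measure.map f ((volume.restrict s).withDensity
        fun y => ENNReal.ofReal (f' y).toLinearMap.normDet) =
      (Measure.euclideanHausdorffMeasure (finrank ℝ U) : Measure V).restrict (f '' s) := by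
  have hcont : ContinuousOn f s := fun x hx => (hf x hx).continuousAt.continuousWithinAt
  -- Nothing is known about `f` off `s`, so it is replaced by a measurable map that agrees with it
  -- where the measure lives.
  obtain ⟨u, u_meas, uf⟩ : ∃ u, Measurable u ∧ EqOn u f s := by
    classical
    exact ⟨s.piecewise f 0, hcont.measurable_piecewise continuous_zero.continuousOn hs,
      piecewise_eqOn _ _ _⟩
  have hae : f =ᵐ[(volume.restrict s).withDensity
      fun y => ENNReal.ofReal (f' y).toLinearMap.normDet] u := by
    refine (withDensity_absolutelyContinuous _ _).ae_eq ?_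
    filter_upwards [ae_restrict_mem hs] with x hx using (uf hx).symm
  rw [Measure.map_congr hae]
  ext t ht
  rw [Measure.map_apply u_meas ht, withDensity_apply _ (u_meas ht), Measure.restrict_apply ht,
    Measure.restrict_restrict (u_meas ht)]
  have hset : f '' (u ⁻¹' t ∩ s) = t ∩ f '' s := by
    ext z
    constructor
    · rintro ⟨y, ⟨hy, hys⟩, rfl⟩
      exact ⟨by rw [← uf hys]; exact hy, y, hys, rfl⟩
    · rintro ⟨hz, y, hys, rfl⟩
      exact ⟨y, ⟨by rw [mem_preimage, uf hys]; exact hz, hys⟩, rfl⟩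
  rw [← hset]
  exact (lintegral_normDet_fderiv_eq_image ((u_meas ht).inter hs) (fun x hx => hf x hx.2)
    (hc.mono inter_subset_right) (fun x hx => hinj x hx.2) (hfi.mono inter_subset_right)).symm

end AreaFormula


/-! ### Curves and surfaces in three-dimensional space -/

section AreaFormulaCoordinates

open Set

/-- The area formula for a curve. -/
theorem map_withDensity_norm_deriv {f f' : ℝ → E3} {s : Set ℝ} (hs : MeasurableSet s)
    (hf : ∀ t ∈ s, HasStrictDerivAt f (f' t) t) (hc : ContinuousOn f' s)
    (hne : ∀ t ∈ s, f' t ≠ 0) (hfi : InjOn f s) :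
    Measure.map f ((volume.restrict s).withDensity fun t => ENNReal.ofReal ‖f' t‖) =
      (Measure.euclideanHausdorffMeasure 1 : Measure E3).restrict (f '' s) := by
  have hnorm : ∀ v : E3, (ContinuousLinearMap.toSpanSingleton ℝ v).toLinearMap.normDet = ‖v‖ := by
    intro v
    have h := (ContinuousLinearMap.toSpanSingleton ℝ v).toLinearMap.normDet_sq_eq_det_gram
      (OrthonormalBasis.singleton Unit ℝ)
    simp [Matrix.gram] at h
    exact (sq_eq_sq₀ (LinearMap.normDet_nonneg _) (norm_nonneg v)).1 h
  have h := map_withDensity_normDet_fderiv (U := ℝ) (V := E3) (f := f)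
    (f' := fun t => ContinuousLinearMap.toSpanSingleton ℝ (f' t)) hs
    (fun t ht => (hf t ht).hasStrictFDerivAt)
    ((ContinuousLinearMap.toSpanSingletonCLE (𝕜 := ℝ) (E := E3)).continuous.comp_continuousOn hc)
    (fun t ht a b hab => by
      simpa [hne t ht] using hab) hfi
  simp only [hnorm, Module.finrank_self] at h
  exact h

/-- The square root of the Gram determinant of two vectors. -/
def areaFactor (u v : E3) : ℝ := Real.sqrt (‖u‖ ^ 2 * ‖v‖ ^ 2 - ⟪u, v⟫_ℝ ^ 2)

/-- The area formula for a parametrized surface. -/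
theorem map_withDensity_areaFactor {f : ℝ × ℝ → E3} {f' : ℝ × ℝ → ℝ × ℝ →L[ℝ] E3}
    {s : Set (ℝ × ℝ)} (hs : MeasurableSet s)
    (hf : ∀ p ∈ s, HasStrictFDerivAt f (f' p) p) (hc : ContinuousOn f' s)
    (hpos : ∀ p ∈ s, 0 < areaFactor (f' p (1, 0)) (f' p (0, 1))) (hfi : InjOn f s) :
    Measure.map f ((volume.restrict s).withDensity
        fun p => ENNReal.ofReal (areaFactor (f' p (1, 0)) (f' p (0, 1)))) =
      (Measure.euclideanHausdorffMeasure 2 : Measure E3).restrict (f '' s) := by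
  -- The product ℝ × ℝ carries the sup norm, while the Jacobian requires an inner product on the
  -- source. The measure preserving identification `e` with the Euclidean plane mediates.
  let e : EuclideanSpace ℝ (Fin 2) →L[ℝ] ℝ × ℝ :=
    (EuclideanSpace.proj (0 : Fin 2)).prod (EuclideanSpace.proj (1 : Fin 2))
  have hemp : MeasurePreserving e volume volume :=
    (volume_preserving_finTwoArrow ℝ).comp (PiLp.volume_preserving_ofLp (Fin 2))
  have hesurj : Function.Surjective e := fun p => ⟨!₂[p.1, p.2], by simp [e]⟩
  have heinj : Function.Injective e := fun u v h => by
    simp only [e, ContinuousLinearMap.prod_apply, Prod.mk.injEq] at h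
    ext i
    fin_cases i
    · exact h.1
    · exact h.2
  have hdet : ∀ A : ℝ × ℝ →L[ℝ] E3,
      (A ∘L e).toLinearMap.normDet = areaFactor (A (1, 0)) (A (0, 1)) := by
    intro A
    have h := (A ∘L e).toLinearMap.normDet_sq_eq_det_gram (EuclideanSpace.basisFun (Fin 2) ℝ)
    have h0 : (A ∘L e) (EuclideanSpace.single 0 1) = A (1, 0) := by simp [e]
    have h1 : (A ∘L e) (EuclideanSpace.single 1 1) = A (0, 1) := by simp [e]
    simp only [Matrix.gram, Matrix.det_fin_two, Matrix.of_apply, EuclideanSpace.basisFun_apply,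
      ContinuousLinearMap.coe_coe, h0, h1, real_inner_self_eq_norm_sq] at h
    rw [areaFactor, ← Real.sqrt_sq (LinearMap.normDet_nonneg (A ∘L e).toLinearMap)]
    congr 1
    have h' : (A ∘L e).toLinearMap.normDet ^ 2 = ‖A (1, 0)‖ ^ 2 * ‖A (0, 1)‖ ^ 2 -
      ⟪A (1, 0), A (0, 1)⟫_ℝ * ⟪A (0, 1), A (1, 0)⟫_ℝ := h
    rw [h', real_inner_comm (A (1, 0)) (A (0, 1))]
    ring
  have hse : MeasurableSet (e ⁻¹' s) := hemp.measurable hs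
  have hcont : ContinuousOn f s := fun x hx => (hf x hx).continuousAt.continuousWithinAt
  have h := map_withDensity_normDet_fderiv (U := EuclideanSpace ℝ (Fin 2)) (V := E3)
    (f := f ∘ e) (f' := fun u => f' (e u) ∘L e) (s := e ⁻¹' s) hse
    (fun u hu => (hf (e u) hu).comp u e.hasStrictFDerivAt)
    (((ContinuousLinearMap.compL ℝ (EuclideanSpace ℝ (Fin 2)) (ℝ × ℝ) E3).flip e).continuous.comp_continuousOn
      (hc.comp e.continuous.continuousOn fun u hu => hu))
    (fun u hu => by
      have : (f' (e u) ∘L e).toLinearMap.normDet ≠ 0 := by rw [hdet]; exact (hpos _ hu).ne'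
      rw [Ne, LinearMap.normDet_eq_zero_iff_ker_ne_bot, not_not] at this
      exact LinearMap.ker_eq_bot.1 this)
    (fun u hu v hv huv => heinj (hfi hu hv huv))
  simp only [hdet, finrank_euclideanSpace, Fintype.card_fin] at h
  rw [image_comp, image_preimage_eq _ hesurj] at h
  rw [← h]
  have hmeq : Measure.map e ((volume.restrict (e ⁻¹' s)).withDensity
      fun u => ENNReal.ofReal (areaFactor (f' (e u) (1, 0)) (f' (e u) (0, 1)))) =
      (volume.restrict s).withDensity
        fun p => ENNReal.ofReal (areaFactor (f' p (1, 0)) (f' p (0, 1))) := by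
    have hemb : MeasurableEmbedding e := e.continuous.measurableEmbedding heinj
    ext t ht
    rw [Measure.map_apply hemp.measurable ht, withDensity_apply _ (hemp.measurable ht),
      withDensity_apply _ ht, Measure.restrict_restrict (hemp.measurable ht),
      Measure.restrict_restrict ht, ← preimage_inter,
      hemp.setLIntegral_comp_preimage_emb hemb
        (fun p => ENNReal.ofReal (areaFactor (f' p (1, 0)) (f' p (0, 1))))]
  rw [← hmeq, AEMeasurable.map_map_of_aemeasurable _ hemp.measurable.aemeasurable]
  rw [hmeq]
  exact (hcont.aemeasurable hs).mono_ac (withDensity_absolutelyContinuous _ _)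

end AreaFormulaCoordinates


/-! ### Prolate spheroidal coordinates -/

section Prolate

open Set

/-- The vector with coordinates `p`, `q`, `r` in an orthonormal basis. -/
def comb (b : OrthonormalBasis (Fin 3) ℝ E3) (p q r : ℝ) : E3 := p • b 0 + q • b 1 + r • b 2

variable (b : OrthonormalBasis (Fin 3) ℝ E3)

theorem inner_comb (p q r p' q' r' : ℝ) :
    ⟪comb b p q r, comb b p' q' r'⟫_ℝ = p * p' + q * q' + r * r' := by
  simp [comb, inner_add_left, inner_add_right, real_inner_smul_left, real_inner_smul_right]
  ring

theorem norm_sq_comb (p q r : ℝ) : ‖comb b p q r‖ ^ 2 = p ^ 2 + q ^ 2 + r ^ 2 := by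
  rw [← real_inner_self_eq_norm_sq, inner_comb]; ring

theorem exists_eq_comb (v : E3) : ∃ p q r, v = comb b p q r := by
  refine ⟨⟪b 0, v⟫_ℝ, ⟪b 1, v⟫_ℝ, ⟪b 2, v⟫_ℝ, ?_⟩
  conv_lhs => rw [← b.sum_repr' v]
  simp [Fin.sum_univ_three, comb]

theorem inner_basis_comb (p q r : ℝ) :
    ⟪b 0, comb b p q r⟫_ℝ = p ∧ ⟪b 1, comb b p q r⟫_ℝ = q ∧ ⟪b 2, comb b p q r⟫_ℝ = r := by
  simp [comb, inner_add_right, real_inner_smul_right]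

theorem comb_add (p q r p' q' r' : ℝ) :
    comb b p q r + comb b p' q' r' = comb b (p + p') (q + q') (r + r') := by
  simp only [comb, add_smul]; abel

theorem smul_comb (k p q r : ℝ) : k • comb b p q r = comb b (k * p) (k * q) (k * r) := by
  simp only [comb, smul_add, smul_smul]

theorem comb_inj {p q r p' q' r' : ℝ} (h : comb b p q r = comb b p' q' r') :
    p = p' ∧ q = q' ∧ r = r' := by
  have h1 := inner_basis_comb b p q r
  rw [h] at h1
  have h2 := inner_basis_comb b p' q' r'
  exact ⟨h1.1.symm.trans h2.1, h1.2.1.symm.trans h2.2.1, h1.2.2.symm.trans h2.2.2⟩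

/-- Prolate spheroidal coordinates with foci `m - a • b 0` and `m + a • b 0`. -/
def prolate (m : E3) (a s t θ : ℝ) : E3 :=
  m + comb b (a * (Real.cosh s * t)) (a * (Real.sinh s * √(1 - t ^ 2) * Real.cos θ))
    (a * (Real.sinh s * √(1 - t ^ 2) * Real.sin θ))

variable {m : E3} {a s t θ : ℝ}

theorem one_sub_sq_nonneg (ht : t ∈ Icc (-1 : ℝ) 1) : 0 ≤ 1 - t ^ 2 := by nlinarith [ht.1, ht.2]

theorem norm_prolate_sub_left (ha : 0 < a) (ht : t ∈ Icc (-1 : ℝ) 1) :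
    ‖prolate b m a s t θ - (m - a • b 0)‖ = a * (Real.cosh s + t) := by
  have h0 : 0 ≤ a * (Real.cosh s + t) :=
    mul_nonneg ha.le (by linarith [ht.1, Real.one_le_cosh s])
  have hv : prolate b m a s t θ - (m - a • b 0) =
      comb b (a * (Real.cosh s * t) + a) (a * (Real.sinh s * √(1 - t ^ 2) * Real.cos θ))
    (a * (Real.sinh s * √(1 - t ^ 2) * Real.sin θ)) := by
    simp only [prolate, comb, add_smul]; abel
  rw [← sq_eq_sq₀ (norm_nonneg _) h0, hv, norm_sq_comb]
  have h1 := Real.sq_sqrt (one_sub_sq_nonneg ht)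
  have h2 := Real.cosh_sq s
  have h3 := Real.sin_sq_add_cos_sq θ
  calc _ = (a * (Real.cosh s * t) + a) ^ 2 + a ^ 2 * Real.sinh s ^ 2 * √(1 - t ^ 2) ^ 2 *
        (Real.sin θ ^ 2 + Real.cos θ ^ 2) := by ring
    _ = _ := by rw [h1, h3, mul_pow, ← sub_eq_iff_eq_add.2 h2]; ring

theorem norm_prolate_sub_right (ha : 0 < a) (ht : t ∈ Icc (-1 : ℝ) 1) :
    ‖prolate b m a s t θ - (m + a • b 0)‖ = a * (Real.cosh s - t) := by
  have h0 : 0 ≤ a * (Real.cosh s - t) :=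
    mul_nonneg ha.le (by linarith [ht.2, Real.one_le_cosh s])
  have hv : prolate b m a s t θ - (m + a • b 0) =
      comb b (a * (Real.cosh s * t) - a) (a * (Real.sinh s * √(1 - t ^ 2) * Real.cos θ))
    (a * (Real.sinh s * √(1 - t ^ 2) * Real.sin θ)) := by
    simp only [prolate, comb, sub_smul]; abel
  rw [← sq_eq_sq₀ (norm_nonneg _) h0, hv, norm_sq_comb]
  have h1 := Real.sq_sqrt (one_sub_sq_nonneg ht)
  have h2 := Real.cosh_sq s
  have h3 := Real.sin_sq_add_cos_sq θ
  calc _ = (a * (Real.cosh s * t) - a) ^ 2 + a ^ 2 * Real.sinh s ^ 2 * √(1 - t ^ 2) ^ 2 *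
        (Real.sin θ ^ 2 + Real.cos θ ^ 2) := by ring
    _ = _ := by rw [h1, h3, mul_pow, ← sub_eq_iff_eq_add.2 h2]; ring

/-- Moving outwards along a coordinate hyperbola, one stays inside the triangles spanned by the
foci and later points. -/
theorem exists_prolate_eq_combination {s' : ℝ} (hs' : 0 ≤ s') (hs : s' < s)
    (ht : t ∈ Icc (-1 : ℝ) 1) : ∃ γ r : ℝ, 0 ≤ γ ∧ γ < 1 ∧ r ∈ Icc (-1 : ℝ) 1 ∧
      prolate b m a s' t θ = (1 - γ) • (m + (a * r) • b 0) + γ • prolate b m a s t θ := by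
  have hsp : 0 < Real.sinh s := Real.sinh_pos_iff.2 (by linarith)
  have hs0 : 0 ≤ Real.sinh s' := Real.sinh_nonneg_iff.2 hs'
  have hlt : Real.sinh s' < Real.sinh s := Real.sinh_lt_sinh.2 hs
  have hd : 0 ≤ Real.sinh (s - s') := Real.sinh_nonneg_iff.2 (by linarith)
  have hsub := Real.sinh_sub s s'
  have hle : Real.sinh (s - s') ≤ Real.sinh s - Real.sinh s' := by
    have h1 : Real.sinh s = Real.sinh ((s - s') + s') := by ring_nf
    rw [Real.sinh_add] at h1
    have h2 := Real.one_le_cosh s'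
    have h3 := Real.one_le_cosh (s - s')
    nlinarith
  -- The components transverse to the axis force γ = sinh s' / sinh s; the axial component then
  -- forces r = κ t with this κ. Superadditivity of sinh gives κ ≤ 1, which keeps the axial point
  -- between the foci.
  set κ := Real.sinh (s - s') / (Real.sinh s - Real.sinh s') with hκ
  have hpos : 0 < Real.sinh s - Real.sinh s' := by linarith
  have hκ0 : 0 ≤ κ := div_nonneg hd hpos.le
  have hκ1 : κ ≤ 1 := (div_le_one hpos).2 hle
  refine ⟨Real.sinh s' / Real.sinh s, κ * t, div_nonneg hs0 hsp.le, (div_lt_one hsp).2 hlt,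
    ⟨by nlinarith [ht.1, ht.2], by nlinarith [ht.1, ht.2]⟩, ?_⟩
  have hm : (1 - Real.sinh s' / Real.sinh s) • (m + (a * (κ * t)) • b 0) +
      (Real.sinh s' / Real.sinh s) • prolate b m a s t θ =
      m + (comb b ((1 - Real.sinh s' / Real.sinh s) * (a * (κ * t))) 0 0 +
        (Real.sinh s' / Real.sinh s) • comb b (a * (Real.cosh s * t))
          (a * (Real.sinh s * √(1 - t ^ 2) * Real.cos θ))
          (a * (Real.sinh s * √(1 - t ^ 2) * Real.sin θ))) := by
    simp only [prolate, comb, zero_smul, add_zero]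
    module
  rw [hm, smul_comb, comb_add, prolate]
  congr 2
  · rw [hκ, hsub]
    field_simp
    ring
  · field_simp
    ring
  · field_simp
    ring

theorem continuous_prolate_left : Continuous fun s => prolate b m a s t θ := by
  unfold prolate comb
  fun_prop

/-- Each point has prolate spheroidal coordinates. -/
theorem exists_prolate_eq (ha : 0 < a) (ξ : E3) : ∃ s t θ : ℝ, 0 ≤ s ∧ t ∈ Icc (-1 : ℝ) 1 ∧
    θ ∈ Ioc (-Real.pi) Real.pi ∧ prolate b m a s t θ = ξ := by
  obtain ⟨X, Y, Z, hv⟩ := exists_eq_comb b (ξ - m)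
  set A := ‖ξ - (m - a • b 0)‖ with hA
  set B := ‖ξ - (m + a • b 0)‖ with hB
  have hA2 : A ^ 2 = (X + a) ^ 2 + Y ^ 2 + Z ^ 2 := by
    rw [hA, ← norm_sq_comb b]
    congr 2
    rw [show ξ - (m - a • b 0) = (ξ - m) + a • b 0 by abel, hv]
    simp only [comb, add_smul]; abel
  have hB2 : B ^ 2 = (X - a) ^ 2 + Y ^ 2 + Z ^ 2 := by
    rw [hB, ← norm_sq_comb b]
    congr 2
    rw [show ξ - (m + a • b 0) = (ξ - m) - a • b 0 by abel, hv]
    simp only [comb, sub_smul]; abel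
  have hfoc : ‖(m + a • b 0) - (m - a • b 0)‖ = 2 * a := by
    rw [show (m + a • b 0) - (m - a • b 0) = (2 * a) • b 0 by module, norm_smul,
      b.orthonormal.1 0, Real.norm_of_nonneg (by linarith), mul_one]
  have hA0 : 0 ≤ A := norm_nonneg _
  have hB0 : 0 ≤ B := norm_nonneg _
  have hsum : 2 * a ≤ A + B := by
    rw [← hfoc, hA, hB]
    calc _ = ‖(ξ - (m - a • b 0)) - (ξ - (m + a • b 0))‖ := by congr 1; abel
      _ ≤ _ := norm_sub_le _ _
  have hAB : |A - B| ≤ 2 * a := by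
    rw [← hfoc, hA, hB]
    refine (abs_norm_sub_norm_le _ _).trans (le_of_eq ?_)
    congr 1; abel
  have hc1 : 1 ≤ (A + B) / (2 * a) := (one_le_div (by linarith)).2 hsum
  -- The focal distances must be a (cosh s + t) and a (cosh s - t), so `c` is the required cosh s
  -- and `τ` the required t. The triangle inequality puts them in the admissible ranges; θ is the
  -- argument of the transverse part.
  set c := (A + B) / (2 * a) with hc
  set τ := (A - B) / (2 * a) with hτ
  have hca : 2 * a * c = A + B := by rw [hc]; field_simp
  have hτa : 2 * a * τ = A - B := by rw [hτ]; field_simp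
  have hτm : τ ∈ Icc (-1 : ℝ) 1 := by
    rw [mem_Icc, ← abs_le, hτ, abs_div, abs_of_pos (by linarith : 0 < 2 * a)]
    exact (div_le_one (by linarith)).2 hAB
  have hsc : 0 ≤ c ^ 2 - 1 := by nlinarith
  refine ⟨Real.arsinh √(c ^ 2 - 1), τ, (⟨Y, Z⟩ : ℂ).arg,
    Real.arsinh_nonneg_iff.2 (Real.sqrt_nonneg _), hτm, Complex.arg_mem_Ioc _, ?_⟩
  have hcosh : Real.cosh (Real.arsinh √(c ^ 2 - 1)) = c := by
    rw [Real.cosh_arsinh, Real.sq_sqrt hsc, add_sub_cancel, Real.sqrt_sq (by linarith)]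
  have hX : a * (c * τ) = X := by
    have : (2 * a * c) * (2 * a * τ) = 4 * a * X := by
      rw [hca, hτa]; linear_combination hA2 - hB2
    have h4 : (4 * a) * (a * (c * τ)) = (4 * a) * X := by linear_combination this
    exact mul_left_cancel₀ (by positivity) h4
  have hR : a * (√(c ^ 2 - 1) * √(1 - τ ^ 2)) = ‖(⟨Y, Z⟩ : ℂ)‖ := by
    rw [← Real.sqrt_mul hsc, ← sq_eq_sq₀ (by positivity) (norm_nonneg _), mul_pow,
      Real.sq_sqrt (mul_nonneg hsc (one_sub_sq_nonneg hτm)), Complex.sq_norm, Complex.normSq_mk]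
    have h1 : (2 * a * c) ^ 2 + (2 * a * τ) ^ 2 = 2 * (A ^ 2 + B ^ 2) := by rw [hca, hτa]; ring
    rw [hA2, hB2] at h1
    have h2 : (a * (c * τ)) ^ 2 = X ^ 2 := by rw [hX]
    linear_combination h1 / 4 - h2
  have hcos := Complex.norm_mul_cos_arg (⟨Y, Z⟩ : ℂ)
  have hsin := Complex.norm_mul_sin_arg (⟨Y, Z⟩ : ℂ)
  have hξ : ξ = m + comb b X Y Z := by rw [← hv]; abel
  rw [prolate, hcosh, Real.sinh_arsinh, ← mul_assoc a _ (Real.cos _), ← mul_assoc a _ (Real.sin _),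
    hR, hX, hcos, hsin, hξ]

/-- The two focal distances determine cosh s + t and cosh s - t, hence t and, by positivity, s. Away
from the axis the transverse radius is positive and the angle can be read off. -/
theorem prolate_injective (ha : 0 < a) {s' t' θ' : ℝ} (hs : 0 < s) (hs' : 0 < s')
    (ht : t ∈ Ioo (-1 : ℝ) 1) (ht' : t' ∈ Ioo (-1 : ℝ) 1) (hθ : θ ∈ Ioc (-Real.pi) Real.pi)
    (hθ' : θ' ∈ Ioc (-Real.pi) Real.pi) (h : prolate b m a s t θ = prolate b m a s' t' θ') :
    s = s' ∧ t = t' ∧ θ = θ' := by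
  have h1 := norm_prolate_sub_left b (m := m) (s := s) (θ := θ) ha (Ioo_subset_Icc_self ht)
  have h2 := norm_prolate_sub_right b (m := m) (s := s) (θ := θ) ha (Ioo_subset_Icc_self ht)
  rw [h, norm_prolate_sub_left b ha (Ioo_subset_Icc_self ht')] at h1
  rw [h, norm_prolate_sub_right b ha (Ioo_subset_Icc_self ht')] at h2
  have h3 := mul_left_cancel₀ ha.ne' h1
  have h4 := mul_left_cancel₀ ha.ne' h2
  have htt : t = t' := by linarith
  have hcc : Real.cosh s = Real.cosh s' := by linarith
  have hss : s = s' := by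
    have h6 := Real.cosh_le_cosh.1 hcc.le
    have h7 := Real.cosh_le_cosh.1 hcc.ge
    rw [abs_of_pos hs, abs_of_pos hs'] at h6 h7
    exact le_antisymm h6 h7
  subst htt hss
  refine ⟨rfl, rfl, ?_⟩
  have h5 := comb_inj b (add_left_cancel h)
  have hpos : 0 < a * (Real.sinh s * √(1 - t ^ 2)) :=
    mul_pos ha (mul_pos (Real.sinh_pos_iff.2 hs)
      (Real.sqrt_pos.2 (by nlinarith [ht.1, ht.2])))
  have hcos : Real.cos θ = Real.cos θ' := by
    have := h5.2.1
    exact mul_left_cancel₀ hpos.ne' (by linear_combination this)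
  have hsin : Real.sin θ = Real.sin θ' := by
    have := h5.2.2
    exact mul_left_cancel₀ hpos.ne' (by linear_combination this)
  have h6 := Complex.arg_cos_add_sin_mul_I hθ
  rw [← Complex.ofReal_cos, ← Complex.ofReal_sin, hcos, hsin, Complex.ofReal_cos,
    Complex.ofReal_sin, Complex.arg_cos_add_sin_mul_I hθ'] at h6
  exact h6.symm

end Prolate


/-! ### The outer unit normal -/

section Normal

open Set

variable {Ω : Set E3} {ξ z : E3} {U : Set E3} {ρ : E3 → ℝ}

theorem IsLocalDefiningFunction.contDiffAt (h : IsLocalDefiningFunction Ω ξ U ρ) (hz : z ∈ U) :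
    ContDiffAt ℝ ((⊤ : ℕ∞) : WithTop ℕ∞) ρ z :=
  h.smooth.contDiffAt (h.isOpen.mem_nhds hz)

theorem IsLocalDefiningFunction.hasFDerivAt (h : IsLocalDefiningFunction Ω ξ U ρ) (hz : z ∈ U) :
    HasFDerivAt ρ (fderiv ℝ ρ z) z :=
  ((h.contDiffAt hz).differentiableAt (by simp)).hasFDerivAt

/-- A positive value would persist in a neighbourhood and keep z out of the closure; a negative
value would put z into Ω, which is disjoint from its frontier. -/
theorem IsLocalDefiningFunction.eq_zero (h : IsLocalDefiningFunction Ω ξ U ρ) (hΩ : IsOpen Ω)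
    (hz : z ∈ U) (hzf : z ∈ frontier Ω) : ρ z = 0 := by
  rw [hΩ.frontier_eq] at hzf
  apply le_antisymm
  · by_contra! hpos
    have hev : ∀ᶠ w in 𝓝 z, w ∈ U ∧ 0 < ρ w :=
      (h.isOpen.eventually_mem hz).and ((h.contDiffAt hz).continuousAt.eventually (lt_mem_nhds hpos))
    obtain ⟨w, hw, hwΩ⟩ := mem_closure_iff_nhds.1 hzf.1 _ hev
    have : w ∈ {z | z ∈ U ∧ ρ z < 0} := h.eq_neg ▸ ⟨hwΩ, hw.1⟩
    linarith [this.2, hw.2]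
  · by_contra! hneg
    have : z ∈ Ω ∩ U := by rw [h.eq_neg]; exact ⟨hz, hneg⟩
    exact hzf.2 this.1

theorem eventually_lt_of_hasFDerivAt_neg {L : E3 →L[ℝ] ℝ} {v : E3} (h : HasFDerivAt ρ L z)
    (hv : L v < 0) : ∀ᶠ t : ℝ in 𝓝[>] 0, ρ (z + t • v) < ρ z := by
  have hd : HasDerivAt (fun t : ℝ => ρ (z + t • v)) (L v) 0 := by
    have h1 : HasDerivAt (fun t : ℝ => z + t • v) v 0 := by
      simpa using ((hasDerivAt_id (0 : ℝ)).smul_const v).const_add z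
    have h2 : HasFDerivAt ρ L (z + (0 : ℝ) • v) := by simpa using h
    exact h2.comp_hasDerivAt (0 : ℝ) h1
  have hs := (hasDerivAt_iff_tendsto_slope.1 hd).mono_left
    (nhdsWithin_mono 0 (fun t (ht : (0 : ℝ) < t) => (ne_of_gt ht : t ≠ 0)))
  filter_upwards [hs.eventually (gt_mem_nhds hv), self_mem_nhdsWithin] with t ht ht0
  have ht0' : (0 : ℝ) < t := ht0
  rw [slope_def_field] at ht
  simp only [zero_smul, add_zero, sub_zero] at ht
  rw [div_lt_iff₀ ht0'] at ht
  linarith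

/-- A nonvanishing derivative provides a direction of descent, along which points of Ω approach z.
-/
theorem IsLocalDefiningFunction.mem_frontier (h : IsLocalDefiningFunction Ω ξ U ρ)
    (hΩ : IsOpen Ω) (hz : z ∈ U) (hzρ : ρ z = 0) : z ∈ frontier Ω := by
  rw [hΩ.frontier_eq]
  refine ⟨?_, fun hzΩ => ?_⟩
  · obtain ⟨v, hv⟩ : ∃ v, fderiv ℝ ρ z v < 0 := by
      by_contra! hall
      refine h.regular z hz (ContinuousLinearMap.ext fun v => le_antisymm ?_ (hall v))
      have := hall (-v)
      rw [map_neg] at this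
      simpa using this
    have h1 := eventually_lt_of_hasFDerivAt_neg (h.hasFDerivAt hz) hv
    have hcont : Tendsto (fun t : ℝ => z + t • v) (𝓝[>] 0) (𝓝 z) := by
      have : Continuous fun t : ℝ => z + t • v := by fun_prop
      simpa using (this.tendsto 0).mono_left nhdsWithin_le_nhds
    refine mem_closure_of_tendsto hcont ?_
    filter_upwards [h1, hcont.eventually (h.isOpen.mem_nhds hz)] with t ht htU
    have : z + t • v ∈ Ω ∩ U := by rw [h.eq_neg]; exact ⟨htU, hzρ ▸ ht⟩
    exact this.1
  · have : z ∈ {z | z ∈ U ∧ ρ z < 0} := h.eq_neg ▸ ⟨hzΩ, hz⟩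
    linarith [this.2]

/-- The gradient of a defining function of a convex set is an outer normal. -/
theorem IsLocalDefiningFunction.fderiv_sub_nonpos (h : IsLocalDefiningFunction Ω ξ U ρ)
    (hΩ : IsOpen Ω) (hconv : Convex ℝ Ω) (hξ : ξ ∈ frontier Ω) (hz : z ∈ Ω) :
    fderiv ℝ ρ ξ (z - ξ) ≤ 0 := by
  by_contra! hpos
  have hd := h.hasFDerivAt h.mem
  have h1 := eventually_lt_of_hasFDerivAt_neg hd.neg (v := z - ξ) (by simpa using hpos)
  have hcont : Tendsto (fun t : ℝ => ξ + t • (z - ξ)) (𝓝[>] 0) (𝓝 ξ) := by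
    have : Continuous fun t : ℝ => ξ + t • (z - ξ) := by fun_prop
    simpa using (this.tendsto 0).mono_left nhdsWithin_le_nhds
  obtain ⟨t, ht, htU, ht01⟩ := (h1.and ((hcont.eventually (h.isOpen.mem_nhds h.mem)).and
    (Ioo_mem_nhdsGT (zero_lt_one' ℝ)))).exists
  -- The segment from a boundary point to a point of the open convex set lies in Ω except for its
  -- end ξ, whereas a positive derivative of ρ towards z would make ρ positive on it near ξ.
  have hmem : ξ + t • (z - ξ) ∈ Ω := by
    have := hconv.combo_interior_closure_mem_interior (hΩ.interior_eq.symm ▸ hz)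
      (frontier_subset_closure hξ) ht01.1 (sub_nonneg.2 ht01.2.le) (by ring)
    rw [hΩ.interior_eq] at this
    convert this using 1
    module
  have : ξ + t • (z - ξ) ∈ {z | z ∈ U ∧ ρ z < 0} := h.eq_neg ▸ ⟨hmem, htU⟩
  simp only [Pi.neg_apply, h.eq_zero hΩ h.mem hξ] at ht
  linarith [this.2]

/-- Since `outerUnitNormal` is selected by choice, the defining function behind the selection has to
be recovered. Later arguments know the normal only through this formula for a derivative. -/
theorem exists_localDefiningFunction_fderiv_eq (hsm : HasSmoothBoundary Ω)
    (hξ : ξ ∈ frontier Ω) : ∃ (U : Set E3) (ρ : E3 → ℝ) (k : ℝ), IsLocalDefiningFunction Ω ξ U ρ ∧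
      0 < k ∧ (∀ v, fderiv ℝ ρ ξ v = k * ⟪outerUnitNormal Ω ξ, v⟫_ℝ) ∧
      ‖outerUnitNormal Ω ξ‖ = 1 := by
  obtain ⟨U₀, ρ₀, h₀⟩ := hsm ξ hξ
  have hex : ∃ n, IsOuterUnitNormal Ω ξ n := ⟨_, U₀, ρ₀, h₀, rfl⟩
  have hn : outerUnitNormal Ω ξ = hex.choose := by
    rw [outerUnitNormal, dif_pos hex]
  obtain ⟨U, ρ, h, hρ⟩ := hex.choose_spec
  rw [← hn] at hρ
  have hg : gradient ρ ξ ≠ 0 := by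
    intro h0
    apply h.regular ξ h.mem
    rwa [gradient, LinearIsometryEquiv.map_eq_zero_iff] at h0
  have hg0 : 0 < ‖gradient ρ ξ‖ := norm_pos_iff.2 hg
  refine ⟨U, ρ, ‖gradient ρ ξ‖, h, hg0, fun v => ?_, ?_⟩
  · rw [hρ, real_inner_smul_left, ← mul_assoc, mul_inv_cancel₀ hg0.ne', one_mul, gradient,
      InnerProductSpace.toDual_symm_apply]
  · rw [hρ, norm_smul, norm_inv, norm_norm, inv_mul_cancel₀ hg0.ne']

theorem norm_outerUnitNormal (hsm : HasSmoothBoundary Ω) (hξ : ξ ∈ frontier Ω) :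
    ‖outerUnitNormal Ω ξ‖ = 1 :=
  (exists_localDefiningFunction_fderiv_eq hsm hξ).choose_spec.choose_spec.choose_spec.2.2.2

/-- This is the supporting half-space at ξ, obtained on Ω from the defining function and extended to
the closure by continuity. -/
theorem inner_sub_outerUnitNormal_nonpos (hΩ : IsOpen Ω) (hconv : Convex ℝ Ω)
    (hsm : HasSmoothBoundary Ω) (hξ : ξ ∈ frontier Ω) (hz : z ∈ closure Ω) :
    ⟪outerUnitNormal Ω ξ, z - ξ⟫_ℝ ≤ 0 := by
  obtain ⟨U, ρ, k, h, hk, hfd, -⟩ := exists_localDefiningFunction_fderiv_eq hsm hξ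
  have hcl : IsClosed {z : E3 | ⟪outerUnitNormal Ω ξ, z - ξ⟫_ℝ ≤ 0} :=
    isClosed_le (by fun_prop) continuous_const
  refine closure_minimal (fun w hw => ?_) hcl hz
  have := h.fderiv_sub_nonpos hΩ hconv hξ hw
  rw [hfd] at this
  exact nonpos_of_mul_nonpos_right this hk

/-- A ball is connected and this one does not meet the frontier, so it cannot leave Ω. -/
theorem ball_subset_of_le_infDist (hΩ : IsOpen Ω) {x : E3} (hx : x ∈ Ω) {r : ℝ}
    (hr : r ≤ Metric.infDist x (frontier Ω)) : Metric.ball x r ⊆ Ω := by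
  rcases le_or_gt r 0 with h0 | h0
  · rw [Metric.ball_eq_empty.2 h0]; exact empty_subset _
  have hpre : IsPreconnected (Metric.ball x r) := (convex_ball x r).isPreconnected
  refine hpre.subset_left_of_subset_union hΩ isClosed_closure.isOpen_compl
    (disjoint_compl_right.mono_left subset_closure) (fun z hz => ?_)
    ⟨x, Metric.mem_ball_self h0, hx⟩
  by_contra hcon
  rw [mem_union, not_or, notMem_compl_iff] at hcon
  have hzf : z ∈ frontier Ω := by rw [hΩ.frontier_eq]; exact ⟨hcon.2, hcon.1⟩
  have h1 := Metric.infDist_le_dist_of_mem (x := x) hzf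
  have h2 := Metric.mem_ball'.1 hz
  linarith

theorem lt_norm_sub_of_mem_innerDomain {ε : ℝ} {x : E3} (hx : x ∈ innerDomain Ω ε)
    (hξ : ξ ∈ frontier Ω) : ε < ‖ξ - x‖ := by
  have := Metric.infDist_le_dist_of_mem (x := x) hξ
  rw [dist_eq_norm, norm_sub_rev] at this
  exact hx.2.trans_le this

/-- The point x + ε n still belongs to Ω, hence to the supporting half-space at ξ. This is the
quantitative transversality through which ε enters all bounds on the boundary parametrization. -/
theorem le_inner_outerUnitNormal {ε : ℝ} {x : E3} (hΩ : IsOpen Ω) (hconv : Convex ℝ Ω)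
    (hsm : HasSmoothBoundary Ω) (hε : 0 < ε) (hx : x ∈ innerDomain Ω ε) (hξ : ξ ∈ frontier Ω) :
    ε ≤ ⟪outerUnitNormal Ω ξ, ξ - x⟫_ℝ := by
  have hn := norm_outerUnitNormal hsm hξ
  have hmem : x + ε • outerUnitNormal Ω ξ ∈ closure Ω := by
    refine subset_closure (ball_subset_of_le_infDist hΩ hx.1 le_rfl ?_)
    rw [Metric.mem_ball, dist_eq_norm, add_sub_cancel_left, norm_smul, hn, mul_one,
      Real.norm_of_nonneg hε.le]
    exact hx.2
  have h := inner_sub_outerUnitNormal_nonpos hΩ hconv hsm hξ hmem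
  have h2 : ⟪outerUnitNormal Ω ξ, outerUnitNormal Ω ξ⟫_ℝ = 1 := by
    rw [real_inner_self_eq_norm_sq, hn]; norm_num
  rw [show x + ε • outerUnitNormal Ω ξ - ξ = ε • outerUnitNormal Ω ξ - (ξ - x) by abel,
    inner_sub_right, real_inner_smul_right, h2] at h
  linarith

end Normal


/-! ### The boundary in prolate spheroidal coordinates -/

section Radius

open Set

/-- A convex domain together with prolate spheroidal coordinates whose foci lie well inside. -/
structure BipolarFrame (Ω : Set E3) (ε : ℝ) (b : OrthonormalBasis (Fin 3) ℝ E3) (m : E3)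
    (a : ℝ) : Prop where
  isOpen : IsOpen Ω
  isBounded : Bornology.IsBounded Ω
  convex : Convex ℝ Ω
  smooth : HasSmoothBoundary Ω
  eps_pos : 0 < ε
  pos : 0 < a
  left_mem : m - a • b 0 ∈ innerDomain Ω ε
  right_mem : m + a • b 0 ∈ innerDomain Ω ε

open Classical in
/-- The coordinate `s` of the boundary point with the other coordinates `t` and `θ`. -/
def radius (Ω : Set E3) (b : OrthonormalBasis (Fin 3) ℝ E3) (m : E3) (a : ℝ) (p : ℝ × ℝ) : ℝ :=
  if h : ∃ s, 0 < s ∧ prolate b m a s p.1 p.2 ∈ frontier Ω then h.choose else 0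

/-- The boundary point with given coordinates `t` and `θ`. -/
def boundaryPoint (Ω : Set E3) (b : OrthonormalBasis (Fin 3) ℝ E3) (m : E3) (a : ℝ) (p : ℝ × ℝ) :
    E3 := prolate b m a (radius Ω b m a p) p.1 p.2

variable {Ω : Set E3} {ε : ℝ} {b : OrthonormalBasis (Fin 3) ℝ E3} {m : E3} {a : ℝ}

namespace BipolarFrame

variable {s t θ : ℝ}

theorem segment_mem (H : BipolarFrame Ω ε b m a) {r : ℝ} (hr : r ∈ Icc (-1 : ℝ) 1) :
    m + (a * r) • b 0 ∈ Ω := by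
  have := H.convex H.left_mem.1 H.right_mem.1 (by linarith [hr.2] : 0 ≤ (1 - r) / 2)
    (by linarith [hr.1] : 0 ≤ (1 + r) / 2) (by ring)
  convert this using 1
  module

/-- The earlier point is a proper convex combination of a later one in the closure and a point of
the focal segment, which is interior. Hence a coordinate curve cannot meet the boundary twice. -/
theorem prolate_mem (H : BipolarFrame Ω ε b m a) {s' : ℝ} (hs' : 0 ≤ s') (hs : s' < s)
    (ht : t ∈ Icc (-1 : ℝ) 1) (hmem : prolate b m a s t θ ∈ closure Ω) :
    prolate b m a s' t θ ∈ Ω := by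
  obtain ⟨γ, r, hγ0, hγ1, hr, heq⟩ :=
    exists_prolate_eq_combination b (m := m) (a := a) (θ := θ) hs' hs ht
  rw [heq]
  have := H.convex.combo_interior_closure_mem_interior
    (H.isOpen.interior_eq.symm ▸ H.segment_mem hr) hmem (sub_pos.2 hγ1) hγ0 (by ring)
  rwa [H.isOpen.interior_eq] at this

theorem exists_prolate_mem_frontier (H : BipolarFrame Ω ε b m a) (ht : t ∈ Icc (-1 : ℝ) 1) (θ : ℝ) :
    ∃ s, 0 < s ∧ prolate b m a s t θ ∈ frontier Ω := by
  -- The boundary point is the last exit: the curve starts on the focal segment inside Ω, the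
  -- parameters in `A` are bounded because s ≤ cosh s and Ω is bounded, and openness prevents the
  -- supremum from being attained.
  set A : Set ℝ := {s | 0 ≤ s ∧ prolate b m a s t θ ∈ Ω} with hA
  have hcont := continuous_prolate_left b (m := m) (a := a) (t := t) (θ := θ)
  have h0 : (0 : ℝ) ∈ A := by
    refine ⟨le_rfl, ?_⟩
    have : prolate b m a 0 t θ = m + (a * t) • b 0 := by simp [prolate, comb]
    rw [this]
    exact H.segment_mem ht
  obtain ⟨R, hR⟩ := H.isBounded.subset_closedBall (m - a • b 0)
  have hbdd : BddAbove A := by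
    refine ⟨R / a + 1, fun s hs => ?_⟩
    have h1 := hR hs.2
    rw [Metric.mem_closedBall, dist_eq_norm, norm_prolate_sub_left b H.pos ht] at h1
    have h2 : Real.cosh s + t ≤ R / a := by rw [le_div_iff₀ H.pos]; linarith
    have h3 : s ≤ Real.cosh s := by
      have h4 := Real.self_le_sinh_iff.2 hs.1
      have h5 := Real.sinh_lt_cosh s
      linarith
    linarith [ht.1]
  have hcl : sSup A ∈ closure A := csSup_mem_closure ⟨0, h0⟩ hbdd
  have hclΩ : prolate b m a (sSup A) t θ ∈ closure Ω :=
    map_mem_closure (f := fun s => prolate b m a s t θ) hcont hcl fun s hs => hs.2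
  have hnot : prolate b m a (sSup A) t θ ∉ Ω := by
    intro hmem
    have hev := (hcont.tendsto (sSup A)).eventually (H.isOpen.mem_nhds hmem)
    obtain ⟨u, hu, hsub⟩ := (mem_nhds_iff_exists_Ioo_subset.1 hev)
    obtain ⟨v, hv1, hv2⟩ := exists_between hsub.1.2
    have : v ∈ A := ⟨(le_csSup hbdd h0).trans hv1.le, hsub.2 ⟨hsub.1.1.trans hv1, hv2⟩⟩
    exact absurd (le_csSup hbdd this) (not_le.2 hv1)
  refine ⟨sSup A, lt_of_le_of_ne (le_csSup hbdd h0) ?_, ?_⟩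
  · intro heq
    exact hnot (heq ▸ h0.2)
  · rw [H.isOpen.frontier_eq]
    exact ⟨hclΩ, hnot⟩

theorem eq_of_prolate_mem_frontier (H : BipolarFrame Ω ε b m a) (ht : t ∈ Icc (-1 : ℝ) 1)
    {s s' : ℝ} (hs : 0 < s) (hs' : 0 < s') (h : prolate b m a s t θ ∈ frontier Ω)
    (h' : prolate b m a s' t θ ∈ frontier Ω) : s = s' := by
  have key : ∀ {u v : ℝ}, 0 < u → u < v → prolate b m a u t θ ∈ frontier Ω →
      prolate b m a v t θ ∈ frontier Ω → False := by
    intro u v hu huv h1 h2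
    have := H.prolate_mem hu.le huv ht (frontier_subset_closure h2)
    rw [H.isOpen.frontier_eq] at h1
    exact h1.2 this
  rcases lt_trichotomy s s' with hlt | heq | hlt
  · exact (key hs hlt h h').elim
  · exact heq
  · exact (key hs' hlt h' h).elim

theorem radius_spec (H : BipolarFrame Ω ε b m a) {p : ℝ × ℝ} (hp : p.1 ∈ Icc (-1 : ℝ) 1) :
    0 < radius Ω b m a p ∧ boundaryPoint Ω b m a p ∈ frontier Ω := by
  have h := H.exists_prolate_mem_frontier hp p.2
  have : radius Ω b m a p = h.choose := by rw [radius, dif_pos h]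
  rw [boundaryPoint, this]
  exact h.choose_spec

theorem radius_eq (H : BipolarFrame Ω ε b m a) {p : ℝ × ℝ} (hp : p.1 ∈ Icc (-1 : ℝ) 1)
    (hs : 0 < s) (h : prolate b m a s p.1 p.2 ∈ frontier Ω) : radius Ω b m a p = s :=
  H.eq_of_prolate_mem_frontier hp (H.radius_spec hp).1 hs (H.radius_spec hp).2 h

end BipolarFrame

/-! ### Derivatives -/

/-- The derivative of the prolate coordinates in `s`. -/
def prolateDs (b : OrthonormalBasis (Fin 3) ℝ E3) (a s t θ : ℝ) : E3 :=
  comb b (a * (Real.sinh s * t)) (a * (Real.cosh s * √(1 - t ^ 2) * Real.cos θ))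
    (a * (Real.cosh s * √(1 - t ^ 2) * Real.sin θ))

/-- The derivative of the prolate coordinates in `t`. -/
def prolateDt (b : OrthonormalBasis (Fin 3) ℝ E3) (a s t θ : ℝ) : E3 :=
  comb b (a * Real.cosh s) (a * (Real.sinh s * (-t / √(1 - t ^ 2)) * Real.cos θ))
    (a * (Real.sinh s * (-t / √(1 - t ^ 2)) * Real.sin θ))

/-- The derivative of the prolate coordinates in `θ`. -/
def prolateDθ (b : OrthonormalBasis (Fin 3) ℝ E3) (a s t θ : ℝ) : E3 :=
  comb b 0 (a * (Real.sinh s * √(1 - t ^ 2) * -Real.sin θ))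
    (a * (Real.sinh s * √(1 - t ^ 2) * Real.cos θ))

theorem one_sub_sq_pos {t : ℝ} (ht : t ∈ Ioo (-1 : ℝ) 1) : 0 < 1 - t ^ 2 := by
  nlinarith [ht.1, ht.2]

theorem hasDerivAt_prolate {s t θ : ℝ → ℝ} {s' t' θ' u : ℝ} (hs : HasDerivAt s s' u)
    (ht : HasDerivAt t t' u) (hθ : HasDerivAt θ θ' u) (htu : t u ∈ Ioo (-1 : ℝ) 1) :
    HasDerivAt (fun v => prolate b m a (s v) (t v) (θ v))
      (s' • prolateDs b a (s u) (t u) (θ u) + t' • prolateDt b a (s u) (t u) (θ u) +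
        θ' • prolateDθ b a (s u) (t u) (θ u)) u := by
  have hq : HasDerivAt (fun v => √(1 - t v ^ 2)) (t' * (-t u / √(1 - t u ^ 2))) u := by
    have h1 : HasDerivAt (fun v => 1 - t v ^ 2) (-(2 * t u * t')) u := by
      simpa using (ht.pow 2).const_sub 1
    have h2 := h1.sqrt (one_sub_sq_pos htu).ne'
    convert h2 using 1
    field_simp
  have h0 := ((hs.cosh.mul ht).const_mul a).smul_const (b 0)
  have h1 := (((hs.sinh.mul hq).mul hθ.cos).const_mul a).smul_const (b 1)
  have h2 := (((hs.sinh.mul hq).mul hθ.sin).const_mul a).smul_const (b 2)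
  have h := ((h0.add h1).add h2).const_add m
  refine (h.congr_deriv ?_)
  simp only [prolateDs, prolateDt, prolateDθ, comb, Pi.mul_apply]
  module

/-- The prolate coordinates as a function of all variables. -/
def prolateMap (b : OrthonormalBasis (Fin 3) ℝ E3) (m : E3) (a : ℝ) (u : (ℝ × ℝ) × ℝ) : E3 :=
  prolate b m a u.2 u.1.1 u.1.2

theorem contDiffAt_prolateMap {u : (ℝ × ℝ) × ℝ} (hu : u.1.1 ∈ Ioo (-1 : ℝ) 1) {n : WithTop ℕ∞} :
    ContDiffAt ℝ n (prolateMap b m a) u := by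
  have hq : ContDiffAt ℝ n (fun u : (ℝ × ℝ) × ℝ => √(1 - u.1.1 ^ 2)) u := by
    refine ContDiffAt.sqrt ?_ (one_sub_sq_pos hu).ne'
    fun_prop
  have hc : ContDiffAt ℝ n (fun u : (ℝ × ℝ) × ℝ => Real.cosh u.2) u :=
    Real.contDiff_cosh.contDiffAt.comp u contDiffAt_snd
  have hs : ContDiffAt ℝ n (fun u : (ℝ × ℝ) × ℝ => Real.sinh u.2) u :=
    Real.contDiff_sinh.contDiffAt.comp u contDiffAt_snd
  unfold prolateMap prolate comb
  fun_prop

/-- For a real last variable, invertibility of the partial derivative in the implicit function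
theorem amounts to the scalar c being nonzero. -/
theorem exists_contDiffAt_implicit {f : (ℝ × ℝ) × ℝ → ℝ} {p : ℝ × ℝ} {s₀ c : ℝ}
    (hcd : ContDiffAt ℝ ((⊤ : ℕ∞) : WithTop ℕ∞) f (p, s₀))
    (hds : HasDerivAt (fun s => f (p, s)) c s₀) (hc : c ≠ 0) (h0 : f (p, s₀) = 0) :
    ∃ ψ : ℝ × ℝ → ℝ, ContDiffAt ℝ ((⊤ : ℕ∞) : WithTop ℕ∞) ψ p ∧ ψ p = s₀ ∧
      ∀ᶠ q in 𝓝 p, f (q, ψ q) = 0 := by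
  have hinv : (fderiv ℝ f (p, s₀) ∘L .inr ℝ (ℝ × ℝ) ℝ).IsInvertible := by
    have h4 : HasFDerivAt f (fderiv ℝ f (p, s₀)) (p, s₀) :=
      (hcd.differentiableAt (by simp)).hasFDerivAt
    have h3 : HasDerivAt (fun s => f (p, s)) ((fderiv ℝ f (p, s₀)) (0, 1)) s₀ :=
      HasFDerivAt.comp_hasDerivAt (f := fun s => (p, s)) s₀ h4
        ((hasDerivAt_const _ p).prodMk (hasDerivAt_id s₀))
    have h5 := h3.unique hds
    refine ⟨ContinuousLinearEquiv.unitsEquivAut ℝ (Units.mk0 _ hc), ?_⟩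
    ext
    simp [h5]
  have hn : ((⊤ : ℕ∞) : WithTop ℕ∞) ≠ 0 := by simp
  refine ⟨hcd.implicitFunction hn hinv, hcd.contDiffAt_implicitFunction hn hinv,
    hcd.implicitFunction_apply_self hn hinv, ?_⟩
  have := hcd.eventually_apply_implicitFunction hn hinv
  rwa [h0] at this

namespace BipolarFrame

/-- After multiplication by sinh s, the outward coordinate direction is a combination of the vectors
from the two foci, with coefficients that are nonnegative for |t| ≤ 1. Lower bounds for the normal
components of those two vectors thus pass to the coordinate direction. -/
theorem sinh_mul_inner_prolateDs {s t θ : ℝ} (n : E3) :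
    Real.sinh s * ⟪n, prolateDs b a s t θ⟫_ℝ =
      ((Real.cosh s - t) * ⟪n, prolate b m a s t θ - (m - a • b 0)⟫_ℝ +
        (Real.cosh s + t) * ⟪n, prolate b m a s t θ - (m + a • b 0)⟫_ℝ) / 2 := by
  have h : Real.sinh s • prolateDs b a s t θ =
      ((Real.cosh s - t) / 2) • (prolate b m a s t θ - (m - a • b 0)) +
        ((Real.cosh s + t) / 2) • (prolate b m a s t θ - (m + a • b 0)) := by
    have h2 := Real.cosh_sq s
    simp only [prolateDs, prolate, comb]
    match_scalars
    · linear_combination (-a * t) * h2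
    · ring
    · ring
    · ring
  rw [← real_inner_smul_right, h, inner_add_right, real_inner_smul_right, real_inner_smul_right]
  ring

/-- The normal component of the outward coordinate direction is bounded below. -/
theorem le_inner_prolateDs (H : BipolarFrame Ω ε b m a) {p : ℝ × ℝ} (hp : p.1 ∈ Icc (-1 : ℝ) 1) :
    ε ≤ ⟪outerUnitNormal Ω (boundaryPoint Ω b m a p),
      prolateDs b a (radius Ω b m a p) p.1 p.2⟫_ℝ := by
  obtain ⟨hs, hf⟩ := H.radius_spec hp
  set s := radius Ω b m a p
  have h := sinh_mul_inner_prolateDs (b := b) (m := m) (a := a) (s := s) (t := p.1) (θ := p.2)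
    (outerUnitNormal Ω (boundaryPoint Ω b m a p))
  have hx := le_inner_outerUnitNormal H.isOpen H.convex H.smooth H.eps_pos H.left_mem hf
  have hy := le_inner_outerUnitNormal H.isOpen H.convex H.smooth H.eps_pos H.right_mem hf
  have hbp : boundaryPoint Ω b m a p = prolate b m a s p.1 p.2 := rfl
  rw [← hbp] at h
  have hc1 : 1 ≤ Real.cosh s := Real.one_le_cosh s
  have hsp : 0 < Real.sinh s := Real.sinh_pos_iff.2 hs
  have hlt := Real.sinh_lt_cosh s
  -- The coefficients (cosh s - t)/2 and (cosh s + t)/2 add up to cosh s, which exceeds sinh s; the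
  -- factor sinh s can therefore be divided out without loss in ε.
  have hge : Real.cosh s * ε ≤ Real.sinh s * ⟪outerUnitNormal Ω (boundaryPoint Ω b m a p),
      prolateDs b a s p.1 p.2⟫_ℝ := by
    rw [h]
    nlinarith [mul_le_mul_of_nonneg_left hx (by linarith [hp.2] : 0 ≤ Real.cosh s - p.1),
      mul_le_mul_of_nonneg_left hy (by linarith [hp.1] : 0 ≤ Real.cosh s + p.1)]
  have h3 : Real.sinh s * ε ≤ Real.sinh s * ⟪outerUnitNormal Ω (boundaryPoint Ω b m a p),
      prolateDs b a s p.1 p.2⟫_ℝ := by nlinarith [H.eps_pos]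
  exact le_of_mul_le_mul_left h3 hsp

/-- The implicit function theorem applies to the defining function in prolate coordinates, since its
derivative in s is a positive multiple of the normal component bounded below by ε. Uniqueness of the
crossing identifies the implicit function with `radius`. -/
theorem contDiffAt_radius (H : BipolarFrame Ω ε b m a) {p : ℝ × ℝ} (hp : p.1 ∈ Ioo (-1 : ℝ) 1) :
    ContDiffAt ℝ ((⊤ : ℕ∞) : WithTop ℕ∞) (radius Ω b m a) p := by
  have hp' := Ioo_subset_Icc_self hp
  obtain ⟨hs, hf⟩ := H.radius_spec hp'
  obtain ⟨U, ρ, k, hρ, hk, hfd, -⟩ := exists_localDefiningFunction_fderiv_eq H.smooth hf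
  have hΦ : ContDiffAt ℝ ((⊤ : ℕ∞) : WithTop ℕ∞) (prolateMap b m a) (p, radius Ω b m a p) :=
    contDiffAt_prolateMap hp
  have hΦu : prolateMap b m a (p, radius Ω b m a p) = boundaryPoint Ω b m a p := rfl
  have hcd : ContDiffAt ℝ ((⊤ : ℕ∞) : WithTop ℕ∞) (fun u => ρ (prolateMap b m a u))
      (p, radius Ω b m a p) :=
    ContDiffAt.comp (p, radius Ω b m a p) (hΦu ▸ hρ.contDiffAt hρ.mem) hΦ
  have hds : HasDerivAt (fun s => ρ (prolateMap b m a (p, s)))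
      (k * ⟪outerUnitNormal Ω (boundaryPoint Ω b m a p),
        prolateDs b a (radius Ω b m a p) p.1 p.2⟫_ℝ) (radius Ω b m a p) := by
    have h1 := hasDerivAt_prolate (b := b) (m := m) (a := a)
      (hasDerivAt_id (radius Ω b m a p)) (hasDerivAt_const (radius Ω b m a p) p.1)
      (hasDerivAt_const (radius Ω b m a p) p.2) hp
    have h2 := (hρ.hasFDerivAt hρ.mem).comp_hasDerivAt (radius Ω b m a p) h1
    refine h2.congr_deriv ?_
    rw [hfd]
    simp
  have hpos : 0 < k * ⟪outerUnitNormal Ω (boundaryPoint Ω b m a p),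
      prolateDs b a (radius Ω b m a p) p.1 p.2⟫_ℝ :=
    mul_pos hk (H.eps_pos.trans_le (H.le_inner_prolateDs hp'))
  obtain ⟨ψ, hψ, hψ0, hψe⟩ := exists_contDiffAt_implicit hcd hds hpos.ne'
    (hρ.eq_zero H.isOpen hρ.mem hf)
  refine hψ.congr_of_eventuallyEq ?_
  have hc1 : Tendsto ψ (𝓝 p) (𝓝 (radius Ω b m a p)) := by
    have := hψ.continuousAt.tendsto
    rwa [hψ0] at this
  have hc2 : Tendsto (fun q : ℝ × ℝ => prolateMap b m a (q, ψ q))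
      (𝓝 p) (𝓝 (boundaryPoint Ω b m a p)) :=
    hΦ.continuousAt.tendsto.comp (tendsto_id.prodMk_nhds hc1)
  have hopen : ∀ᶠ q : ℝ × ℝ in 𝓝 p, q.1 ∈ Ioo (-1 : ℝ) 1 :=
    continuous_fst.continuousAt.eventually (isOpen_Ioo.mem_nhds hp)
  filter_upwards [hψe, hc1.eventually (lt_mem_nhds hs),
    hc2.eventually (hρ.isOpen.eventually_mem hρ.mem), hopen] with q hq1 hq2 hq3 hq4
  exact H.radius_eq (Ioo_subset_Icc_self hq4) hq2 (hρ.mem_frontier H.isOpen hq3 hq1)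

/-- The partial derivatives of the radius. -/
theorem hasDerivAt_radius (H : BipolarFrame Ω ε b m a) {t θ : ℝ} (ht : t ∈ Ioo (-1 : ℝ) 1) :
    HasDerivAt (fun t => radius Ω b m a (t, θ)) (fderiv ℝ (radius Ω b m a) (t, θ) (1, 0)) t ∧
    HasDerivAt (fun θ => radius Ω b m a (t, θ)) (fderiv ℝ (radius Ω b m a) (t, θ) (0, 1)) θ := by
  have h : HasFDerivAt (radius Ω b m a) (fderiv ℝ (radius Ω b m a) (t, θ)) (t, θ) :=
    ((H.contDiffAt_radius (p := (t, θ)) ht).differentiableAt (by simp)).hasFDerivAt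
  exact ⟨HasFDerivAt.comp_hasDerivAt (f := fun t => (t, θ)) t h
      ((hasDerivAt_id t).prodMk (hasDerivAt_const t θ)),
    HasFDerivAt.comp_hasDerivAt (f := fun θ => (t, θ)) θ h
      ((hasDerivAt_const θ t).prodMk (hasDerivAt_id θ))⟩

theorem contDiffAt_boundaryPoint (H : BipolarFrame Ω ε b m a) {p : ℝ × ℝ}
    (hp : p.1 ∈ Ioo (-1 : ℝ) 1) :
    ContDiffAt ℝ ((⊤ : ℕ∞) : WithTop ℕ∞) (boundaryPoint Ω b m a) p := by
  have h : ContDiffAt ℝ ((⊤ : ℕ∞) : WithTop ℕ∞) (prolateMap b m a) (p, radius Ω b m a p) :=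
    contDiffAt_prolateMap hp
  exact ContDiffAt.comp (f := fun p => (p, radius Ω b m a p)) p h
    (contDiffAt_id.prodMk (H.contDiffAt_radius hp))

theorem fderiv_boundaryPoint (H : BipolarFrame Ω ε b m a) {p : ℝ × ℝ} (hp : p.1 ∈ Ioo (-1 : ℝ) 1) :
    fderiv ℝ (boundaryPoint Ω b m a) p (1, 0) =
      prolateDt b a (radius Ω b m a p) p.1 p.2 + fderiv ℝ (radius Ω b m a) p (1, 0) •
        prolateDs b a (radius Ω b m a p) p.1 p.2 ∧
    fderiv ℝ (boundaryPoint Ω b m a) p (0, 1) =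
      prolateDθ b a (radius Ω b m a p) p.1 p.2 + fderiv ℝ (radius Ω b m a) p (0, 1) •
        prolateDs b a (radius Ω b m a p) p.1 p.2 := by
  obtain ⟨t, θ⟩ := p
  have h : HasFDerivAt (boundaryPoint Ω b m a) (fderiv ℝ (boundaryPoint Ω b m a) (t, θ)) (t, θ) :=
    ((H.contDiffAt_boundaryPoint (p := (t, θ)) hp).differentiableAt (by simp)).hasFDerivAt
  have h1 := HasFDerivAt.comp_hasDerivAt (f := fun t => (t, θ)) t h
    ((hasDerivAt_id t).prodMk (hasDerivAt_const t θ))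
  have h2 := HasFDerivAt.comp_hasDerivAt (f := fun θ => (t, θ)) θ h
    ((hasDerivAt_const θ t).prodMk (hasDerivAt_id θ))
  have h3 := hasDerivAt_prolate (b := b) (m := m) (a := a) (H.hasDerivAt_radius (θ := θ) hp).1
    (hasDerivAt_id t) (hasDerivAt_const t θ) hp
  have h4 := hasDerivAt_prolate (b := b) (m := m) (a := a) (H.hasDerivAt_radius (θ := θ) hp).2
    (hasDerivAt_const θ t) (hasDerivAt_id θ) hp
  refine ⟨(h1.unique h3).trans ?_, (h2.unique h4).trans ?_⟩
  · simp [add_comm]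
  · simp [add_comm]

/-- The defining function vanishes identically along the parametrized boundary, so the chain rule
makes its gradient orthogonal to all tangent vectors. -/
theorem inner_outerUnitNormal_fderiv_boundaryPoint (H : BipolarFrame Ω ε b m a) {p : ℝ × ℝ}
    (hp : p.1 ∈ Ioo (-1 : ℝ) 1) (v : ℝ × ℝ) :
    ⟪outerUnitNormal Ω (boundaryPoint Ω b m a p), fderiv ℝ (boundaryPoint Ω b m a) p v⟫_ℝ = 0 := by
  obtain ⟨hs, hf⟩ := H.radius_spec (Ioo_subset_Icc_self hp)
  obtain ⟨U, ρ, k, hρ, hk, hfd, -⟩ := exists_localDefiningFunction_fderiv_eq H.smooth hf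
  have hcd := H.contDiffAt_boundaryPoint hp
  have h : HasFDerivAt (ρ ∘ boundaryPoint Ω b m a) _ p :=
    (hρ.hasFDerivAt hρ.mem).comp p (hcd.differentiableAt (by simp)).hasFDerivAt
  have h0 : ρ ∘ boundaryPoint Ω b m a =ᶠ[𝓝 p] fun _ => 0 := by
    have hopen : ∀ᶠ q : ℝ × ℝ in 𝓝 p, q.1 ∈ Ioo (-1 : ℝ) 1 :=
      continuous_fst.continuousAt.eventually (isOpen_Ioo.mem_nhds hp)
    filter_upwards [hopen, hcd.continuousAt.eventually (hρ.isOpen.mem_nhds hρ.mem)] with q hq1 hq2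
    exact hρ.eq_zero H.isOpen hq2 (H.radius_spec (Ioo_subset_Icc_self hq1)).2
  have h1 := (h.congr_of_eventuallyEq h0.symm).unique (hasFDerivAt_const (0 : ℝ) p)
  have h2 := DFunLike.congr_fun h1 v
  simp only [ContinuousLinearMap.comp_apply, hfd, zero_apply] at h2
  exact (mul_eq_zero.1 h2).resolve_left hk.ne'

end BipolarFrame

end Radius


/-! ### Surface measure and arc length in prolate spheroidal coordinates -/

section SurfaceParametrization

open Set

variable {Ω : Set E3} {ε : ℝ} {b : OrthonormalBasis (Fin 3) ℝ E3} {m : E3} {a : ℝ}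

theorem one_add_one_le_top : (1 + 1 : WithTop ℕ∞) ≤ ((⊤ : ℕ∞) : WithTop ℕ∞) := by
  have : ((2 : ℕ∞) : WithTop ℕ∞) ≤ ((⊤ : ℕ∞) : WithTop ℕ∞) := WithTop.coe_le_coe.2 le_top
  exact (le_of_eq one_add_one_eq_two).trans this

/-- The parameter domain. -/
def paramDomain : Set (ℝ × ℝ) := Ioo (-1 : ℝ) 1 ×ˢ Ioc (-Real.pi) Real.pi

theorem measurableSet_paramDomain : MeasurableSet paramDomain :=
  measurableSet_Ioo.prod measurableSet_Ioc

/-- The area density of the boundary parametrization. -/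
def areaDensity (Ω : Set E3) (b : OrthonormalBasis (Fin 3) ℝ E3) (m : E3) (a : ℝ) (p : ℝ × ℝ) :
    ℝ :=
  areaFactor (fderiv ℝ (boundaryPoint Ω b m a) p (1, 0)) (fderiv ℝ (boundaryPoint Ω b m a) p (0, 1))

/-- The area density divided by the distances to the foci. -/
def weight (Ω : Set E3) (b : OrthonormalBasis (Fin 3) ℝ E3) (m : E3) (a : ℝ) (p : ℝ × ℝ) : ℝ :=
  areaDensity Ω b m a p /
    (‖boundaryPoint Ω b m a p - (m - a • b 0)‖ * ‖boundaryPoint Ω b m a p - (m + a • b 0)‖)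

/-! ### Gram matrix of the prolate coordinate directions -/

section Gram

variable (b a) (s t θ : ℝ)

theorem norm_sq_prolateDs (ht : t ∈ Ioo (-1 : ℝ) 1) :
    ‖prolateDs b a s t θ‖ ^ 2 = a ^ 2 * (Real.cosh s ^ 2 - t ^ 2) := by
  have h1 := Real.sq_sqrt (one_sub_sq_pos ht).le
  have h2 := Real.cosh_sq s
  have h3 := Real.sin_sq_add_cos_sq θ
  rw [prolateDs, norm_sq_comb]
  linear_combination (a ^ 2 * Real.cosh s ^ 2 * √(1 - t ^ 2) ^ 2) * h3 +
    (a ^ 2 * Real.cosh s ^ 2) * h1 - a ^ 2 * t ^ 2 * h2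

theorem norm_sq_prolateDt (ht : t ∈ Ioo (-1 : ℝ) 1) :
    ‖prolateDt b a s t θ‖ ^ 2 = a ^ 2 * (Real.cosh s ^ 2 - t ^ 2) / (1 - t ^ 2) := by
  have h0 := one_sub_sq_pos ht
  have h1 := Real.sq_sqrt h0.le
  have h2 := Real.cosh_sq s
  have h3 := Real.sin_sq_add_cos_sq θ
  rw [prolateDt, norm_sq_comb]
  have h4 : (-t / √(1 - t ^ 2)) ^ 2 = t ^ 2 / (1 - t ^ 2) := by rw [div_pow, h1, neg_sq]
  have h5 : a ^ 2 * (Real.cosh s ^ 2 - t ^ 2) / (1 - t ^ 2) =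
      a ^ 2 * Real.cosh s ^ 2 + a ^ 2 * Real.sinh s ^ 2 * (t ^ 2 / (1 - t ^ 2)) := by
    field_simp
    rw [h2]
    ring
  rw [h5, ← h4]
  linear_combination (a ^ 2 * Real.sinh s ^ 2 * (-t / √(1 - t ^ 2)) ^ 2) * h3

theorem norm_sq_prolateDθ (ht : t ∈ Ioo (-1 : ℝ) 1) :
    ‖prolateDθ b a s t θ‖ ^ 2 = a ^ 2 * (Real.sinh s ^ 2 * (1 - t ^ 2)) := by
  have h1 := Real.sq_sqrt (one_sub_sq_pos ht).le
  have h3 := Real.sin_sq_add_cos_sq θ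
  rw [prolateDθ, norm_sq_comb]
  linear_combination (a ^ 2 * Real.sinh s ^ 2 * √(1 - t ^ 2) ^ 2) * h3 +
    (a ^ 2 * Real.sinh s ^ 2) * h1

theorem inner_prolateDs_prolateDt (ht : t ∈ Ioo (-1 : ℝ) 1) :
    ⟪prolateDs b a s t θ, prolateDt b a s t θ⟫_ℝ = 0 := by
  have h0 : √(1 - t ^ 2) ≠ 0 := (Real.sqrt_pos.2 (one_sub_sq_pos ht)).ne'
  have h3 := Real.sin_sq_add_cos_sq θ
  have h4 : √(1 - t ^ 2) * (-t / √(1 - t ^ 2)) = -t := by field_simp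
  rw [prolateDs, prolateDt, inner_comb]
  linear_combination (a ^ 2 * Real.cosh s * Real.sinh s * (√(1 - t ^ 2) * (-t / √(1 - t ^ 2)))) *
    h3 + (a ^ 2 * Real.cosh s * Real.sinh s) * h4

theorem inner_prolateDs_prolateDθ : ⟪prolateDs b a s t θ, prolateDθ b a s t θ⟫_ℝ = 0 := by
  rw [prolateDs, prolateDθ, inner_comb]; ring

theorem inner_prolateDt_prolateDθ : ⟪prolateDt b a s t θ, prolateDθ b a s t θ⟫_ℝ = 0 := by
  rw [prolateDt, prolateDθ, inner_comb]; ring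

/-- Parseval's identity in the orthogonal frame of the coordinate directions. -/
theorem parseval_prolate (ht : t ∈ Ioo (-1 : ℝ) 1) (n : E3) :
    Real.sinh s ^ 2 * (⟪n, prolateDs b a s t θ⟫_ℝ ^ 2 +
        (1 - t ^ 2) * ⟪n, prolateDt b a s t θ⟫_ℝ ^ 2) * (1 - t ^ 2) +
      (Real.cosh s ^ 2 - t ^ 2) * ⟪n, prolateDθ b a s t θ⟫_ℝ ^ 2 =
      a ^ 2 * Real.sinh s ^ 2 * (1 - t ^ 2) * (Real.cosh s ^ 2 - t ^ 2) * ‖n‖ ^ 2 := by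
  obtain ⟨n₀, n₁, n₂, rfl⟩ := exists_eq_comb b n
  have h0 : √(1 - t ^ 2) ≠ 0 := (Real.sqrt_pos.2 (one_sub_sq_pos ht)).ne'
  have h1 := Real.sq_sqrt (one_sub_sq_pos ht).le
  have h2 := Real.cosh_sq s
  have h3 := Real.sin_sq_add_cos_sq θ
  have hA : ⟪comb b n₀ n₁ n₂, prolateDs b a s t θ⟫_ℝ = a * (Real.sinh s * t * n₀ +
      Real.cosh s * √(1 - t ^ 2) * (n₁ * Real.cos θ + n₂ * Real.sin θ)) := by
    rw [prolateDs, inner_comb]; ring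
  have hB : √(1 - t ^ 2) * ⟪comb b n₀ n₁ n₂, prolateDt b a s t θ⟫_ℝ =
      a * (√(1 - t ^ 2) * Real.cosh s * n₀ -
        Real.sinh s * t * (n₁ * Real.cos θ + n₂ * Real.sin θ)) := by
    rw [prolateDt, inner_comb]; field_simp; ring
  have hC : ⟪comb b n₀ n₁ n₂, prolateDθ b a s t θ⟫_ℝ = a * (Real.sinh s * √(1 - t ^ 2) *
      (n₂ * Real.cos θ - n₁ * Real.sin θ)) := by
    rw [prolateDθ, inner_comb]; ring
  have hB2 : (1 - t ^ 2) * ⟪comb b n₀ n₁ n₂, prolateDt b a s t θ⟫_ℝ ^ 2 =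
      (a * (√(1 - t ^ 2) * Real.cosh s * n₀ -
        Real.sinh s * t * (n₁ * Real.cos θ + n₂ * Real.sin θ))) ^ 2 := by
    rw [← hB, mul_pow, h1]
  rw [hB2, hA, hC, norm_sq_comb]
  generalize Real.cosh s = C at *
  generalize Real.sinh s = S at *
  generalize Real.cos θ = c at *
  generalize Real.sin θ = σ at *
  generalize √(1 - t ^ 2) = q at *
  have hr : (n₁ * c + n₂ * σ) ^ 2 = n₁ ^ 2 + n₂ ^ 2 - (n₂ * c - n₁ * σ) ^ 2 := by
    linear_combination (n₁ ^ 2 + n₂ ^ 2) * h3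
  have hE : S ^ 2 * t ^ 2 + C ^ 2 * q ^ 2 = C ^ 2 - t ^ 2 := by
    rw [h1]; linear_combination (-t ^ 2) * h2
  -- In a meridian plane the normalized directions of s and t are a rotation of the axial and radial
  -- directions, so the mixed terms cancel.
  have hsum : (a * (S * t * n₀ + C * q * (n₁ * c + n₂ * σ))) ^ 2 +
      (a * (q * C * n₀ - S * t * (n₁ * c + n₂ * σ))) ^ 2 =
      a ^ 2 * (C ^ 2 - t ^ 2) * (n₀ ^ 2 + (n₁ * c + n₂ * σ) ^ 2) := by
    rw [← hE]; ring
  rw [hsum, hr, ← h1]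
  ring

end Gram

namespace BipolarFrame

/-- The two focal distances, each at most D, add up to 2a cosh s. -/
theorem exists_bound (H : BipolarFrame Ω ε b m a) {D : ℝ}
    (hD : ∀ z ∈ closure Ω, ∀ w ∈ closure Ω, ‖z - w‖ ≤ D) {p : ℝ × ℝ}
    (hp : p.1 ∈ Icc (-1 : ℝ) 1) : a * Real.cosh (radius Ω b m a p) ≤ D := by
  obtain ⟨-, hf⟩ := H.radius_spec hp
  have h1 := hD _ (frontier_subset_closure hf) _ (subset_closure H.left_mem.1)
  have h2 := hD _ (frontier_subset_closure hf) _ (subset_closure H.right_mem.1)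
  rw [boundaryPoint, norm_prolate_sub_left b H.pos hp] at h1
  rw [boundaryPoint, norm_prolate_sub_right b H.pos hp] at h2
  linarith

/-- Tangential area times normal height is volume: the right-hand side is the volume density of the
coordinates. In the proof, tangency expresses the components of the normal along the t and θ
directions as multiples of its component along the s direction. Parseval's identity for the unit
normal then turns into the Gram determinant. -/
theorem areaDensity_mul_inner (H : BipolarFrame Ω ε b m a) {p : ℝ × ℝ}
    (hp : p.1 ∈ Ioo (-1 : ℝ) 1) :
    areaDensity Ω b m a p * ⟪outerUnitNormal Ω (boundaryPoint Ω b m a p),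
        prolateDs b a (radius Ω b m a p) p.1 p.2⟫_ℝ =
      a ^ 3 * Real.sinh (radius Ω b m a p) * (Real.cosh (radius Ω b m a p) ^ 2 - p.1 ^ 2) := by
  have hp' := Ioo_subset_Icc_self hp
  obtain ⟨hs, hf⟩ := H.radius_spec hp'
  have hn := norm_outerUnitNormal H.smooth hf
  have hA := H.eps_pos.trans_le (H.le_inner_prolateDs hp')
  have hB := H.inner_outerUnitNormal_fderiv_boundaryPoint hp (1, 0)
  have hC := H.inner_outerUnitNormal_fderiv_boundaryPoint hp (0, 1)
  rw [(H.fderiv_boundaryPoint hp).1, inner_add_right, real_inner_smul_right] at hB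
  rw [(H.fderiv_boundaryPoint hp).2, inner_add_right, real_inner_smul_right] at hC
  rw [areaDensity, (H.fderiv_boundaryPoint hp).1, (H.fderiv_boundaryPoint hp).2, areaFactor]
  set s := radius Ω b m a p
  set n := outerUnitNormal Ω (boundaryPoint Ω b m a p)
  set u := fderiv ℝ (radius Ω b m a) p (1, 0)
  set v := fderiv ℝ (radius Ω b m a) p (0, 1)
  have hpar := parseval_prolate b a s p.1 p.2 hp n
  rw [hn] at hpar
  have g11 := norm_sq_prolateDs b a s p.1 p.2 hp
  have g22 := norm_sq_prolateDt b a s p.1 p.2 hp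
  have g33 := norm_sq_prolateDθ b a s p.1 p.2 hp
  have g12 := inner_prolateDs_prolateDt b a s p.1 p.2 hp
  have g13 := inner_prolateDs_prolateDθ b a s p.1 p.2
  have g23 := inner_prolateDt_prolateDθ b a s p.1 p.2
  have hpos := one_sub_sq_pos hp
  set T := prolateDs b a s p.1 p.2
  set Dt := prolateDt b a s p.1 p.2
  set Dθ := prolateDθ b a s p.1 p.2
  have hsp : 0 < Real.sinh s := Real.sinh_pos_iff.2 hs
  have hEpos : 0 < Real.cosh s ^ 2 - p.1 ^ 2 := by
    rw [Real.cosh_sq]; nlinarith [sq_nonneg (Real.sinh s)]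
  set E := Real.cosh s ^ 2 - p.1 ^ 2
  have e1 : ‖Dt + u • T‖ ^ 2 = ‖Dt‖ ^ 2 + u ^ 2 * ‖T‖ ^ 2 := by
    rw [norm_add_sq_real, real_inner_smul_right, real_inner_comm, g12, norm_smul, mul_pow,
      Real.norm_eq_abs, sq_abs]; ring
  have e2 : ‖Dθ + v • T‖ ^ 2 = ‖Dθ‖ ^ 2 + v ^ 2 * ‖T‖ ^ 2 := by
    rw [norm_add_sq_real, real_inner_smul_right, real_inner_comm, g13, norm_smul, mul_pow,
      Real.norm_eq_abs, sq_abs]; ring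
  have e3 : ⟪Dt + u • T, Dθ + v • T⟫_ℝ = u * v * ‖T‖ ^ 2 := by
    rw [inner_add_left, inner_add_right, inner_add_right, g23, real_inner_smul_right,
      real_inner_comm, g12, real_inner_smul_left, g13, real_inner_smul_left, real_inner_smul_right,
      real_inner_self_eq_norm_sq]; ring
  rw [e1, e2, e3, g11, g22, g33]
  have hB' : ⟪n, Dt⟫_ℝ = -u * ⟪n, T⟫_ℝ := by linarith
  have hC' : ⟪n, Dθ⟫_ℝ = -v * ⟪n, T⟫_ℝ := by linarith
  rw [hB', hC'] at hpar
  set A := ⟪n, T⟫_ℝ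
  have hrhs : 0 ≤ a ^ 3 * Real.sinh s * E := by have := H.pos; positivity
  have hsq : ((a ^ 2 * E / (1 - p.1 ^ 2) + u ^ 2 * (a ^ 2 * E)) *
      (a ^ 2 * (Real.sinh s ^ 2 * (1 - p.1 ^ 2)) + v ^ 2 * (a ^ 2 * E)) -
      (u * v * (a ^ 2 * E)) ^ 2) * A ^ 2 = (a ^ 3 * Real.sinh s * E) ^ 2 := by
    field_simp
    linear_combination a ^ 4 * hpar
  rw [← Real.sqrt_sq hA.le, ← Real.sqrt_mul' _ (sq_nonneg A), hsq, Real.sqrt_sq hrhs]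

theorem norm_mul_norm (H : BipolarFrame Ω ε b m a) {p : ℝ × ℝ} (hp : p.1 ∈ Icc (-1 : ℝ) 1) :
    ‖boundaryPoint Ω b m a p - (m - a • b 0)‖ * ‖boundaryPoint Ω b m a p - (m + a • b 0)‖ =
      a ^ 2 * (Real.cosh (radius Ω b m a p) ^ 2 - p.1 ^ 2) := by
  rw [boundaryPoint, norm_prolate_sub_left b H.pos hp, norm_prolate_sub_right b H.pos hp]; ring

theorem cosh_sq_sub_pos (H : BipolarFrame Ω ε b m a) {p : ℝ × ℝ} (hp : p.1 ∈ Icc (-1 : ℝ) 1) :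
    0 < Real.cosh (radius Ω b m a p) ^ 2 - p.1 ^ 2 := by
  have := Real.sinh_pos_iff.2 (H.radius_spec hp).1
  rw [Real.cosh_sq]
  nlinarith [hp.1, hp.2]

/-- The product of the focal distances equals a² (cosh² s - t²) and cancels the same factor in the
volume density. What remains is controlled even when the foci approach each other. -/
theorem weight_mul_inner (H : BipolarFrame Ω ε b m a) {p : ℝ × ℝ} (hp : p.1 ∈ Ioo (-1 : ℝ) 1) :
    weight Ω b m a p * ⟪outerUnitNormal Ω (boundaryPoint Ω b m a p),
        prolateDs b a (radius Ω b m a p) p.1 p.2⟫_ℝ = a * Real.sinh (radius Ω b m a p) := by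
  have hp' := Ioo_subset_Icc_self hp
  have h := H.areaDensity_mul_inner hp
  have hE := H.cosh_sq_sub_pos hp'
  have ha := H.pos
  rw [weight, H.norm_mul_norm hp', div_mul_eq_mul_div, h]
  field_simp

theorem weight_nonneg (p : ℝ × ℝ) : 0 ≤ weight Ω b m a p :=
  div_nonneg (Real.sqrt_nonneg _) (by positivity)

theorem areaDensity_pos (H : BipolarFrame Ω ε b m a) {p : ℝ × ℝ} (hp : p.1 ∈ Ioo (-1 : ℝ) 1) :
    0 < areaDensity Ω b m a p := by
  have hp' := Ioo_subset_Icc_self hp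
  have h := H.areaDensity_mul_inner hp
  have h1 : 0 < a ^ 3 * Real.sinh (radius Ω b m a p) *
      (Real.cosh (radius Ω b m a p) ^ 2 - p.1 ^ 2) :=
    mul_pos (mul_pos (pow_pos H.pos 3) (Real.sinh_pos_iff.2 (H.radius_spec hp').1))
      (H.cosh_sq_sub_pos hp')
  rw [← h] at h1
  exact pos_of_mul_pos_left h1 (H.eps_pos.trans_le (H.le_inner_prolateDs hp')).le

/-- The chain weight · ε ≤ a sinh s ≤ a cosh s ≤ D contains no trace of the position of the foci.
The O(1/|x - y|) bounds on the principal and linear parts rest on this uniformity. -/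
theorem weight_le (H : BipolarFrame Ω ε b m a) {D : ℝ}
    (hD : ∀ z ∈ closure Ω, ∀ w ∈ closure Ω, ‖z - w‖ ≤ D) {p : ℝ × ℝ}
    (hp : p.1 ∈ Ioo (-1 : ℝ) 1) : weight Ω b m a p ≤ D / ε := by
  have hp' := Ioo_subset_Icc_self hp
  have h := H.weight_mul_inner hp
  have h1 := H.le_inner_prolateDs hp'
  have h2 := H.exists_bound hD hp'
  have h3 := Real.sinh_lt_cosh (radius Ω b m a p)
  rw [le_div_iff₀ H.eps_pos]
  calc _ ≤ _ := mul_le_mul_of_nonneg_left h1 (weight_nonneg p)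
    _ = _ := h
    _ ≤ D := by nlinarith [H.pos]

/-- Positivity of the density keeps the Gram determinant away from the point where the square root
is singular. -/
theorem contDiffAt_areaDensity (H : BipolarFrame Ω ε b m a) {p : ℝ × ℝ}
    (hp : p.1 ∈ Ioo (-1 : ℝ) 1) : ContDiffAt ℝ 1 (areaDensity Ω b m a) p := by
  have hfd : ContDiffAt ℝ 1 (fderiv ℝ (boundaryPoint Ω b m a)) p :=
    (H.contDiffAt_boundaryPoint hp).fderiv_right (m := 1) one_add_one_le_top
  have h1 : ContDiffAt ℝ 1 (fun p => fderiv ℝ (boundaryPoint Ω b m a) p (1, 0)) p :=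
    hfd.clm_apply contDiffAt_const
  have h2 : ContDiffAt ℝ 1 (fun p => fderiv ℝ (boundaryPoint Ω b m a) p (0, 1)) p :=
    hfd.clm_apply contDiffAt_const
  have hne := (Real.sqrt_pos.1 (H.areaDensity_pos hp)).ne'
  refine ContDiffAt.sqrt (ContDiffAt.sub ?_ ((h1.inner ℝ h2).pow 2)) hne
  exact (h1.norm_sq ℝ).mul (h2.norm_sq ℝ)

theorem contDiffAt_cosh_radius (H : BipolarFrame Ω ε b m a) {p : ℝ × ℝ}
    (hp : p.1 ∈ Ioo (-1 : ℝ) 1) : ContDiffAt ℝ 1 (fun p => Real.cosh (radius Ω b m a p)) p :=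
  (Real.contDiff_cosh.contDiffAt (n := 1)).comp p
    ((H.contDiffAt_radius hp).of_le (by exact_mod_cast le_top))

theorem contDiffAt_weight (H : BipolarFrame Ω ε b m a) {p : ℝ × ℝ}
    (hp : p.1 ∈ Ioo (-1 : ℝ) 1) : ContDiffAt ℝ 1 (weight Ω b m a) p := by
  have hE := H.cosh_sq_sub_pos (Ioo_subset_Icc_self hp)
  have h : ContDiffAt ℝ 1 (fun p => areaDensity Ω b m a p /
      (a ^ 2 * (Real.cosh (radius Ω b m a p) ^ 2 - p.1 ^ 2))) p := by
    refine (H.contDiffAt_areaDensity hp).div ?_ (mul_pos (pow_pos H.pos 2) hE).ne'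
    have := H.contDiffAt_cosh_radius hp
    fun_prop
  refine h.congr_of_eventuallyEq ?_
  have hopen : ∀ᶠ q : ℝ × ℝ in 𝓝 p, q.1 ∈ Ioo (-1 : ℝ) 1 :=
    continuous_fst.continuousAt.eventually (isOpen_Ioo.mem_nhds hp)
  filter_upwards [hopen] with q hq
  rw [weight, H.norm_mul_norm (Ioo_subset_Icc_self hq)]

theorem injOn_boundaryPoint (H : BipolarFrame Ω ε b m a) :
    InjOn (boundaryPoint Ω b m a) paramDomain := by
  rintro ⟨t, θ⟩ hp ⟨t', θ'⟩ hp' heq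
  have h := prolate_injective b H.pos (H.radius_spec (Ioo_subset_Icc_self hp.1)).1
    (H.radius_spec (Ioo_subset_Icc_self hp'.1)).1 hp.1 hp'.1 hp.2 hp'.2 heq
  exact Prod.ext h.2.1 h.2.2

theorem exists_boundaryPoint_eq (H : BipolarFrame Ω ε b m a) {ξ : E3} (hξ : ξ ∈ frontier Ω) :
    ∃ p : ℝ × ℝ, p.1 ∈ Icc (-1 : ℝ) 1 ∧ p.2 ∈ Ioc (-Real.pi) Real.pi ∧
      boundaryPoint Ω b m a p = ξ := by
  obtain ⟨s, t, θ, hs, ht, hθ, rfl⟩ := exists_prolate_eq b (m := m) H.pos ξ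
  have hs0 : 0 < s := by
    refine lt_of_le_of_ne hs ?_
    rintro rfl
    have h0 : prolate b m a 0 t θ = m + (a * t) • b 0 := by simp [prolate, comb]
    rw [h0, H.isOpen.frontier_eq] at hξ
    exact hξ.2 (H.segment_mem ht)
  exact ⟨(t, θ), ht, hθ, by rw [boundaryPoint, H.radius_eq (p := (t, θ)) ht hs0 hξ]⟩

/-- The parametrization misses at most the two points of ∂Ω on the axis, where t = ±1 and θ is
irrelevant, and points are null sets for two-dimensional Hausdorff measure. -/
theorem surfaceMeasure_eq_restrict_image (H : BipolarFrame Ω ε b m a) :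
    surfaceMeasure Ω = (Measure.euclideanHausdorffMeasure 2 : Measure E3).restrict
      (boundaryPoint Ω b m a '' paramDomain) := by
  have hpt : ∀ ξ : E3, (Measure.euclideanHausdorffMeasure 2 : Measure E3) {ξ} = 0 := by
    intro ξ
    have : (Measure.hausdorffMeasure (2 : ℕ) : Measure E3) {ξ} = 0 := by
      have := Measure.nullSingletonClass_hausdorff E3 (d := ((2 : ℕ) : ℝ)) (by norm_num)
      exact measure_singleton ξ
    rw [Measure.euclideanHausdorffMeasure_def, Measure.smul_apply, this, smul_zero]
  refine Measure.restrict_congr_set (ae_eq_set.2 ⟨?_, ?_⟩)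
  · refine measure_mono_null (t := {boundaryPoint Ω b m a (1, 0)} ∪ {boundaryPoint Ω b m a (-1, 0)})
      ?_ (measure_union_null (hpt _) (hpt _))
    rintro ξ ⟨hξ, hξ'⟩
    obtain ⟨p, hp1, hp2, rfl⟩ := H.exists_boundaryPoint_eq hξ
    obtain ⟨hs, hf⟩ := H.radius_spec hp1
    have hax : ∀ t : ℝ, t ^ 2 = 1 → p.1 = t →
        boundaryPoint Ω b m a p = boundaryPoint Ω b m a (t, 0) := by
      intro t ht hpt
      have h0 : ∀ s θ, prolate b m a s t θ = prolate b m a s t 0 := by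
        intro s θ
        simp [prolate, ht]
      have h1 : radius Ω b m a (t, 0) = radius Ω b m a p := by
        refine H.radius_eq (p := (t, 0)) (hpt ▸ hp1) hs ?_
        rw [← h0 _ p.2, ← hpt]
        exact hf
      rw [boundaryPoint, boundaryPoint, h1, hpt, h0]
    by_cases h1 : p.1 = 1
    · left; exact hax 1 (by norm_num) h1
    by_cases h2 : p.1 = -1
    · right; exact hax (-1) (by norm_num) h2
    exact (hξ' ⟨p, ⟨⟨lt_of_le_of_ne hp1.1 (Ne.symm h2), lt_of_le_of_ne hp1.2 h1⟩, hp2⟩, rfl⟩).elim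
  · have : boundaryPoint Ω b m a '' paramDomain \ frontier Ω = ∅ := by
      rw [sdiff_eq_empty]
      rintro _ ⟨p, hp, rfl⟩
      exact (H.radius_spec (Ioo_subset_Icc_self hp.1)).2
    rw [this, measure_empty]

/-- The surface measure in prolate spheroidal coordinates. -/
theorem map_withDensity_areaDensity (H : BipolarFrame Ω ε b m a) :
    Measure.map (boundaryPoint Ω b m a) ((volume.restrict paramDomain).withDensity
      fun p => ENNReal.ofReal (areaDensity Ω b m a p)) = surfaceMeasure Ω := by
  rw [H.surfaceMeasure_eq_restrict_image]
  refine map_withDensity_areaFactor measurableSet_paramDomain (fun p hp =>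
    (H.contDiffAt_boundaryPoint hp.1).hasStrictFDerivAt (by simp)) (fun p hp => ?_)
    (fun p hp => H.areaDensity_pos hp.1) H.injOn_boundaryPoint
  exact ((H.contDiffAt_boundaryPoint hp.1).fderiv_right (m := 1)
    one_add_one_le_top).continuousAt.continuousWithinAt

end BipolarFrame

end SurfaceParametrization


/-! ### Layer densities of the weighted surface measure -/

section Layers

open Set

/-- For |t| ≤ 1/2 the parameters fill a compact convex rectangle away from the poles t = ±1, on
which the derivative is bounded and the mean value inequality applies. -/
theorem exists_lipschitz_in_first {g : ℝ × ℝ → ℝ}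
    (hg : ∀ p : ℝ × ℝ, p.1 ∈ Ioo (-1 : ℝ) 1 → ContDiffAt ℝ 1 g p) :
    ∃ K : ℝ, 0 ≤ K ∧ ∀ t ∈ Icc (-(1 / 2) : ℝ) (1 / 2), ∀ θ ∈ Icc (-Real.pi) Real.pi,
      ‖g (t, θ) - g (0, θ)‖ ≤ K * |t| := by
  set k : Set (ℝ × ℝ) := Icc (-(1 / 2) : ℝ) (1 / 2) ×ˢ Icc (-Real.pi) Real.pi
  have hk : IsCompact k := isCompact_Icc.prod isCompact_Icc
  have hsub : ∀ p ∈ k, p.1 ∈ Ioo (-1 : ℝ) 1 :=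
    fun p hp => ⟨by linarith [hp.1.1], by linarith [hp.1.2]⟩
  have hc : ContinuousOn (fderiv ℝ g) k := fun p hp =>
    ((hg p (hsub p hp)).fderiv_right (m := 0) (by simp)).continuousAt.continuousWithinAt
  obtain ⟨K, hK⟩ := hk.exists_bound_of_continuousOn hc
  refine ⟨max K 0, le_max_right _ _, fun t ht θ hθ => ?_⟩
  have h := ((convex_Icc (-(1 / 2) : ℝ) (1 / 2)).prod
    (convex_Icc (-Real.pi) Real.pi)).norm_image_sub_le_of_norm_fderiv_le (𝕜 := ℝ) (f := g)
    (fun p hp => (hg p (hsub p hp)).differentiableAt (by simp))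
    (fun p hp => (hK p hp).trans (le_max_left K 0))
    (x := (0, θ)) (y := (t, θ)) ⟨by norm_num, hθ⟩ ⟨ht, hθ⟩
  simpa using h

variable {Ω : Set E3} {ε : ℝ} {b : OrthonormalBasis (Fin 3) ℝ E3} {m : E3} {a : ℝ}

/-- The density in `t` of the push-forward of the weighted surface measure. -/
def layer (Ω : Set E3) (b : OrthonormalBasis (Fin 3) ℝ E3) (m : E3) (a : ℝ) (F : E3 → ℂ) (t : ℝ) :
    ℂ := ∫ θ in Ioc (-Real.pi) Real.pi, (weight Ω b m a (t, θ) : ℂ) * F (boundaryPoint Ω b m a (t, θ))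

theorem BipolarFrame.isCompact_frontier (H : BipolarFrame Ω ε b m a) : IsCompact (frontier Ω) :=
  H.isBounded.isCompact_closure.of_isClosed_subset isClosed_frontier frontier_subset_closure

theorem exists_diam_bound (hb : Bornology.IsBounded Ω) :
    ∃ D : ℝ, 0 < D ∧ ∀ z ∈ closure Ω, ∀ w ∈ closure Ω, ‖z - w‖ ≤ D := by
  refine ⟨Metric.diam (closure Ω) + 1, by have := Metric.diam_nonneg (s := closure Ω); linarith,
    fun z hz w hw => ?_⟩
  have := Metric.dist_le_diam_of_mem hb.closure hz hw
  rw [dist_eq_norm] at this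
  linarith

/-- The centre is the midpoint of x and y, and the unit vector from x to y is completed to an
orthonormal basis. Statements about pairs of distinct points can thereby be proved in a frame. -/
theorem exists_bipolarFrame (hΩ_open : IsOpen Ω) (hΩ_bdd : Bornology.IsBounded Ω)
    (hΩ_convex : Convex ℝ Ω) (hΩ_smooth : HasSmoothBoundary Ω) (hε : 0 < ε) {x y : E3}
    (hx : x ∈ innerDomain Ω ε) (hy : y ∈ innerDomain Ω ε) (hxy : x ≠ y) :
    ∃ (b : OrthonormalBasis (Fin 3) ℝ E3) (m : E3) (a : ℝ), BipolarFrame Ω ε b m a ∧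
      m - a • b 0 = x ∧ m + a • b 0 = y ∧ 2 * a = ‖y - x‖ := by
  have hpos : 0 < ‖y - x‖ := norm_pos_iff.2 (sub_ne_zero.2 hxy.symm)
  have hd : ‖direction x y‖ = 1 := by
    rw [direction, norm_smul, norm_inv, norm_norm, inv_mul_cancel₀ hpos.ne']
  have hON : Orthonormal ℝ (({0} : Set (Fin 3)).domRestrict fun _ => direction x y) := by
    rw [orthonormal_iff_ite]
    rintro ⟨i, rfl⟩ ⟨j, rfl⟩
    simp [hd]
  obtain ⟨b, hb⟩ := hON.exists_orthonormalBasis_extension_of_card_eq (ι := Fin 3) (by simp)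
  have hb0 : b 0 = direction x y := hb 0 rfl
  have hx' : (1 / 2 : ℝ) • (x + y) - (‖y - x‖ / 2) • b 0 = x := by
    rw [hb0, direction, smul_smul, div_mul_eq_mul_div, mul_inv_cancel₀ hpos.ne']
    module
  have hy' : (1 / 2 : ℝ) • (x + y) + (‖y - x‖ / 2) • b 0 = y := by
    rw [hb0, direction, smul_smul, div_mul_eq_mul_div, mul_inv_cancel₀ hpos.ne']
    module
  refine ⟨b, (1 / 2 : ℝ) • (x + y), ‖y - x‖ / 2, ⟨hΩ_open, hΩ_bdd, hΩ_convex, hΩ_smooth, hε,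
    by positivity, hx'.symm ▸ hx, hy'.symm ▸ hy⟩, hx', hy', by ring⟩

namespace BipolarFrame

theorem continuousOn_weight_mul (H : BipolarFrame Ω ε b m a) {F : E3 → ℂ}
    (hF : ContinuousOn F (frontier Ω)) :
    ContinuousOn (fun p => (weight Ω b m a p : ℂ) * F (boundaryPoint Ω b m a p))
      (Ioo (-1 : ℝ) 1 ×ˢ univ) := by
  refine ContinuousOn.mul (fun p hp => ?_) (hF.comp (fun p hp => ?_) fun p hp => ?_)
  · exact (Complex.continuous_ofReal.continuousAt.comp
      (H.contDiffAt_weight hp.1).continuousAt).continuousWithinAt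
  · exact (H.contDiffAt_boundaryPoint hp.1).continuousAt.continuousWithinAt
  · exact (H.radius_spec (Ioo_subset_Icc_self hp.1)).2

theorem norm_weight_mul_le (H : BipolarFrame Ω ε b m a) {D : ℝ}
    (hD : ∀ z ∈ closure Ω, ∀ w ∈ closure Ω, ‖z - w‖ ≤ D) {F : E3 → ℂ} {M : ℝ}
    (hM : ∀ ξ ∈ frontier Ω, ‖F ξ‖ ≤ M) {p : ℝ × ℝ} (hp : p.1 ∈ Ioo (-1 : ℝ) 1) :
    ‖(weight Ω b m a p : ℂ) * F (boundaryPoint Ω b m a p)‖ ≤ D / ε * M := by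
  have hf := (H.radius_spec (Ioo_subset_Icc_self hp)).2
  rw [norm_mul, Complex.norm_real, Real.norm_of_nonneg (weight_nonneg p)]
  exact mul_le_mul (H.weight_le hD hp) (hM _ hf) (norm_nonneg _)
    ((weight_nonneg p).trans (H.weight_le hD hp))

theorem integrableOn_weight_mul (H : BipolarFrame Ω ε b m a) {F : E3 → ℂ}
    (hF : ContinuousOn F (frontier Ω)) :
    IntegrableOn (fun p => (weight Ω b m a p : ℂ) * F (boundaryPoint Ω b m a p)) paramDomain := by
  obtain ⟨D, hD0, hD⟩ := exists_diam_bound H.isBounded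
  obtain ⟨M, hM⟩ := H.isCompact_frontier.exists_bound_of_continuousOn hF
  have hfin : volume paramDomain < ⊤ := by
    rw [paramDomain, Measure.volume_eq_prod, Measure.prod_prod, Real.volume_Ioo, Real.volume_Ioc]
    exact ENNReal.mul_lt_top ENNReal.ofReal_lt_top ENNReal.ofReal_lt_top
  refine IntegrableOn.of_bound hfin
    (((H.continuousOn_weight_mul hF).mono fun p hp => ⟨hp.1, mem_univ _⟩).aestronglyMeasurable
      measurableSet_paramDomain) (D / ε * M) ?_
  filter_upwards [ae_restrict_mem measurableSet_paramDomain] with p hp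
  exact H.norm_weight_mul_le hD hM hp.1

theorem norm_layer_le (H : BipolarFrame Ω ε b m a) {D : ℝ}
    (hD : ∀ z ∈ closure Ω, ∀ w ∈ closure Ω, ‖z - w‖ ≤ D) {F : E3 → ℂ} {M : ℝ}
    (hM : ∀ ξ ∈ frontier Ω, ‖F ξ‖ ≤ M) {t : ℝ} (ht : t ∈ Ioo (-1 : ℝ) 1) :
    ‖layer Ω b m a F t‖ ≤ 2 * Real.pi * (D / ε) * M := by
  have h := norm_setIntegral_le_of_norm_le_const (μ := volume) (s := Ioc (-Real.pi) Real.pi)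
    (f := fun θ => (weight Ω b m a (t, θ) : ℂ) * F (boundaryPoint Ω b m a (t, θ)))
    (C := D / ε * M) (by rw [Real.volume_Ioc]; exact ENNReal.ofReal_lt_top)
    (fun θ _ => H.norm_weight_mul_le hD hM (p := (t, θ)) ht)
  refine h.trans (le_of_eq ?_)
  rw [Real.volume_real_Ioc_of_le (by linarith [Real.pi_pos])]
  ring

theorem integrableOn_layer (H : BipolarFrame Ω ε b m a) {F : E3 → ℂ}
    (hF : ContinuousOn F (frontier Ω)) :
    IntegrableOn (layer Ω b m a F) (Ioo (-1 : ℝ) 1) := by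
  have h := H.integrableOn_weight_mul hF
  rw [IntegrableOn, paramDomain, Measure.volume_eq_prod, ← Measure.prod_restrict] at h
  exact h.integral_prod_left

theorem aemeasurable_boundaryPoint (H : BipolarFrame Ω ε b m a) :
    AEMeasurable (boundaryPoint Ω b m a) (volume.restrict paramDomain) :=
  ContinuousOn.aemeasurable (fun _ hp =>
    (H.contDiffAt_boundaryPoint hp.1).continuousAt.continuousWithinAt) measurableSet_paramDomain

theorem aemeasurable_areaDensity (H : BipolarFrame Ω ε b m a) :
    AEMeasurable (areaDensity Ω b m a) (volume.restrict paramDomain) :=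
  ContinuousOn.aemeasurable (fun _ hp =>
    (H.contDiffAt_areaDensity hp.1).continuousAt.continuousWithinAt) measurableSet_paramDomain

theorem areaDensity_eq (H : BipolarFrame Ω ε b m a) {p : ℝ × ℝ} (hp : p.1 ∈ Ioo (-1 : ℝ) 1) :
    areaDensity Ω b m a p = weight Ω b m a p *
      (‖boundaryPoint Ω b m a p - (m - a • b 0)‖ * ‖boundaryPoint Ω b m a p - (m + a • b 0)‖) := by
  have hp' := Ioo_subset_Icc_self hp
  rw [weight, div_mul_cancel₀]
  rw [H.norm_mul_norm hp']
  exact (mul_pos (pow_pos H.pos 2) (H.cosh_sq_sub_pos hp')).ne'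

/-- Integration over the boundary, layer by layer. -/
theorem integral_surfaceMeasure_eq (H : BipolarFrame Ω ε b m a) {F : E3 → ℂ}
    (hF : ContinuousOn F (frontier Ω)) :
    ∫ ξ, F ξ / ((‖ξ - (m + a • b 0)‖ : ℂ) * (‖ξ - (m - a • b 0)‖ : ℂ)) ∂(surfaceMeasure Ω) =
      ∫ t in Ioo (-1 : ℝ) 1, layer Ω b m a F t := by
  have hac := withDensity_absolutelyContinuous (volume.restrict paramDomain)
    (fun p => ENNReal.ofReal (areaDensity Ω b m a p))
  have hcont : ContinuousOn (fun ξ => F ξ / ((‖ξ - (m + a • b 0)‖ : ℂ) * (‖ξ - (m - a • b 0)‖ : ℂ)))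
      (frontier Ω) := by
    refine hF.div (by fun_prop) fun ξ hξ => ?_
    have h1 := H.eps_pos.trans (lt_norm_sub_of_mem_innerDomain H.left_mem hξ)
    have h2 := H.eps_pos.trans (lt_norm_sub_of_mem_innerDomain H.right_mem hξ)
    exact mul_ne_zero (Complex.ofReal_ne_zero.2 h2.ne') (Complex.ofReal_ne_zero.2 h1.ne')
  have hmeas := hcont.aestronglyMeasurable (μ := (Measure.euclideanHausdorffMeasure 2 : Measure E3))
    isClosed_frontier.measurableSet
  rw [← surfaceMeasure, ← H.map_withDensity_areaDensity] at hmeas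
  conv_lhs => rw [← H.map_withDensity_areaDensity]
  rw [integral_map (H.aemeasurable_boundaryPoint.mono_ac hac) hmeas]
  have hwd : (volume.restrict paramDomain).withDensity
      (fun p => ENNReal.ofReal (areaDensity Ω b m a p)) = (volume.restrict paramDomain).withDensity
      (fun p => ((areaDensity Ω b m a p).toNNReal : ENNReal)) := rfl
  rw [hwd, integral_withDensity_eq_integral_smul₀ H.aemeasurable_areaDensity.real_toNNReal]
  -- The division by both focal distances turns the area density into `weight`.
  have heq : ∫ p in paramDomain, (areaDensity Ω b m a p).toNNReal •
      (F (boundaryPoint Ω b m a p) / ((‖boundaryPoint Ω b m a p - (m + a • b 0)‖ : ℂ) *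
        (‖boundaryPoint Ω b m a p - (m - a • b 0)‖ : ℂ))) =
      ∫ p in paramDomain, (weight Ω b m a p : ℂ) * F (boundaryPoint Ω b m a p) := by
    refine setIntegral_congr_fun measurableSet_paramDomain fun p hp => ?_
    have hp' := Ioo_subset_Icc_self hp.1
    have h0 := (mul_pos (pow_pos H.pos 2) (H.cosh_sq_sub_pos hp')).ne'
    rw [← H.norm_mul_norm hp'] at h0
    have h1 : (‖boundaryPoint Ω b m a p - (m - a • b 0)‖ : ℂ) ≠ 0 :=
      Complex.ofReal_ne_zero.2 (left_ne_zero_of_mul h0)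
    have h2 : (‖boundaryPoint Ω b m a p - (m + a • b 0)‖ : ℂ) ≠ 0 :=
      Complex.ofReal_ne_zero.2 (right_ne_zero_of_mul h0)
    simp only [NNReal.smul_def, Real.coe_toNNReal _ (H.areaDensity_pos hp.1).le,
      Complex.real_smul]
    rw [H.areaDensity_eq hp.1]
    push_cast
    field_simp
  rw [heq, paramDomain, Measure.volume_eq_prod, setIntegral_prod _ (H.integrableOn_weight_mul hF)]
  rfl

/-- The phase is constant on the layers. -/
theorem layer_phase_mul (H : BipolarFrame Ω ε b m a) (F : E3 → ℂ) (l : ℝ) {t : ℝ}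
    (ht : t ∈ Icc (-1 : ℝ) 1) :
    layer Ω b m a (fun ξ => Complex.exp (Complex.I * ((l * (‖ξ - (m + a • b 0)‖ -
      ‖ξ - (m - a • b 0)‖) : ℝ) : ℂ)) * F ξ) t =
    Complex.exp (Complex.I * ((-(l * (2 * a) * t) : ℝ) : ℂ)) * layer Ω b m a F t := by
  rw [layer, layer, ← integral_const_mul]
  congr 1
  ext θ
  have h : ‖boundaryPoint Ω b m a (t, θ) - (m + a • b 0)‖ -
      ‖boundaryPoint Ω b m a (t, θ) - (m - a • b 0)‖ = -(2 * a * t) := by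
    rw [boundaryPoint, norm_prolate_sub_left b H.pos ht, norm_prolate_sub_right b H.pos ht]; ring
  rw [h, show l * -(2 * a * t) = -(l * (2 * a) * t) by ring]
  ring

/-- The layer densities of smooth functions of the distances are Lipschitz continuous. -/
theorem exists_lipschitz_layer (H : BipolarFrame Ω ε b m a) (k : ℝ) :
    ∃ K : ℝ, ∀ t ∈ Icc (-(1 / 2) : ℝ) (1 / 2),
      ‖layer Ω b m a (fun ξ => ((Real.exp (-k * (‖ξ - (m + a • b 0)‖ + ‖ξ - (m - a • b 0)‖)) : ℝ) :
          ℂ)) t -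
        layer Ω b m a (fun ξ => ((Real.exp (-k * (‖ξ - (m + a • b 0)‖ + ‖ξ - (m - a • b 0)‖)) : ℝ) :
          ℂ)) 0‖ ≤ K * |t| := by
  set F : E3 → ℂ := fun ξ => ((Real.exp (-k * (‖ξ - (m + a • b 0)‖ + ‖ξ - (m - a • b 0)‖)) : ℝ) : ℂ)
    with hFdef
  have hF : ContinuousOn F (frontier Ω) := by
    refine Continuous.continuousOn ?_
    rw [hFdef]
    fun_prop
  -- The sum of the focal distances is 2a cosh s, so on the boundary the damping factor depends on
  -- (t, θ) through the radius only and is as regular as the radius.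
  set g : ℝ × ℝ → ℝ := fun p => weight Ω b m a p *
    Real.exp (-k * (2 * a * Real.cosh (radius Ω b m a p))) with hg
  obtain ⟨K, hK0, hK⟩ := exists_lipschitz_in_first (g := g) fun p hp => by
    have h1 := H.contDiffAt_weight hp
    have h2 := H.contDiffAt_cosh_radius hp
    exact h1.mul (Real.contDiff_exp.contDiffAt.comp p (by fun_prop))
  have hgF : ∀ t ∈ Ioo (-1 : ℝ) 1, ∀ θ, (weight Ω b m a (t, θ) : ℂ) *
      F (boundaryPoint Ω b m a (t, θ)) = (g (t, θ) : ℂ) := by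
    intro t ht θ
    have h : ‖boundaryPoint Ω b m a (t, θ) - (m + a • b 0)‖ +
      ‖boundaryPoint Ω b m a (t, θ) - (m - a • b 0)‖ =
        2 * a * Real.cosh (radius Ω b m a (t, θ)) := by
      rw [boundaryPoint, norm_prolate_sub_left b H.pos (Ioo_subset_Icc_self ht),
        norm_prolate_sub_right b H.pos (Ioo_subset_Icc_self ht)]; ring
    simp only [hFdef, hg, h]
    push_cast
    rfl
  have hint : ∀ t ∈ Ioo (-1 : ℝ) 1, IntegrableOn (fun θ => (g (t, θ) : ℂ))
      (Ioc (-Real.pi) Real.pi) := by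
    intro t ht
    have hc : ContinuousOn (fun θ => (g (t, θ) : ℂ)) (Icc (-Real.pi) Real.pi) := by
      have := (H.continuousOn_weight_mul hF).comp (s := Icc (-Real.pi) Real.pi)
        (f := fun θ : ℝ => (t, θ)) (by fun_prop) fun θ _ => ⟨ht, mem_univ _⟩
      exact this.congr fun θ _ => (hgF t ht θ).symm
    exact hc.integrableOn_Icc.mono_set Ioc_subset_Icc_self
  refine ⟨K * (2 * Real.pi), fun t ht => ?_⟩
  have ht' : t ∈ Ioo (-1 : ℝ) 1 := ⟨by linarith [ht.1], by linarith [ht.2]⟩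
  have h0' : (0 : ℝ) ∈ Ioo (-1 : ℝ) 1 := by norm_num
  simp only [layer, hgF t ht', hgF 0 h0']
  rw [← integral_sub (hint t ht') (hint 0 h0')]
  have h := norm_setIntegral_le_of_norm_le_const (μ := volume) (s := Ioc (-Real.pi) Real.pi)
    (f := fun θ => (g (t, θ) : ℂ) - (g (0, θ) : ℂ)) (C := K * |t|)
    (by rw [Real.volume_Ioc]; exact ENNReal.ofReal_lt_top)
    (fun θ hθ => by
      rw [← Complex.ofReal_sub, Complex.norm_real]
      exact hK t ht θ (Ioc_subset_Icc_self hθ))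
  refine h.trans (le_of_eq ?_)
  rw [Real.volume_real_Ioc_of_le (by linarith [Real.pi_pos])]
  ring

theorem isFiniteMeasure_surfaceMeasure (H : BipolarFrame Ω ε b m a) :
    IsFiniteMeasure (surfaceMeasure Ω) := by
  obtain ⟨D, hD0, hD⟩ := exists_diam_bound H.isBounded
  have hac := withDensity_absolutelyContinuous (volume.restrict paramDomain)
    (fun p => ENNReal.ofReal (areaDensity Ω b m a p))
  have hfin : volume paramDomain < ⊤ := by
    rw [paramDomain, Measure.volume_eq_prod, Measure.prod_prod, Real.volume_Ioo, Real.volume_Ioc]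
    exact ENNReal.mul_lt_top ENNReal.ofReal_lt_top ENNReal.ofReal_lt_top
  refine ⟨?_⟩
  rw [← H.map_withDensity_areaDensity, Measure.map_apply_of_aemeasurable
    (H.aemeasurable_boundaryPoint.mono_ac hac) MeasurableSet.univ, preimage_univ,
    withDensity_apply _ MeasurableSet.univ, Measure.restrict_univ]
  calc ∫⁻ p in paramDomain, ENNReal.ofReal (areaDensity Ω b m a p)
      ≤ ∫⁻ p in paramDomain, ENNReal.ofReal (D / ε * (D * D)) := by
        refine setLIntegral_mono' measurableSet_paramDomain fun p hp => ENNReal.ofReal_le_ofReal ?_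
        have hf := (H.radius_spec (Ioo_subset_Icc_self hp.1)).2
        rw [H.areaDensity_eq hp.1]
        have h1 := hD _ (frontier_subset_closure hf) _ (subset_closure H.left_mem.1)
        have h2 := hD _ (frontier_subset_closure hf) _ (subset_closure H.right_mem.1)
        have h3 := H.weight_le hD hp.1
        have h4 := weight_nonneg (Ω := Ω) (b := b) (m := m) (a := a) p
        gcongr
        exact h4.trans h3
    _ < ⊤ := by
      rw [setLIntegral_const]
      exact ENNReal.mul_lt_top ENNReal.ofReal_lt_top hfin

end BipolarFrame

end Layers


/-! ### Arc length on the bisecting section -/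

section BisectingSection

open Set

variable {Ω : Set E3} {ε : ℝ} {b : OrthonormalBasis (Fin 3) ℝ E3} {m : E3} {a : ℝ}

namespace BipolarFrame

theorem boundaryPoint_zero_norm (H : BipolarFrame Ω ε b m a) (θ : ℝ) :
    ‖boundaryPoint Ω b m a (0, θ) - (m - a • b 0)‖ = a * Real.cosh (radius Ω b m a (0, θ)) ∧
    ‖boundaryPoint Ω b m a (0, θ) - (m + a • b 0)‖ = a * Real.cosh (radius Ω b m a (0, θ)) := by
  have h0 : (0 : ℝ) ∈ Icc (-1 : ℝ) 1 := by norm_num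
  rw [boundaryPoint, norm_prolate_sub_left b H.pos h0, norm_prolate_sub_right b H.pos h0]
  simp

/-- The bisecting section in polar coordinates. -/
theorem bisectingSection_eq_image (H : BipolarFrame Ω ε b m a) :
    bisectingSection Ω (m - a • b 0) (m + a • b 0) =
      (fun θ => boundaryPoint Ω b m a (0, θ)) '' Ioc (-Real.pi) Real.pi := by
  have hin : ∀ p : ℝ × ℝ, ⟪boundaryPoint Ω b m a p - (1 / 2 : ℝ) • (m - a • b 0 + (m + a • b 0)),
      m + a • b 0 - (m - a • b 0)⟫_ℝ =
      2 * a * (a * (Real.cosh (radius Ω b m a p) * p.1)) := by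
    intro p
    rw [show (1 / 2 : ℝ) • (m - a • b 0 + (m + a • b 0)) = m by module,
      show m + a • b 0 - (m - a • b 0) = (2 * a) • b 0 by module, boundaryPoint, prolate,
      add_sub_cancel_left, real_inner_smul_right, real_inner_comm, (inner_basis_comb b _ _ _).1]
  ext ξ
  constructor
  · rintro ⟨hξ, hξ0⟩
    obtain ⟨⟨t, θ⟩, hp1, hp2, rfl⟩ := H.exists_boundaryPoint_eq hξ
    rw [hin] at hξ0
    have ha := H.pos
    have hc := Real.cosh_pos (radius Ω b m a (t, θ))
    have ht : t = 0 := by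
      by_contra hne
      exact mul_ne_zero (by positivity) (mul_ne_zero ha.ne' (mul_ne_zero hc.ne' hne)) hξ0
    subst ht
    exact ⟨θ, hp2, rfl⟩
  · rintro ⟨θ, hθ, rfl⟩
    refine ⟨(H.radius_spec (p := (0, θ)) (by norm_num)).2, ?_⟩
    rw [hin]
    simp

/-- The velocity of the bisecting section. -/
theorem norm_fderiv_boundaryPoint_zero (H : BipolarFrame Ω ε b m a) (θ : ℝ) :
    0 < ‖fderiv ℝ (boundaryPoint Ω b m a) (0, θ) (0, 1)‖ ∧
    0 < ‖outerUnitNormal Ω (boundaryPoint Ω b m a (0, θ)) -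
        ⟪b 0, outerUnitNormal Ω (boundaryPoint Ω b m a (0, θ))⟫_ℝ • b 0‖ ∧
    ‖fderiv ℝ (boundaryPoint Ω b m a) (0, θ) (0, 1)‖ =
      weight Ω b m a (0, θ) * (a * Real.cosh (radius Ω b m a (0, θ))) *
      ‖outerUnitNormal Ω (boundaryPoint Ω b m a (0, θ)) -
        ⟪b 0, outerUnitNormal Ω (boundaryPoint Ω b m a (0, θ))⟫_ℝ • b 0‖ := by
  have h0 : ((0, θ) : ℝ × ℝ).1 ∈ Ioo (-1 : ℝ) 1 := by norm_num
  have h0' := Ioo_subset_Icc_self h0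
  obtain ⟨hs, hf⟩ := H.radius_spec h0'
  have ha := H.pos
  have hA := H.eps_pos.trans_le (H.le_inner_prolateDs h0')
  have hW := H.weight_mul_inner h0
  have hC := H.inner_outerUnitNormal_fderiv_boundaryPoint h0 (0, 1)
  rw [(H.fderiv_boundaryPoint h0).2] at hC ⊢
  set s := radius Ω b m a (0, θ)
  set v := fderiv ℝ (radius Ω b m a) (0, θ) (0, 1)
  obtain ⟨n₀, n₁, n₂, hn⟩ := exists_eq_comb b (outerUnitNormal Ω (boundaryPoint Ω b m a (0, θ)))
  rw [hn] at hA hW hC ⊢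
  have hS := Real.sinh_pos_iff.2 hs
  have hCpos := Real.cosh_pos s
  have hsc := Real.sin_sq_add_cos_sq θ
  have hD : prolateDθ b a s (0, θ).1 (0, θ).2 + v • prolateDs b a s (0, θ).1 (0, θ).2 =
      comb b 0 (a * (v * Real.cosh s * Real.cos θ - Real.sinh s * Real.sin θ))
        (a * (v * Real.cosh s * Real.sin θ + Real.sinh s * Real.cos θ)) := by
    rw [prolateDθ, prolateDs, smul_comb, comb_add]
    congr 1
    · simp
    · simp; ring
    · simp; ring
  have hT : ⟪comb b n₀ n₁ n₂, prolateDs b a s (0, θ).1 (0, θ).2⟫_ℝ =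
      a * Real.cosh s * (n₁ * Real.cos θ + n₂ * Real.sin θ) := by
    rw [prolateDs, inner_comb]; simp; ring
  have hproj : comb b n₀ n₁ n₂ - ⟪b 0, comb b n₀ n₁ n₂⟫_ℝ • b 0 = comb b 0 n₁ n₂ := by
    rw [(inner_basis_comb b n₀ n₁ n₂).1]; simp only [comb]; module
  rw [hT] at hA hW
  rw [hD] at hC ⊢
  rw [hproj]
  rw [inner_comb] at hC
  have hNr : 0 < n₁ * Real.cos θ + n₂ * Real.sin θ := pos_of_mul_pos_right hA (by positivity)
  set Nr := n₁ * Real.cos θ + n₂ * Real.sin θ with hNrdef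
  -- Within the bisecting plane, the velocity has radial component a v cosh s and angular component
  -- a sinh s. Orthogonality to the projected normal makes it proportional to that projection turned
  -- by a right angle, which is the content of `key`.
  have hperp : v * Real.cosh s * Nr = -(Real.sinh s * (n₂ * Real.cos θ - n₁ * Real.sin θ)) := by
    have : a * (v * Real.cosh s * Nr + Real.sinh s * (n₂ * Real.cos θ - n₁ * Real.sin θ)) = 0 := by
      rw [← hC, hNrdef]; ring
    linarith [(mul_eq_zero.1 this).resolve_left ha.ne']
  have hnorm : ‖comb b 0 n₁ n₂‖ ^ 2 = Nr ^ 2 + (n₂ * Real.cos θ - n₁ * Real.sin θ) ^ 2 := by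
    rw [norm_sq_comb, hNrdef]; linear_combination -(n₁ ^ 2 + n₂ ^ 2) * hsc
  have hnD : ‖comb b 0 (a * (v * Real.cosh s * Real.cos θ - Real.sinh s * Real.sin θ))
        (a * (v * Real.cosh s * Real.sin θ + Real.sinh s * Real.cos θ))‖ ^ 2 =
      a ^ 2 * ((v * Real.cosh s) ^ 2 + Real.sinh s ^ 2) := by
    rw [norm_sq_comb]
    linear_combination a ^ 2 * ((v * Real.cosh s) ^ 2 + Real.sinh s ^ 2) * hsc
  have key : ‖comb b 0 (a * (v * Real.cosh s * Real.cos θ - Real.sinh s * Real.sin θ))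
        (a * (v * Real.cosh s * Real.sin θ + Real.sinh s * Real.cos θ))‖ * Nr =
      a * Real.sinh s * ‖comb b 0 n₁ n₂‖ := by
    rw [← sq_eq_sq₀ (by positivity) (by positivity), mul_pow _ Nr, hnD,
      mul_pow (a * Real.sinh s), hnorm]
    have : (v * Real.cosh s * Nr) ^ 2 =
        Real.sinh s ^ 2 * (n₂ * Real.cos θ - n₁ * Real.sin θ) ^ 2 := by rw [hperp]; ring
    linear_combination a ^ 2 * this
  have hp0 : 0 < ‖comb b 0 n₁ n₂‖ := by
    have h2 : 0 < ‖comb b 0 n₁ n₂‖ ^ 2 := by rw [hnorm]; positivity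
    exact lt_of_le_of_ne (norm_nonneg _) fun h => by simp [← h] at h2
  refine ⟨?_, hp0, ?_⟩
  · have : 0 < a * Real.sinh s * ‖comb b 0 n₁ n₂‖ := by positivity
    rw [← key] at this
    exact pos_of_mul_pos_left this hNr.le
  · refine mul_right_cancel₀ hNr.ne' ?_
    rw [key, ← hW]
    ring

theorem sectionMeasure_eq_map (H : BipolarFrame Ω ε b m a) :
    Measure.map (fun θ => boundaryPoint Ω b m a (0, θ))
      ((volume.restrict (Ioc (-Real.pi) Real.pi)).withDensity
        fun θ => ENNReal.ofReal ‖fderiv ℝ (boundaryPoint Ω b m a) (0, θ) (0, 1)‖) =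
      sectionMeasure Ω (m - a • b 0) (m + a • b 0) := by
  rw [sectionMeasure, H.bisectingSection_eq_image]
  have h0 : ∀ θ : ℝ, ((0, θ) : ℝ × ℝ).1 ∈ Ioo (-1 : ℝ) 1 := fun θ => by norm_num
  refine map_withDensity_norm_deriv measurableSet_Ioc (fun θ _ => ?_) (fun θ _ => ?_)
    (fun θ _ => norm_pos_iff.1 (H.norm_fderiv_boundaryPoint_zero θ).1) fun θ hθ θ' hθ' h => ?_
  · have h1 : HasStrictFDerivAt (boundaryPoint Ω b m a)
        (fderiv ℝ (boundaryPoint Ω b m a) (0, θ)) (0, θ) :=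
      (H.contDiffAt_boundaryPoint (h0 θ)).hasStrictFDerivAt (by simp)
    exact HasStrictFDerivAt.comp_hasStrictDerivAt (f := fun θ : ℝ => ((0 : ℝ), θ)) θ h1
      ((hasStrictDerivAt_const θ (0 : ℝ)).prodMk (hasStrictDerivAt_id θ))
  · have h1 : ContinuousAt (fderiv ℝ (boundaryPoint Ω b m a)) (0, θ) :=
      ((H.contDiffAt_boundaryPoint (h0 θ)).fderiv_right (m := 1) one_add_one_le_top).continuousAt
    have h2 : ContinuousAt (fun θ : ℝ => fderiv ℝ (boundaryPoint Ω b m a) (0, θ)) θ :=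
      ContinuousAt.comp (f := fun θ : ℝ => ((0 : ℝ), θ)) h1 (by fun_prop)
    exact (h2.clm_apply continuousAt_const).continuousWithinAt
  · exact (Prod.ext_iff.1 (H.injOn_boundaryPoint ⟨h0 θ, hθ⟩ ⟨h0 θ', hθ'⟩ h)).2

theorem direction_eq (H : BipolarFrame Ω ε b m a) :
    direction (m - a • b 0) (m + a • b 0) = b 0 := by
  have ha := H.pos
  rw [direction, show m + a • b 0 - (m - a • b 0) = (2 * a) • b 0 by module, norm_smul,
    b.orthonormal.1 0, Real.norm_of_nonneg (by linarith), mul_one, smul_smul,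
    inv_mul_cancel₀ (by positivity), one_smul]

/-- The line integral over the bisecting section is the layer density at zero. -/
theorem integral_sectionMeasure_eq (H : BipolarFrame Ω ε b m a) (k : ℝ) :
    Integrable (sectionIntegrand Ω k (m - a • b 0) (m + a • b 0))
      (sectionMeasure Ω (m - a • b 0) (m + a • b 0)) ∧
    ((∫ ξ, sectionIntegrand Ω k (m - a • b 0) (m + a • b 0) ξ
      ∂(sectionMeasure Ω (m - a • b 0) (m + a • b 0)) : ℝ) : ℂ) =
    layer Ω b m a (fun ξ => ((Real.exp (-k * (‖ξ - (m + a • b 0)‖ + ‖ξ - (m - a • b 0)‖)) : ℝ) :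
          ℂ)) 0 := by
  have h0 : ∀ θ : ℝ, ((0, θ) : ℝ × ℝ).1 ∈ Ioo (-1 : ℝ) 1 := fun θ => by norm_num
  set Ψ : ℝ → E3 := fun θ => boundaryPoint Ω b m a (0, θ) with hΨ
  set J : ℝ → ℝ := fun θ => ‖fderiv ℝ (boundaryPoint Ω b m a) (0, θ) (0, 1)‖ with hJ
  set I : Set ℝ := Ioc (-Real.pi) Real.pi with hI
  set f := sectionIntegrand Ω k (m - a • b 0) (m + a • b 0) with hf
  set w : ℝ → ℝ := fun θ => weight Ω b m a (0, θ) *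
    Real.exp (-2 * k * (a * Real.cosh (radius Ω b m a (0, θ)))) with hw
  have hline : ∀ θ : ℝ, ContinuousAt (fun θ : ℝ => ((0 : ℝ), θ)) θ := fun θ => by fun_prop
  have hΨc : Continuous Ψ := continuous_iff_continuousAt.2 fun θ =>
    ContinuousAt.comp (f := fun θ : ℝ => ((0 : ℝ), θ))
      (H.contDiffAt_boundaryPoint (h0 θ)).continuousAt (hline θ)
  have hJc : Continuous J := continuous_iff_continuousAt.2 fun θ => by
    have h1 : ContinuousAt (fderiv ℝ (boundaryPoint Ω b m a)) (0, θ) :=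
      ((H.contDiffAt_boundaryPoint (h0 θ)).fderiv_right (m := 1) one_add_one_le_top).continuousAt
    have h2 : ContinuousAt (fun θ : ℝ => fderiv ℝ (boundaryPoint Ω b m a) (0, θ)) θ :=
      ContinuousAt.comp (f := fun θ : ℝ => ((0 : ℝ), θ)) h1 (hline θ)
    exact (h2.clm_apply continuousAt_const).norm
  have hwc : Continuous w := continuous_iff_continuousAt.2 fun θ => by
    have h1 : ContinuousAt (fun θ : ℝ => weight Ω b m a (0, θ)) θ :=
      ContinuousAt.comp (f := fun θ : ℝ => ((0 : ℝ), θ))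
        (H.contDiffAt_weight (h0 θ)).continuousAt (hline θ)
    have h2 : ContinuousAt (fun θ : ℝ => Real.cosh (radius Ω b m a (0, θ))) θ :=
      ContinuousAt.comp (f := fun θ : ℝ => ((0 : ℝ), θ))
        (H.contDiffAt_cosh_radius (h0 θ)).continuousAt (hline θ)
    exact h1.mul (Real.continuous_exp.continuousAt.comp (by fun_prop))
  -- The speed contains both the length of the projected normal and the focal distance as factors.
  -- They cancel the two denominators of the integrand and leave the layer density at t = 0.
  have hJf : ∀ θ, J θ * f (Ψ θ) = w θ := by
    intro θ
    obtain ⟨-, hp, heq⟩ := H.norm_fderiv_boundaryPoint_zero θ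
    have hr : 0 < a * Real.cosh (radius Ω b m a (0, θ)) := mul_pos H.pos (Real.cosh_pos _)
    simp only [hJ, hf, hΨ, hw, sectionIntegrand, H.direction_eq, (H.boundaryPoint_zero_norm θ).1]
    rw [heq]
    have ha := H.pos
    have hc := Real.cosh_pos (radius Ω b m a (0, θ))
    field_simp
  have hJpos : ∀ θ, 0 < J θ := fun θ => (H.norm_fderiv_boundaryPoint_zero θ).1
  have hfΨ : ∀ θ, f (Ψ θ) = w θ / J θ := fun θ => by
    rw [← hJf θ, mul_div_cancel_left₀ _ (hJpos θ).ne']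
  -- The normal is chosen point by point, so measurability of the integrand is not evident. Along
  -- the curve it equals the continuous quotient w / J, and it is replaced by a measurable extension
  -- `g` from the curve.
  have hemb : MeasurableEmbedding (I.domRestrict Ψ) :=
    hΨc.continuousOn.measurableEmbedding measurableSet_Ioc fun θ hθ θ' hθ' h =>
      (Prod.ext_iff.1 (H.injOn_boundaryPoint ⟨h0 θ, hθ⟩ ⟨h0 θ', hθ'⟩ h)).2
  obtain ⟨g, hg, hgf⟩ := hemb.exists_measurable_extend
    (g := fun θ : I => f (Ψ θ)) (by
      simp only [hfΨ]
      exact (hwc.measurable.div hJc.measurable).comp measurable_subtype_coe) (fun _ => inferInstance)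
  have hgΨ : ∀ θ ∈ I, g (Ψ θ) = f (Ψ θ) := fun θ hθ => congrFun hgf ⟨θ, hθ⟩
  have hmapeq := H.sectionMeasure_eq_map
  have hwd : (volume.restrict I).withDensity (fun θ => ENNReal.ofReal (J θ)) =
    (volume.restrict I).withDensity (fun θ => ((J θ).toNNReal : ENNReal)) := rfl
  have hfg : f =ᵐ[sectionMeasure Ω (m - a • b 0) (m + a • b 0)] g := by
    rw [sectionMeasure, H.bisectingSection_eq_image]
    have : MeasurableSet (Ψ '' I) := by
      have := hemb.measurableSet_range
      rwa [range_domRestrict] at this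
    filter_upwards [ae_restrict_mem this] with ξ hξ
    obtain ⟨θ, hθ, rfl⟩ := hξ
    exact (hgΨ θ hθ).symm
  have hwint : IntegrableOn w I := hwc.integrableOn_Icc.mono_set Ioc_subset_Icc_self
  have hsm : ∀ θ ∈ I, (J θ).toNNReal • g (Ψ θ) = w θ := fun θ hθ => by
    rw [hgΨ θ hθ, ← hJf θ, NNReal.smul_def, Real.coe_toNNReal _ (hJpos θ).le, smul_eq_mul]
  refine ⟨?_, ?_⟩
  · rw [integrable_congr hfg, ← hmapeq, integrable_map_measure hg.aestronglyMeasurable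
      hΨc.measurable.aemeasurable, hwd,
      integrable_withDensity_iff_integrable_smul hJc.measurable.real_toNNReal]
    refine Integrable.congr hwint ?_
    filter_upwards [ae_restrict_mem measurableSet_Ioc] with θ hθ
    exact (hsm θ hθ).symm
  · rw [integral_congr_ae hfg, ← hmapeq, integral_map hΨc.measurable.aemeasurable
      hg.aestronglyMeasurable, hwd, integral_withDensity_eq_integral_smul
      hJc.measurable.real_toNNReal, setIntegral_congr_fun measurableSet_Ioc hsm,
      ← integral_complex_ofReal, layer]
    refine setIntegral_congr_fun measurableSet_Ioc fun θ _ => ?_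
    simp only [(H.boundaryPoint_zero_norm θ).1, (H.boundaryPoint_zero_norm θ).2, hw]
    rw [show -k * (a * Real.cosh (radius Ω b m a (0, θ)) + a * Real.cosh (radius Ω b m a (0, θ))) =
      -2 * k * (a * Real.cosh (radius Ω b m a (0, θ))) by ring]
    push_cast
    rfl

end BipolarFrame

end BisectingSection


/-! ### Oscillatory integrals in one variable -/

section Wave

open FourierTransform

/-- The Fourier transform of `g` at the frequency `ω * l`. -/
def wave (l : ℝ) (g : ℝ → ℂ) (ω : ℝ) : ℂ :=
  ∫ t : ℝ, Complex.exp (Complex.I * ((-(ω * l * t) : ℝ) : ℂ)) * g t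

variable {l : ℝ} {g : ℝ → ℂ}

theorem norm_exp_I_mul_ofReal (r : ℝ) : ‖Complex.exp (Complex.I * (r : ℂ))‖ = 1 := by
  rw [mul_comm, Complex.norm_exp_ofReal_mul_I]

theorem wave_eq_fourier (l : ℝ) (g : ℝ → ℂ) (ω : ℝ) :
    wave l g ω = 𝓕 g (l / (2 * Real.pi) * ω) := by
  rw [wave, Real.fourier_real_eq_integral_exp_smul]
  refine integral_congr_ae (Eventually.of_forall fun t => ?_)
  simp only [smul_eq_mul]
  congr 2
  rw [mul_comm]
  congr 2
  field_simp

theorem norm_wave_le (l : ℝ) (g : ℝ → ℂ) (ω : ℝ) : ‖wave l g ω‖ ≤ ∫ t, ‖g t‖ := by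
  refine (norm_integral_le_integral_norm _).trans_eq ?_
  simp [-Complex.ofReal_neg, -Complex.ofReal_mul]

theorem continuous_wave (hg : Integrable g) : Continuous (wave l g) := by
  refine continuous_of_dominated (bound := fun t => ‖g t‖) (fun ω => ?_) (fun ω => ?_) hg.norm ?_
  · exact (Continuous.aestronglyMeasurable (by fun_prop)).mul hg.aestronglyMeasurable
  · exact Eventually.of_forall fun t => by rw [norm_mul, norm_exp_I_mul_ofReal, one_mul]
  · exact Eventually.of_forall fun t => by fun_prop

theorem integrable_gaussian_mul_of_bdd {δ C : ℝ} {h : ℝ → ℂ} (hδ : 0 < δ)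
    (hh : AEStronglyMeasurable h volume) (hC : ∀ ω, ‖h ω‖ ≤ C) :
    Integrable fun ω : ℝ => ((Real.exp (-δ * ω ^ 2) : ℝ) : ℂ) * h ω :=
  (integrable_exp_neg_mul_sq hδ).ofReal.mul_bdd (c := C) hh (Eventually.of_forall hC)

theorem integral_exp_mul_gaussian {δ : ℝ} (hδ : 0 < δ) (r : ℝ) :
    ∫ ω : ℝ, ((Real.exp (-δ * ω ^ 2) : ℝ) : ℂ) * Complex.exp (Complex.I * ((ω * r : ℝ) : ℂ)) =
      ((√(Real.pi / δ) * Real.exp (-(r ^ 2 / (4 * δ))) : ℝ) : ℂ) := by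
  have h := fourierIntegral_gaussian (b := (δ : ℂ)) (by simpa using hδ) (r : ℂ)
  have h2 : ((Real.pi : ℂ) / δ) ^ (1 / 2 : ℂ) = ((√(Real.pi / δ) : ℝ) : ℂ) := by
    rw [Real.sqrt_eq_rpow, Complex.ofReal_cpow (by positivity)]
    push_cast; rfl
  rw [h2] at h
  rw [Complex.ofReal_mul, Complex.ofReal_exp]
  convert h using 2
  · ext ω
    rw [mul_comm, Complex.ofReal_exp]
    congr 2 <;> push_cast <;> ring
  · congr 1; push_cast; ring

/-- Fubini is available thanks to the Gaussian factor, and the frequency integral becomes a heat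
kernel: regularized Fourier inversion is convolution with an approximate identity. -/
theorem integral_gaussian_mul_wave (hg : Integrable g) {δ : ℝ} (hδ : 0 < δ) (s : ℝ) :
    ∫ ω : ℝ, ((Real.exp (-δ * ω ^ 2) : ℝ) : ℂ) *
        (Complex.exp (Complex.I * ((ω * l * s : ℝ) : ℂ)) * wave l g ω) =
      ∫ t : ℝ, ((√(Real.pi / δ) * Real.exp (-((l * (s - t)) ^ 2 / (4 * δ))) : ℝ) : ℂ) * g t := by
  have hint : Integrable (Function.uncurry fun (ω t : ℝ) =>
      ((Real.exp (-δ * ω ^ 2) : ℝ) : ℂ) * Complex.exp (Complex.I * ((ω * (l * (s - t)) : ℝ) : ℂ)) *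
        g t) (volume.prod volume) := by
    have : Integrable (fun z : ℝ × ℝ => ((Real.exp (-δ * z.1 ^ 2) : ℝ) : ℂ) * g z.2)
        (volume.prod volume) := (integrable_exp_neg_mul_sq hδ).ofReal.mul_prod hg
    refine (this.bdd_mul (c := 1)
      (f := fun z : ℝ × ℝ => Complex.exp (Complex.I * ((z.1 * (l * (s - z.2)) : ℝ) : ℂ)))
      (Continuous.aestronglyMeasurable (by fun_prop))
      (Eventually.of_forall fun z => (norm_exp_I_mul_ofReal _).le)).congr
      (Eventually.of_forall fun z => ?_)
    simp only [Function.uncurry]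
    ring
  have h1 : ∀ ω : ℝ, ((Real.exp (-δ * ω ^ 2) : ℝ) : ℂ) *
        (Complex.exp (Complex.I * ((ω * l * s : ℝ) : ℂ)) * wave l g ω) =
      ∫ t : ℝ, ((Real.exp (-δ * ω ^ 2) : ℝ) : ℂ) *
        Complex.exp (Complex.I * ((ω * (l * (s - t)) : ℝ) : ℂ)) * g t := by
    intro ω
    rw [wave, ← integral_const_mul, ← integral_const_mul]
    refine integral_congr_ae (Eventually.of_forall fun t => ?_)
    simp only
    rw [← mul_assoc (Complex.exp _), ← Complex.exp_add, ← mul_assoc]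
    congr 3
    push_cast; ring
  rw [integral_congr_ae (Eventually.of_forall h1), integral_integral_swap hint]
  refine integral_congr_ae (Eventually.of_forall fun t => ?_)
  simp only
  rw [integral_mul_const, integral_exp_mul_gaussian hδ]

theorem integrable_gaussian_profile (hl : 0 < l) {δ : ℝ} (hδ : 0 < δ) (s : ℝ) :
    Integrable fun t : ℝ => √(Real.pi / δ) * Real.exp (-((l * (s - t)) ^ 2 / (4 * δ))) := by
  have h := ((integrable_exp_neg_mul_sq (b := l ^ 2 / (4 * δ)) (by positivity)).comp_sub_left
    s).const_mul √(Real.pi / δ)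
  refine h.congr (Eventually.of_forall fun t => ?_)
  simp only
  congr 2
  ring

/-- The mass does not depend on δ, which makes the bounds below uniform in the regularization; the
factor 1/l is the later 1/|x - y|. -/
theorem integral_gaussian_profile (hl : 0 < l) {δ : ℝ} (hδ : 0 < δ) (s : ℝ) :
    ∫ t : ℝ, √(Real.pi / δ) * Real.exp (-((l * (s - t)) ^ 2 / (4 * δ))) = 2 * Real.pi / l := by
  have h : ∀ t : ℝ, √(Real.pi / δ) * Real.exp (-((l * (s - t)) ^ 2 / (4 * δ))) =
      √(Real.pi / δ) * Real.exp (-(l ^ 2 / (4 * δ)) * (s - t) ^ 2) := fun t => by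
    congr 2; ring
  simp_rw [h]
  rw [integral_const_mul,
    integral_sub_left_eq_self (fun t : ℝ => Real.exp (-(l ^ 2 / (4 * δ)) * t ^ 2)) volume s,
    integral_gaussian, ← Real.sqrt_mul (by positivity),
    show Real.pi / δ * (Real.pi / (l ^ 2 / (4 * δ))) = (2 * Real.pi / l) ^ 2 by field_simp; ring,
    Real.sqrt_sq (by positivity)]

theorem norm_integral_gaussian_mul_wave_le (hl : 0 < l) (hg : Integrable g) {B : ℝ}
    (hB : ∀ t, ‖g t‖ ≤ B) {δ : ℝ} (hδ : 0 < δ) (s : ℝ) :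
    ‖∫ ω : ℝ, ((Real.exp (-δ * ω ^ 2) : ℝ) : ℂ) *
        (Complex.exp (Complex.I * ((ω * l * s : ℝ) : ℂ)) * wave l g ω)‖ ≤
      2 * Real.pi / l * B := by
  rw [integral_gaussian_mul_wave hg hδ, ← integral_gaussian_profile hl hδ s, ← integral_mul_const]
  refine norm_integral_le_of_norm_le ((integrable_gaussian_profile hl hδ s).mul_const B)
    (Eventually.of_forall fun t => ?_)
  rw [norm_mul, Complex.norm_of_nonneg (by positivity)]
  exact mul_le_mul_of_nonneg_left (hB t) (by positivity)

/-- Writing out the conjugate factor and exchanging integrals pairs the heat-smoothed g with the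
conjugate of g. The smoothed function is bounded by B times the kernel mass, the other factor is
integrable. -/
theorem integral_gaussian_mul_norm_sq_wave_le (hl : 0 < l) (hg : Integrable g) {B : ℝ}
    (hB : ∀ t, ‖g t‖ ≤ B) {δ : ℝ} (hδ : 0 < δ) :
    ∫ ω : ℝ, Real.exp (-δ * ω ^ 2) * ‖wave l g ω‖ ^ 2 ≤ 2 * Real.pi / l * B * ∫ t, ‖g t‖ := by
  have hint : Integrable (Function.uncurry fun (ω s : ℝ) =>
      ((Real.exp (-δ * ω ^ 2) : ℝ) : ℂ) *
        (Complex.exp (Complex.I * ((ω * l * s : ℝ) : ℂ)) * wave l g ω) * conj (g s))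
      (volume.prod volume) := by
    have := (integrable_gaussian_mul_of_bdd hδ (continuous_wave (l := l) hg).aestronglyMeasurable
      (norm_wave_le l g)).mul_prod (Complex.conjCLE.toContinuousLinearMap.integrable_comp hg)
    refine (this.bdd_mul (c := 1)
      (f := fun z : ℝ × ℝ => Complex.exp (Complex.I * ((z.1 * l * z.2 : ℝ) : ℂ)))
      (Continuous.aestronglyMeasurable (by fun_prop))
      (Eventually.of_forall fun z => (norm_exp_I_mul_ofReal _).le)).congr
      (Eventually.of_forall fun z => ?_)
    simp only [Function.uncurry, ContinuousLinearEquiv.coe_coe, Complex.conjCLE_apply]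
    ring
  have hconj : ∀ ω : ℝ, conj (wave l g ω) =
      ∫ s : ℝ, Complex.exp (Complex.I * ((ω * l * s : ℝ) : ℂ)) * conj (g s) := by
    intro ω
    rw [wave, ← integral_conj]
    refine integral_congr_ae (Eventually.of_forall fun s => ?_)
    simp only [map_mul, ← Complex.exp_conj, Complex.conj_I, Complex.conj_ofReal]
    congr 2
    push_cast; ring
  have h1 : ((∫ ω : ℝ, Real.exp (-δ * ω ^ 2) * ‖wave l g ω‖ ^ 2 : ℝ) : ℂ) =
      ∫ s : ℝ, (∫ ω : ℝ, ((Real.exp (-δ * ω ^ 2) : ℝ) : ℂ) *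
        (Complex.exp (Complex.I * ((ω * l * s : ℝ) : ℂ)) * wave l g ω)) * conj (g s) := by
    simp_rw [← integral_mul_const]
    rw [← integral_integral_swap hint, ← integral_complex_ofReal]
    refine integral_congr_ae (Eventually.of_forall fun ω => ?_)
    simp only
    rw [Complex.ofReal_mul, Complex.ofReal_pow, ← Complex.mul_conj', hconj, ← mul_assoc,
      ← integral_const_mul]
    refine integral_congr_ae (Eventually.of_forall fun s => ?_)
    simp only
    ring
  refine (le_abs_self _).trans ?_
  rw [← Real.norm_eq_abs, ← Complex.norm_real, h1, ← integral_const_mul]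
  refine norm_integral_le_of_norm_le (hg.norm.const_mul _) (Eventually.of_forall fun s => ?_)
  rw [norm_mul, RCLike.norm_conj]
  exact mul_le_mul_of_nonneg_right (norm_integral_gaussian_mul_wave_le hl hg hB hδ s)
    (norm_nonneg _)

theorem tendsto_gaussian_one (ω : ℝ) :
    Tendsto (fun n : ℕ => Real.exp (-(1 / ((n : ℝ) + 1)) * ω ^ 2)) atTop (𝓝 1) := by
  have h := ((tendsto_one_div_add_atTop_nhds_zero_nat (𝕜 := ℝ)).neg.mul_const (ω ^ 2)).rexp
  simpa using h

/-- Fatou's lemma removes the Gaussian. This is the part of Plancherel's theorem needed here, with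
the explicit dependence on l. -/
theorem lintegral_sq_wave_le (hl : 0 < l) (hg : Integrable g) {B : ℝ} (hB : ∀ t, ‖g t‖ ≤ B) :
    ∫⁻ ω : ℝ, ENNReal.ofReal (‖wave l g ω‖ ^ 2) ≤
      ENNReal.ofReal (2 * Real.pi / l * B * ∫ t, ‖g t‖) := by
  have hc := continuous_wave (l := l) hg
  have hlim : ∀ ω : ℝ, liminf (fun n : ℕ => ENNReal.ofReal
      (Real.exp (-(1 / ((n : ℝ) + 1)) * ω ^ 2) * ‖wave l g ω‖ ^ 2)) atTop =
        ENNReal.ofReal (‖wave l g ω‖ ^ 2) := fun ω => by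
    have := (tendsto_gaussian_one ω).mul_const (‖wave l g ω‖ ^ 2)
    rw [one_mul] at this
    exact ((ENNReal.continuous_ofReal.tendsto _).comp this).liminf_eq
  simp_rw [← hlim]
  refine (lintegral_liminf_le fun n => by fun_prop).trans ?_
  refine liminf_le_of_frequently_le' (Frequently.of_forall fun n => ?_)
  have hδ : 0 < 1 / ((n : ℝ) + 1) := by positivity
  rw [← ofReal_integral_eq_lintegral_ofReal _ (Eventually.of_forall fun ω => by positivity)]
  · exact ENNReal.ofReal_le_ofReal (integral_gaussian_mul_norm_sq_wave_le hl hg hB hδ)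
  · refine (integrable_exp_neg_mul_sq hδ).mul_bdd (c := (∫ t, ‖g t‖) ^ 2)
      (Continuous.aestronglyMeasurable (by fun_prop)) (Eventually.of_forall fun ω => ?_)
    rw [norm_pow, norm_norm]
    exact pow_le_pow_left₀ (norm_nonneg _) (norm_wave_le l g ω) 2

theorem tendsto_integral_gaussian_mul_wave (hl : 0 < l) (hg : Integrable g) {B : ℝ}
    (hB : ∀ t, ‖g t‖ ≤ B) (hc : ContinuousAt g 0) :
    Tendsto (fun n : ℕ => ∫ ω : ℝ, ((Real.exp (-(1 / ((n : ℝ) + 1)) * ω ^ 2) : ℝ) : ℂ) *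
      wave l g ω) atTop (𝓝 (((2 * Real.pi / l : ℝ) : ℂ) * g 0)) := by
  -- The substitution t = √δ u freezes the heat kernel and moves the parameter into the argument of
  -- g, where continuity at 0 and dominated convergence finish.
  have key : ∀ n : ℕ, ∫ ω : ℝ, ((Real.exp (-(1 / ((n : ℝ) + 1)) * ω ^ 2) : ℝ) : ℂ) *
      wave l g ω = ∫ u : ℝ, ((√(Real.pi / 1) * Real.exp (-((l * (0 - u)) ^ 2 / (4 * 1))) : ℝ) : ℂ) *
        g (√(1 / ((n : ℝ) + 1)) * u) := by
    intro n
    have hδ : 0 < 1 / ((n : ℝ) + 1) := by positivity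
    have h := integral_gaussian_mul_wave (l := l) hg hδ 0
    simp only [mul_zero, Complex.ofReal_zero, Complex.exp_zero, one_mul] at h
    rw [h]
    generalize 1 / ((n : ℝ) + 1) = δ at hδ
    have hs : 0 < √δ := Real.sqrt_pos.2 hδ
    have h2 := Measure.integral_comp_mul_left (fun t : ℝ =>
      ((√(Real.pi / δ) * Real.exp (-((l * (0 - t)) ^ 2 / (4 * δ))) : ℝ) : ℂ) * g t) √δ
    rw [abs_of_pos (inv_pos.2 hs), eq_inv_smul_iff₀ hs.ne'] at h2
    rw [← h2, ← integral_smul]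
    refine integral_congr_ae (Eventually.of_forall fun u => ?_)
    simp only [Complex.real_smul, ← mul_assoc, ← Complex.ofReal_mul]
    congr 3
    · rw [Real.sqrt_div' _ hδ.le, div_one]; field_simp
    · congr 2
      rw [zero_sub, zero_sub, mul_neg, mul_neg, neg_sq, neg_sq, mul_pow, mul_pow, mul_pow,
        Real.sq_sqrt hδ.le]
      field_simp
  simp_rw [key]
  rw [← integral_gaussian_profile hl one_pos 0, ← integral_complex_ofReal, ← integral_mul_const]
  refine tendsto_integral_of_dominated_convergence
    (fun u => √(Real.pi / 1) * Real.exp (-((l * (0 - u)) ^ 2 / (4 * 1))) * B) (fun n => ?_)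
    ((integrable_gaussian_profile hl one_pos 0).mul_const B)
    (fun n => Eventually.of_forall fun u => ?_) (Eventually.of_forall fun u => ?_)
  · have hs : √(1 / ((n : ℝ) + 1)) ≠ 0 := (Real.sqrt_pos.2 (by positivity)).ne'
    exact (Continuous.aestronglyMeasurable (by fun_prop)).mul
      (hg.comp_mul_left' hs).aestronglyMeasurable
  · rw [norm_mul, Complex.norm_of_nonneg (by positivity)]
    exact mul_le_mul_of_nonneg_left (hB _) (by positivity)
  · refine Tendsto.const_mul _ ?_
    have h := ((tendsto_one_div_add_atTop_nhds_zero_nat (𝕜 := ℝ)).sqrt.mul_const u)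
    rw [Real.sqrt_zero, zero_mul] at h
    exact hc.tendsto.comp h

/-- The difference quotient of `g` at `0`, with a Gaussian in place of the constant `g 0`. -/
def gaussianSlope (g : ℝ → ℂ) (t : ℝ) : ℂ :=
  (t : ℂ)⁻¹ * (g t - g 0 * Complex.exp (-Real.pi * 1 * (t : ℂ) ^ 2))

theorem ofReal_mul_gaussianSlope (g : ℝ → ℂ) (t : ℝ) :
    (t : ℂ) * gaussianSlope g t = g t - g 0 * Complex.exp (-Real.pi * 1 * (t : ℂ) ^ 2) := by
  rcases eq_or_ne t 0 with rfl | ht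
  · simp
  · rw [gaussianSlope, mul_inv_cancel_left₀ (by exact_mod_cast ht)]

theorem norm_cexp_neg_pi_mul_sq (t : ℝ) :
    Complex.exp (-Real.pi * 1 * (t : ℂ) ^ 2) = ((Real.exp (-Real.pi * t ^ 2) : ℝ) : ℂ) := by
  rw [Complex.ofReal_exp]; push_cast; ring_nf

/-- For |t| ≤ 1 the Lipschitz condition at 0 and 1 - exp(-πt²) ≤ π|t| bound the quotient; for |t| >
1 division by t only helps. -/
theorem integrable_gaussianSlope (hg : Integrable g) {K : ℝ} (hK : ∀ t, ‖g t - g 0‖ ≤ K * |t|) :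
    Integrable (gaussianSlope g) := by
  have hG : Integrable fun t : ℝ => Real.exp (-Real.pi * t ^ 2) :=
    integrable_exp_neg_mul_sq Real.pi_pos
  have hK0 : 0 ≤ K := by simpa using (norm_nonneg _).trans (hK 1)
  have hbound : Integrable fun t : ℝ => (Set.Icc (-1) 1).indicator
      (fun _ => K + ‖g 0‖ * Real.pi) t + (‖g t‖ + ‖g 0‖ * Real.exp (-Real.pi * t ^ 2)) :=
    (IntegrableOn.integrable_indicator (by simp) measurableSet_Icc).add
      (hg.norm.add (hG.const_mul _))
  refine hbound.mono' ?_ (Eventually.of_forall fun t => ?_)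
  · exact (Complex.measurable_ofReal.inv.aestronglyMeasurable).mul
      (hg.aestronglyMeasurable.sub (Continuous.aestronglyMeasurable (by fun_prop)))
  · rw [gaussianSlope, norm_cexp_neg_pi_mul_sq, norm_mul, norm_inv, Complex.norm_real,
      Real.norm_eq_abs]
    by_cases ht : t ∈ Set.Icc (-1 : ℝ) 1
    · rw [Set.indicator_of_mem ht]
      have h1 : |t|⁻¹ * ‖g t - g 0 * ((Real.exp (-Real.pi * t ^ 2) : ℝ) : ℂ)‖ ≤
          K + ‖g 0‖ * Real.pi := by
        rcases eq_or_ne t 0 with rfl | ht0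
        · simp; positivity
        rw [inv_mul_le_iff₀ (abs_pos.2 ht0)]
        have h2 : g t - g 0 * ((Real.exp (-Real.pi * t ^ 2) : ℝ) : ℂ) =
            (g t - g 0) + g 0 * ((1 - Real.exp (-Real.pi * t ^ 2) : ℝ) : ℂ) := by
          push_cast; ring
        have h3 : 1 - Real.exp (-Real.pi * t ^ 2) ≤ Real.pi * |t| := by
          have := Real.add_one_le_exp (-Real.pi * t ^ 2)
          have h4 : t ^ 2 ≤ |t| := by
            rw [← sq_abs]; nlinarith [abs_nonneg t, abs_le.2 ht]
          nlinarith [Real.pi_pos]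
        have h5 : 0 ≤ 1 - Real.exp (-Real.pi * t ^ 2) := by
          rw [sub_nonneg]
          exact Real.exp_le_one_iff.2 (by nlinarith [Real.pi_pos, sq_nonneg t])
        rw [h2]
        refine (norm_add_le _ _).trans ?_
        rw [norm_mul, Complex.norm_of_nonneg h5]
        nlinarith [hK t, mul_le_mul_of_nonneg_left h3 (norm_nonneg (g 0))]
      have h6 : 0 ≤ ‖g t‖ + ‖g 0‖ * Real.exp (-Real.pi * t ^ 2) := by positivity
      linarith
    · rw [Set.indicator_of_notMem ht, zero_add]
      have h1 : 1 ≤ |t| := by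
        by_contra h
        exact ht (abs_le.1 (not_le.1 h).le)
      refine (mul_le_of_le_one_left (norm_nonneg _) (inv_le_one_of_one_le₀ h1)).trans ?_
      refine (norm_sub_le _ _).trans_eq ?_
      rw [norm_mul, Complex.norm_of_nonneg (Real.exp_pos _).le]

/-- Subtracting g(0) times a Gaussian leaves t · v(t) with v integrable, whose Fourier transform is
up to a constant the derivative of that of v. Its improper integral is a difference of boundary
values and vanishes by the Riemann-Lebesgue lemma, with the two ends independent. The Gaussian
contributes the limit. Regularity of g away from 0 plays no role, so jumps of the density at t = ±1
are harmless. -/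
theorem tendsto_integral_wave (hl : 0 < l) (hg : Integrable g) {K : ℝ}
    (hK : ∀ t, ‖g t - g 0‖ ≤ K * |t|) :
    Tendsto (fun p : ℝ × ℝ => ∫ ω in p.1..p.2, wave l g ω) (atBot ×ˢ atTop)
      (𝓝 (((2 * Real.pi / l : ℝ) : ℂ) * g 0)) := by
  have hv := integrable_gaussianSlope hg hK
  have htv : Integrable fun t : ℝ => t • gaussianSlope g t := by
    simp_rw [Complex.real_smul, ofReal_mul_gaussianSlope]
    exact hg.sub (((integrable_cexp_neg_mul_sq (b := (Real.pi : ℂ) * 1)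
      (by simp [Real.pi_pos])).const_mul (g 0)).congr
        (Eventually.of_forall fun t => by simp))
  set L := l / (2 * Real.pi) with hL
  have hLpos : 0 < L := by positivity
  have hgauss : Integrable fun ω : ℝ => Real.exp (-(Real.pi * L ^ 2) * ω ^ 2) :=
    integrable_exp_neg_mul_sq (by positivity)
  -- Differentiation of 𝓕 v brings down -2πi t, and the dilation by L = l / 2π brings a further
  -- factor L; the prefactor I / l compensates both.
  have hderiv : ∀ ω : ℝ, HasDerivAt (fun ω => Complex.I / l * 𝓕 (gaussianSlope g) (L * ω))
      (wave l g ω - g 0 * ((Real.exp (-(Real.pi * L ^ 2) * ω ^ 2) : ℝ) : ℂ)) ω := by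
    intro ω
    have h1 := (Real.hasDerivAt_fourier hv htv (L * ω)).scomp ω ((hasDerivAt_id ω).const_mul L)
    refine (h1.const_mul (Complex.I / l)).congr_deriv ?_
    have h2 : (fun x : ℝ => (-2 * (Real.pi : ℂ) * Complex.I * x) • gaussianSlope g x) =
        fun x => (-2 * (Real.pi : ℂ) * Complex.I) •
          (g x - g 0 * Complex.exp (-Real.pi * 1 * (x : ℂ) ^ 2)) := by
      ext x
      rw [← ofReal_mul_gaussianSlope, smul_eq_mul, smul_eq_mul]; ring
    have h3 := congrFun (fourier_gaussian_pi (b := 1) (by simp)) (L * ω)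
    rw [Real.fourier_real_eq_integral_exp_smul] at h3
    have hi : ∀ f : ℝ → ℂ, Integrable f → Integrable fun v : ℝ =>
        Complex.exp (((-2 * Real.pi * v * (L * ω) : ℝ) : ℂ) * Complex.I) * f v := fun f hf =>
      hf.bdd_mul (c := 1) (Continuous.aestronglyMeasurable (by fun_prop))
        (Eventually.of_forall fun v => (Complex.norm_exp_ofReal_mul_I _).le)
    have h4 : 𝓕 (fun x : ℝ => (-2 * (Real.pi : ℂ) * Complex.I * x) • gaussianSlope g x) (L * ω) =
        (-2 * (Real.pi : ℂ) * Complex.I) * (wave l g ω -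
          g 0 * ((Real.exp (-(Real.pi * L ^ 2) * ω ^ 2) : ℝ) : ℂ)) := by
      have h5 : ((Real.exp (-(Real.pi * L ^ 2) * ω ^ 2) : ℝ) : ℂ) = 1 / 1 ^ (1 / 2 : ℂ) *
          Complex.exp (-Real.pi / 1 * ((L * ω : ℝ) : ℂ) ^ 2) := by
        rw [Complex.ofReal_exp, Complex.one_cpow, div_one, div_one, one_mul]
        congr 1; push_cast; ring
      rw [h2, h5, wave_eq_fourier, ← h3, Real.fourier_real_eq_integral_exp_smul,
        Real.fourier_real_eq_integral_exp_smul]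
      simp only [smul_eq_mul]
      rw [← integral_const_mul, ← hL, ← integral_sub (hi _ hg), ← integral_const_mul]
      · refine integral_congr_ae (Eventually.of_forall fun v => ?_)
        simp only
        ring
      · refine (hi _ (integrable_cexp_neg_mul_sq (b := (Real.pi : ℂ) * 1)
          (by simp [Real.pi_pos]))).const_mul (g 0) |>.congr
            (Eventually.of_forall fun v => ?_)
        simp only [neg_mul]
    rw [h4, Complex.real_smul, hL]
    have : (l : ℂ) ≠ 0 := by exact_mod_cast hl.ne'
    have hpi : (Real.pi : ℂ) ≠ 0 := by exact_mod_cast Real.pi_ne_zero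
    push_cast
    field_simp
    rw [Complex.I_sq]
    simp
  have hcw := continuous_wave (l := l) hg
  have hsub : ∀ p q : ℝ, ∫ ω in p..q, wave l g ω =
      (Complex.I / l * 𝓕 (gaussianSlope g) (L * q) - Complex.I / l * 𝓕 (gaussianSlope g) (L * p)) +
        ∫ ω in p..q, g 0 * ((Real.exp (-(Real.pi * L ^ 2) * ω ^ 2) : ℝ) : ℂ) := by
    intro p q
    rw [← intervalIntegral.integral_eq_sub_of_hasDerivAt (fun ω _ => hderiv ω)
      (Continuous.intervalIntegrable (by fun_prop) _ _), intervalIntegral.integral_sub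
        (hcw.intervalIntegrable _ _) (Continuous.intervalIntegrable (by fun_prop) _ _)]
    ring
  have hRL := Real.zero_at_infty_fourier (gaussianSlope g)
  have htop : Tendsto (fun p : ℝ × ℝ => 𝓕 (gaussianSlope g) (L * p.2)) (atBot ×ˢ atTop) (𝓝 0) :=
    (hRL.mono_left atTop_le_cocompact).comp (tendsto_snd.const_mul_atTop hLpos)
  have hbot : Tendsto (fun p : ℝ × ℝ => 𝓕 (gaussianSlope g) (L * p.1)) (atBot ×ˢ atTop) (𝓝 0) :=
    (hRL.mono_left atBot_le_cocompact).comp (tendsto_fst.const_mul_atBot hLpos)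
  have hlim := ((htop.const_mul (Complex.I / l)).sub (hbot.const_mul (Complex.I / l))).add
    (intervalIntegral_tendsto_integral (μ := volume) (hgauss.ofReal.const_mul (g 0))
      tendsto_fst tendsto_snd)
  have hval : ∫ ω : ℝ, g 0 * ((Real.exp (-(Real.pi * L ^ 2) * ω ^ 2) : ℝ) : ℂ) =
      ((2 * Real.pi / l : ℝ) : ℂ) * g 0 := by
    rw [integral_const_mul, integral_complex_ofReal, integral_gaussian,
      show Real.pi / (Real.pi * L ^ 2) = (2 * Real.pi / l) ^ 2 by rw [hL]; field_simp,
      Real.sqrt_sq (by positivity), mul_comm]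
  simp only [mul_zero, sub_zero, zero_add] at hlim
  erw [hval] at hlim
  refine hlim.congr fun p => ?_
  rw [hsub]
  rfl

end Wave


/-! ### Improper and regularized frequency integrals -/

section Regularized

/-- Gaussian cutoff functions increasing to one. -/
def cutoff (n : ℕ) (ω : ℝ) : ℝ := Real.exp (-(1 / ((n : ℝ) + 1)) * ω ^ 2)

theorem cutoff_pos (n : ℕ) (ω : ℝ) : 0 < cutoff n ω := Real.exp_pos _

theorem cutoff_le_one (n : ℕ) (ω : ℝ) : cutoff n ω ≤ 1 :=
  Real.exp_le_one_iff.2 (mul_nonpos_of_nonpos_of_nonneg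
    (neg_nonpos.2 (by positivity)) (sq_nonneg ω))

theorem continuous_cutoff (n : ℕ) : Continuous (cutoff n) := by
  unfold cutoff; fun_prop

theorem integrable_cutoff (n : ℕ) : Integrable (cutoff n) :=
  integrable_exp_neg_mul_sq (by positivity)

theorem norm_cutoff_mul_le (n : ℕ) (ω : ℝ) (z : ℂ) : ‖(cutoff n ω : ℂ) * z‖ ≤ ‖z‖ := by
  rw [norm_mul, Complex.norm_of_nonneg (cutoff_pos n ω).le]
  exact mul_le_of_le_one_left (norm_nonneg _) (cutoff_le_one n ω)

/-- The improper integral of `A` and the limit of its Gaussian regularizations both exist and are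
equal to `L`, and the regularizations are bounded by `C`. -/
structure HasRegularizedIntegral (A : ℝ → ℂ) (L : ℂ) (C : ℝ) : Prop where
  intervalIntegrable : ∀ p q : ℝ, IntervalIntegrable A volume p q
  improper : Tendsto (fun p : ℝ × ℝ => ∫ ω in p.1..p.2, A ω) (atBot ×ˢ atTop) (𝓝 L)
  integrable : ∀ n, Integrable fun ω => (cutoff n ω : ℂ) * A ω
  regularized : Tendsto (fun n => ∫ ω, (cutoff n ω : ℂ) * A ω) atTop (𝓝 L)
  bound : ∀ n, ‖∫ ω, (cutoff n ω : ℂ) * A ω‖ ≤ C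

namespace HasRegularizedIntegral

variable {A A' : ℝ → ℂ} {L L' : ℂ} {C C' : ℝ}

theorem mono (h : HasRegularizedIntegral A L C) (hC : C ≤ C') : HasRegularizedIntegral A L C' :=
  ⟨h.1, h.2, h.3, h.4, fun n => (h.5 n).trans hC⟩

theorem norm_le (h : HasRegularizedIntegral A L C) : ‖L‖ ≤ C :=
  le_of_tendsto h.regularized.norm (Eventually.of_forall h.bound)

theorem add (h : HasRegularizedIntegral A L C) (h' : HasRegularizedIntegral A' L' C') :
    HasRegularizedIntegral (fun ω => A ω + A' ω) (L + L') (C + C') := by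
  have key : ∀ n, ∫ ω, (cutoff n ω : ℂ) * (A ω + A' ω) =
      (∫ ω, (cutoff n ω : ℂ) * A ω) + ∫ ω, (cutoff n ω : ℂ) * A' ω := fun n => by
    simp_rw [mul_add]
    exact integral_add (h.integrable n) (h'.integrable n)
  refine ⟨fun p q => (h.1 p q).add (h'.1 p q), ?_, fun n => ?_, ?_, fun n => ?_⟩
  · refine (h.improper.add h'.improper).congr fun p => ?_
    rw [intervalIntegral.integral_add (h.1 _ _) (h'.1 _ _)]
  · simp_rw [mul_add]
    exact (h.integrable n).add (h'.integrable n)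
  · simp_rw [key]
    exact h.regularized.add h'.regularized
  · rw [key]
    exact (norm_add_le _ _).trans (add_le_add (h.bound n) (h'.bound n))

theorem of_integrable (hA : Integrable A) :
    HasRegularizedIntegral A (∫ ω, A ω) (∫ ω, ‖A ω‖) := by
  have hm : ∀ n, AEStronglyMeasurable (fun ω => (cutoff n ω : ℂ) * A ω) := fun n =>
    (Complex.continuous_ofReal.comp (continuous_cutoff n)).aestronglyMeasurable.mul hA.1
  refine ⟨fun p q => hA.intervalIntegrable, ?_, fun n => ?_, ?_, fun n => ?_⟩
  · exact intervalIntegral_tendsto_integral hA tendsto_fst tendsto_snd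
  · exact hA.norm.mono' (hm n) (Eventually.of_forall fun ω => norm_cutoff_mul_le n ω _)
  · refine tendsto_integral_of_dominated_convergence _ hm hA.norm
      (fun n => Eventually.of_forall fun ω => norm_cutoff_mul_le n ω _)
      (Eventually.of_forall fun ω => ?_)
    have h := ((Complex.continuous_ofReal.tendsto _).comp (tendsto_gaussian_one ω)).mul_const (A ω)
    rw [Complex.ofReal_one, one_mul] at h
    exact h
  · exact norm_integral_le_of_norm_le hA.norm
      (Eventually.of_forall fun ω => norm_cutoff_mul_le n ω _)

/-- The improper limit and the Gaussian limit are computed separately and both equal 2π g(0) / l. -/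
theorem wave {l : ℝ} {g : ℝ → ℂ} (hl : 0 < l) (hg : Integrable g) {B K : ℝ}
    (hB : ∀ t, ‖g t‖ ≤ B) (hK : ∀ t, ‖g t - g 0‖ ≤ K * |t|) :
    HasRegularizedIntegral (wave l g) (((2 * Real.pi / l : ℝ) : ℂ) * g 0)
      (2 * Real.pi / l * B) := by
  have hc := continuous_wave (l := l) hg
  have hc0 : ContinuousAt g 0 := by
    refine tendsto_iff_norm_sub_tendsto_zero.2 (squeeze_zero (fun t => norm_nonneg _) hK ?_)
    have : Continuous fun t : ℝ => K * |t| := by fun_prop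
    simpa using this.tendsto 0
  refine ⟨fun p q => hc.intervalIntegrable _ _, tendsto_integral_wave hl hg hK, fun n => ?_,
    tendsto_integral_gaussian_mul_wave hl hg hB hc0, fun n => ?_⟩
  · exact integrable_gaussian_mul_of_bdd (by positivity) hc.aestronglyMeasurable (norm_wave_le l g)
  · have := norm_integral_gaussian_mul_wave_le hl hg hB (δ := 1 / ((n : ℝ) + 1)) (by positivity) 0
    simp only [mul_zero, Complex.ofReal_zero, Complex.exp_zero, one_mul] at this
    exact this

theorem iteratedIntegralConverges {Ω : Set E3} {a : ℝ → E3 → ℂ}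
    (h : HasRegularizedIntegral (fun ω => ∫ ξ, a ω ξ ∂(surfaceMeasure Ω)) L C)
    (ha : ∀ ω, Integrable (a ω) (surfaceMeasure Ω)) : IteratedIntegralConverges Ω a :=
  ⟨ha, h.intervalIntegrable, L, h.improper⟩

theorem iteratedIntegral_eq {Ω : Set E3} {a : ℝ → E3 → ℂ}
    (h : HasRegularizedIntegral (fun ω => ∫ ξ, a ω ξ ∂(surfaceMeasure Ω)) L C) :
    iteratedIntegral Ω a = L :=
  Tendsto.limUnder_eq h.improper

end HasRegularizedIntegral

/-- A measurable integrand dominated by an integrable function of the frequency. -/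
theorem integrable_prod_of_dominated {Ω : Set E3} [IsFiniteMeasure (surfaceMeasure Ω)]
    {a : ℝ → E3 → ℂ} {φ : ℝ → ℝ} (ha : Measurable (Function.uncurry a)) (hφ : Integrable φ)
    (h : ∀ ω, ∀ ξ ∈ frontier Ω, ‖a ω ξ‖ ≤ φ ω) :
    Integrable (Function.uncurry a) ((volume : Measure ℝ).prod (surfaceMeasure Ω)) := by
  refine (hφ.comp_fst (surfaceMeasure Ω)).mono' ha.aestronglyMeasurable ?_
  filter_upwards [Measure.quasiMeasurePreserving_snd.ae
    (ae_restrict_mem (isClosed_frontier (s := Ω)).measurableSet)] with p hp using h p.1 p.2 hp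

theorem HasRegularizedIntegral.of_dominated {Ω : Set E3} [IsFiniteMeasure (surfaceMeasure Ω)]
    {a : ℝ → E3 → ℂ} {φ : ℝ → ℝ} (ha : Measurable (Function.uncurry a)) (hφ : Integrable φ)
    (h : ∀ ω, ∀ ξ ∈ frontier Ω, ‖a ω ξ‖ ≤ φ ω) :
    HasRegularizedIntegral (fun ω => ∫ ξ, a ω ξ ∂(surfaceMeasure Ω))
      (∫ ω, ∫ ξ, a ω ξ ∂(surfaceMeasure Ω))
      ((surfaceMeasure Ω).real Set.univ * ∫ ω, φ ω) := by
  have hint := (integrable_prod_of_dominated ha hφ h).integral_prod_left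
  refine (HasRegularizedIntegral.of_integrable hint).mono ?_
  rw [← integral_const_mul]
  refine integral_mono hint.norm (hφ.const_mul _) fun ω => ?_
  have := norm_integral_le_of_norm_le_const (μ := surfaceMeasure Ω) (f := a ω) (C := φ ω) (by
    filter_upwards [ae_restrict_mem isClosed_frontier.measurableSet] with ξ hξ using h ω ξ hξ)
  rwa [mul_comm] at this

theorem integrable_surfaceMeasure_of_bdd {Ω : Set E3} [IsFiniteMeasure (surfaceMeasure Ω)]
    {f : E3 → ℂ} (hf : Measurable f) {C : ℝ} (h : ∀ ξ ∈ frontier Ω, ‖f ξ‖ ≤ C) :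
    Integrable f (surfaceMeasure Ω) :=
  Integrable.of_bound hf.aestronglyMeasurable C (by
    filter_upwards [ae_restrict_mem isClosed_frontier.measurableSet] with ξ hξ using h ξ hξ)

end Regularized

/-! ### The frequency densities of the parts of the kernel -/

section Densities

open Set

/-- The common factor of the integrands of the parts of the kernel. -/
def phaseFactor (c k : ℝ) (x y : E3) (ω : ℝ) (ξ : E3) : ℂ :=
  Complex.exp (Complex.I * ((ω / c * (‖ξ - y‖ - ‖ξ - x‖) : ℝ) : ℂ)) /
      ((‖ξ - y‖ : ℂ) * (‖ξ - x‖ : ℂ)) *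
    ((Real.exp (-k * (‖ξ - y‖ + ‖ξ - x‖)) : ℝ) : ℂ)

variable {Ω : Set E3} {ε : ℝ} {x y ξ : E3} {c k ω : ℝ} {κ κs : ℝ → ℂ}

theorem inv_norm_mul_norm_le (hε : 0 < ε) (hx : x ∈ innerDomain Ω ε) (hy : y ∈ innerDomain Ω ε)
    (hξ : ξ ∈ frontier Ω) : (‖ξ - y‖ * ‖ξ - x‖)⁻¹ ≤ (ε * ε)⁻¹ := by
  have h1 := (lt_norm_sub_of_mem_innerDomain hx hξ).le
  have h2 := (lt_norm_sub_of_mem_innerDomain hy hξ).le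
  gcongr

theorem norm_phaseFactor_le (hε : 0 < ε) (hx : x ∈ innerDomain Ω ε) (hy : y ∈ innerDomain Ω ε)
    (hξ : ξ ∈ frontier Ω) (hk : 0 ≤ k) : ‖phaseFactor c k x y ω ξ‖ ≤ (ε * ε)⁻¹ := by
  rw [phaseFactor, norm_mul, norm_div, norm_exp_I_mul_ofReal, norm_mul, Complex.norm_real,
    Complex.norm_real, norm_norm, norm_norm, one_div, Complex.norm_of_nonneg (Real.exp_pos _).le]
  refine (mul_le_of_le_one_right (by positivity) (Real.exp_le_one_iff.2 ?_)).trans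
    (inv_norm_mul_norm_le hε hx hy hξ)
  have : 0 ≤ k * (‖ξ - y‖ + ‖ξ - x‖) := by positivity
  linarith

theorem measurable_phaseFactor (c k : ℝ) : Measurable fun q : (E3 × E3) × ℝ × E3 =>
    phaseFactor c k q.1.1 q.1.2 q.2.1 q.2.2 := by
  unfold phaseFactor; fun_prop

theorem measurable_linearTerm (hκs : Measurable κs) : Measurable fun q : (E3 × E3) × ℝ × E3 =>
    linearTerm κs q.1.1 q.1.2 q.2.1 q.2.2 := by
  have h : Measurable fun q : (E3 × E3) × ℝ × E3 => κs q.2.1 :=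
    hκs.comp (measurable_fst.comp measurable_snd)
  have h' := Complex.continuous_conj.measurable.comp h
  unfold linearTerm
  exact ((measurable_const.mul h).mul (by fun_prop)).sub ((measurable_const.mul h').mul (by fun_prop))

theorem splitIntegrand_eq (c k : ℝ) (κs : ℝ → ℂ) (j : Fin 3) :
    splitIntegrand c k κs j x y ω ξ = phaseFactor c k x y ω ξ * splitFactor κs x y ω ξ j := rfl

theorem measurable_splitIntegrand (c k : ℝ) (hκs : Measurable κs) (j : Fin 3) :
    Measurable fun q : (E3 × E3) × ℝ × E3 =>
      splitIntegrand c k κs j q.1.1 q.1.2 q.2.1 q.2.2 := by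
  have h := measurable_linearTerm hκs
  refine (measurable_phaseFactor c k).mul ?_
  fin_cases j
  · exact measurable_const
  · exact h
  · exact (h.cexp.sub h).sub measurable_const

theorem measurable_kernelIntegrand (hκ : Measurable κ) : Measurable fun q : (E3 × E3) × ℝ × E3 =>
    kernelIntegrand κ q.1.1 q.1.2 q.2.1 q.2.2 := by
  have h := measurable_linearTerm hκ
  exact h.cexp.div (by fun_prop)

theorem measurable_uncurry_of_measurable {α β γ δ : Type*} [MeasurableSpace α] [MeasurableSpace β]
    [MeasurableSpace γ] [MeasurableSpace δ] {f : α → α → β → γ → δ}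
    (hf : Measurable fun q : (α × α) × β × γ => f q.1.1 q.1.2 q.2.1 q.2.2) (x y : α) :
    Measurable (Function.uncurry (f x y)) :=
  hf.comp (measurable_prodMk_left (x := (x, y)))

theorem norm_linearTerm_le {D : ℝ} (hx : ‖ξ - x‖ ≤ D) (hy : ‖ξ - y‖ ≤ D) :
    ‖linearTerm κs x y ω ξ‖ ≤ 2 * D * ‖κs ω‖ := by
  refine (norm_sub_le _ _).trans ?_
  simp only [norm_mul, Complex.norm_I, one_mul, RCLike.norm_conj, Complex.norm_real, norm_norm]
  nlinarith [norm_nonneg (κs ω)]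

/-- The three factors add up to the exponential of the linear term, while the real linear part and
the constant part of κ supply phase and damping. -/
theorem kernelIntegrand_eq_sum {kinf : ℝ} (h : IsWeakRepresentation κ c kinf κs) :
    kernelIntegrand κ x y ω ξ = ∑ j : Fin 3, splitIntegrand c kinf κs j x y ω ξ := by
  simp only [splitIntegrand_eq, ← Finset.mul_sum]
  have h1 : ∑ j : Fin 3, splitFactor κs x y ω ξ j = Complex.exp (linearTerm κs x y ω ξ) := by
    rw [Fin.sum_univ_three]
    simp only [splitFactor, Matrix.cons_val]
    ring
  rw [h1, kernelIntegrand, phaseFactor, div_mul_eq_mul_div, div_mul_eq_mul_div, Complex.ofReal_exp,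
    ← Complex.exp_add, ← Complex.exp_add, h.eq, linearTerm]
  congr 2
  simp only [map_add, map_mul, Complex.conj_ofReal, Complex.conj_I]
  push_cast
  ring_nf
  rw [Complex.I_sq]
  ring

theorem integrable_norm_sq_wave {l : ℝ} {g : ℝ → ℂ} (hl : 0 < l) (hg : Integrable g) {B : ℝ}
    (hB : ∀ t, ‖g t‖ ≤ B) : Integrable (fun ω => ‖wave l g ω‖ ^ 2) ∧
      ∫ ω, ‖wave l g ω‖ ^ 2 ≤ 2 * Real.pi / l * B * ∫ t, ‖g t‖ := by
  have hc := continuous_wave (l := l) hg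
  have hle := lintegral_sq_wave_le hl hg hB
  have hB0 : 0 ≤ B := (norm_nonneg _).trans (hB 0)
  have hi : 0 ≤ ∫ t, ‖g t‖ := integral_nonneg fun _ => norm_nonneg _
  have hm : AEStronglyMeasurable (fun ω => ‖wave l g ω‖ ^ 2) volume :=
    Continuous.aestronglyMeasurable (by fun_prop)
  have hint : Integrable (fun ω => ‖wave l g ω‖ ^ 2) := by
    refine ⟨hm, ?_⟩
    rw [hasFiniteIntegral_iff_ofReal (Eventually.of_forall fun ω => by positivity)]
    exact hle.trans_lt ENNReal.ofReal_lt_top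
  refine ⟨hint, ?_⟩
  rw [← ofReal_integral_eq_lintegral_ofReal hint (Eventually.of_forall fun ω => by positivity)]
    at hle
  exact (ENNReal.ofReal_le_ofReal_iff (by positivity)).1 hle

/-- The layer densities, extended by zero to the real line. -/
def amplitude (Ω : Set E3) (b : OrthonormalBasis (Fin 3) ℝ E3) (m : E3) (a : ℝ) (F : E3 → ℂ) :
    ℝ → ℂ := (Ioo (-1 : ℝ) 1).indicator (layer Ω b m a F)

namespace BipolarFrame

variable {b : OrthonormalBasis (Fin 3) ℝ E3} {m : E3} {a : ℝ} {F : E3 → ℂ}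

theorem integrable_amplitude (H : BipolarFrame Ω ε b m a) (hF : ContinuousOn F (frontier Ω)) :
    Integrable (amplitude Ω b m a F) :=
  (integrable_indicator_iff measurableSet_Ioo).2 (H.integrableOn_layer hF)

theorem norm_amplitude_le (H : BipolarFrame Ω ε b m a) {D : ℝ} (hD0 : 0 ≤ D)
    (hD : ∀ z ∈ closure Ω, ∀ w ∈ closure Ω, ‖z - w‖ ≤ D) {M : ℝ} (hM0 : 0 ≤ M)
    (hM : ∀ ξ ∈ frontier Ω, ‖F ξ‖ ≤ M) (t : ℝ) :
    ‖amplitude Ω b m a F t‖ ≤ 2 * Real.pi * (D / ε) * M := by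
  have hε := H.eps_pos
  by_cases ht : t ∈ Ioo (-1 : ℝ) 1
  · rw [amplitude, indicator_of_mem ht]
    exact H.norm_layer_le hD hM ht
  · rw [amplitude, indicator_of_notMem ht, norm_zero]
    positivity

theorem integral_norm_amplitude_le {B : ℝ} (hB : ∀ t, ‖amplitude Ω b m a F t‖ ≤ B) :
    ∫ t, ‖amplitude Ω b m a F t‖ ≤ 2 * B := by
  have h : ∀ t, ‖amplitude Ω b m a F t‖ ≤ (Ioo (-1 : ℝ) 1).indicator (fun _ => B) t := by
    intro t
    by_cases ht : t ∈ Ioo (-1 : ℝ) 1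
    · rw [indicator_of_mem ht]
      exact hB t
    · rw [amplitude, indicator_of_notMem ht, indicator_of_notMem ht, norm_zero]
  have hi : Integrable ((Ioo (-1 : ℝ) 1).indicator fun _ => B) :=
    (integrable_indicator_iff measurableSet_Ioo).2 (integrableOn_const (by simp))
  refine (integral_mono_of_nonneg (Eventually.of_forall fun _ => norm_nonneg _) hi
    (Eventually.of_forall h)).trans_eq ?_
  rw [integral_indicator measurableSet_Ioo, setIntegral_const, Real.volume_real_Ioo_of_le
    (by norm_num), smul_eq_mul]
  norm_num

/-- The surface integral at the frequency `ω` is a Fourier integral of the layer densities. -/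
theorem integral_phase_mul_eq_wave (H : BipolarFrame Ω ε b m a) (hF : ContinuousOn F (frontier Ω))
    (c ω : ℝ) :
    ∫ ξ, Complex.exp (Complex.I * ((ω / c * (‖ξ - (m + a • b 0)‖ - ‖ξ - (m - a • b 0)‖) : ℝ) : ℂ)) /
        ((‖ξ - (m + a • b 0)‖ : ℂ) * (‖ξ - (m - a • b 0)‖ : ℂ)) * F ξ ∂(surfaceMeasure Ω) =
      wave (2 * a / c) (amplitude Ω b m a F) ω := by
  refine (integral_congr_ae (Eventually.of_forall fun ξ => div_mul_eq_mul_div _ _ _)).trans ?_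
  have hphase : ContinuousOn (fun ξ => Complex.exp (Complex.I *
      ((ω / c * (‖ξ - (m + a • b 0)‖ - ‖ξ - (m - a • b 0)‖) : ℝ) : ℂ)) * F ξ) (frontier Ω) :=
    ContinuousOn.mul (Continuous.continuousOn (by fun_prop)) hF
  rw [H.integral_surfaceMeasure_eq hphase, wave, ← integral_indicator measurableSet_Ioo]
  refine integral_congr_ae (Eventually.of_forall fun t => ?_)
  simp only [amplitude]
  by_cases ht : t ∈ Ioo (-1 : ℝ) 1
  · rw [indicator_of_mem ht, indicator_of_mem ht, H.layer_phase_mul F _ (Ioo_subset_Icc_self ht)]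
    congr 4
    ring
  · rw [indicator_of_notMem ht, indicator_of_notMem ht, mul_zero]

/-- Extension by zero may create jumps at t = ±1, so the estimate is anchored at 0. For |t| > 1/2
the trivial bound 2B is at most 4B|t|, whence the second entry of the maximum. -/
theorem exists_lipschitz_amplitude (H : BipolarFrame Ω ε b m a) {k : ℝ}
    (hFk : F = fun ξ =>
      ((Real.exp (-k * (‖ξ - (m + a • b 0)‖ + ‖ξ - (m - a • b 0)‖)) : ℝ) : ℂ)) {B : ℝ}
    (hB : ∀ t, ‖amplitude Ω b m a F t‖ ≤ B) :
    ∃ K, ∀ t, ‖amplitude Ω b m a F t - amplitude Ω b m a F 0‖ ≤ K * |t| := by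
  obtain ⟨K, hK⟩ := H.exists_lipschitz_layer k
  rw [← hFk] at hK
  have hB0 : 0 ≤ B := (norm_nonneg _).trans (hB 0)
  refine ⟨max K (4 * B), fun t => ?_⟩
  by_cases ht : t ∈ Icc (-(1 / 2) : ℝ) (1 / 2)
  · have ht' : t ∈ Ioo (-1 : ℝ) 1 := ⟨by linarith [ht.1], by linarith [ht.2]⟩
    have h0 : (0 : ℝ) ∈ Ioo (-1 : ℝ) 1 := by norm_num
    rw [amplitude, indicator_of_mem ht', indicator_of_mem h0]
    exact (hK t ht).trans (mul_le_mul_of_nonneg_right (le_max_left _ _) (abs_nonneg t))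
  · have h1 : 1 / 2 < |t| := by
      by_contra h
      exact ht (abs_le.1 (not_lt.1 h))
    have h2 := (norm_sub_le _ _).trans (add_le_add (hB t) (hB 0))
    have h3 : 4 * B * |t| ≤ max K (4 * B) * |t| :=
      mul_le_mul_of_nonneg_right (le_max_right _ _) (abs_nonneg t)
    nlinarith

end BipolarFrame

end Densities


/-! ### Convergence and size of the parts of the kernel -/

section Parts

open Set

variable {Ω : Set E3} {ε : ℝ} {c k : ℝ} {κ κs : ℝ → ℂ}

/-- The inner domain for the given ε may be empty, so two foci are taken in a small ball of radius r
inside Ω, with r/4 in the role of ε. -/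
theorem isFiniteMeasure_surfaceMeasure (hΩ_open : IsOpen Ω) (hΩ_ne : Ω.Nonempty)
    (hΩ_bdd : Bornology.IsBounded Ω) (hΩ_convex : Convex ℝ Ω) (hΩ_smooth : HasSmoothBoundary Ω) :
    IsFiniteMeasure (surfaceMeasure Ω) := by
  obtain ⟨x, hx⟩ := hΩ_ne
  obtain ⟨r, hr, hball⟩ := Metric.isOpen_iff.1 hΩ_open x hx
  obtain ⟨v, hv⟩ := exists_norm_eq E3 (c := r / 4) (by positivity)
  have hfr : (frontier Ω).Nonempty := by
    refine nonempty_frontier_iff.2 ⟨⟨x, hx⟩, fun h => ?_⟩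
    rw [h] at hΩ_bdd
    exact NormedSpace.unbounded_univ ℝ E3 hΩ_bdd
  have hmem : ∀ z ∈ Metric.ball x (r / 2), z ∈ innerDomain Ω (r / 4) := by
    intro z hz
    refine ⟨hball (Metric.ball_subset_ball (by linarith) hz), ?_⟩
    refine lt_of_lt_of_le (by linarith : r / 4 < r / 2) ?_
    refine (Metric.le_infDist hfr).2 fun ξ hξ => ?_
    have h1 : r ≤ dist ξ x := by
      by_contra h
      exact (hΩ_open.frontier_eq ▸ hξ : ξ ∈ closure Ω \ Ω).2 (hball (not_le.1 h))
    have h2 := dist_triangle ξ z x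
    rw [dist_comm z ξ]
    have h3 := Metric.mem_ball.1 hz
    linarith
  have hxy : x ≠ x + v := by
    intro h
    rw [left_eq_add] at h
    rw [h, norm_zero] at hv
    linarith
  obtain ⟨b, m, a, H, -⟩ := exists_bipolarFrame hΩ_open hΩ_bdd hΩ_convex hΩ_smooth
    (by positivity : 0 < r / 4) (hmem x (Metric.mem_ball_self (by positivity)))
    (hmem (x + v) (by rw [mem_ball_iff_norm, add_sub_cancel_left, hv]; linarith)) hxy
  exact H.isFiniteMeasure_surfaceMeasure

/-- The frequency density of the principal part has an improper integral, which is a line integral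
over the bisecting section. -/
theorem exists_hasRegularizedIntegral_zero (hΩ_open : IsOpen Ω) (hΩ_bdd : Bornology.IsBounded Ω)
    (hΩ_convex : Convex ℝ Ω) (hΩ_smooth : HasSmoothBoundary Ω) (hε : 0 < ε) (hc : 0 < c)
    (hk : 0 ≤ k) (κs : ℝ → ℂ) :
    ∃ C : ℝ, ∀ x ∈ innerDomain Ω ε, ∀ y ∈ innerDomain Ω ε, x ≠ y →
      Integrable (sectionIntegrand Ω k x y) (sectionMeasure Ω x y) ∧
      HasRegularizedIntegral
        (fun ω => ∫ ξ, splitIntegrand c k κs 0 x y ω ξ ∂(surfaceMeasure Ω))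
        ((2 * Real.pi / (‖y - x‖ / c) *
          ∫ ξ, sectionIntegrand Ω k x y ξ ∂(sectionMeasure Ω x y) : ℝ) : ℂ) (C / ‖x - y‖) := by
  obtain ⟨D, hD0, hD⟩ := exists_diam_bound hΩ_bdd
  -- The density is bounded by 2π (D/ε) times the sup of the damping factor, which is at most 1; the
  -- remaining 2πc is |x - y| times 2π/l with l = |x - y|/c.
  refine ⟨2 * Real.pi * c * (2 * Real.pi * (D / ε) * 1), fun x hx y hy hxy => ?_⟩
  obtain ⟨b, m, a, H, rfl, rfl, ha⟩ :=
    exists_bipolarFrame hΩ_open hΩ_bdd hΩ_convex hΩ_smooth hε hx hy hxy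
  obtain ⟨hint, hval⟩ := H.integral_sectionMeasure_eq k
  refine ⟨hint, ?_⟩
  rw [Complex.ofReal_mul, hval]
  generalize hFk : (fun ξ : E3 =>
    ((Real.exp (-k * (‖ξ - (m + a • b 0)‖ + ‖ξ - (m - a • b 0)‖)) : ℝ) : ℂ)) = F
  have hF : ContinuousOn F (frontier Ω) := by
    rw [← hFk]; exact Continuous.continuousOn (by fun_prop)
  have hM : ∀ ξ ∈ frontier Ω, ‖F ξ‖ ≤ 1 := fun ξ _ => by
    rw [← hFk, Complex.norm_of_nonneg (Real.exp_pos _).le, Real.exp_le_one_iff]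
    have : 0 ≤ k * (‖ξ - (m + a • b 0)‖ + ‖ξ - (m - a • b 0)‖) := by positivity
    linarith
  have hB := H.norm_amplitude_le hD0.le hD zero_le_one hM
  obtain ⟨K, hK⟩ := H.exists_lipschitz_amplitude hFk.symm hB
  have hl : 0 < 2 * a / c := by have := H.pos; positivity
  have hw := HasRegularizedIntegral.wave hl (H.integrable_amplitude hF) hB hK
  rw [← ha]
  have h0 : amplitude Ω b m a F 0 = layer Ω b m a F 0 := by
    rw [amplitude, indicator_of_mem (by norm_num)]
  rw [h0] at hw
  convert hw using 1
  · ext ω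
    rw [← H.integral_phase_mul_eq_wave hF, ← hFk]
    simp [splitIntegrand, splitFactor]
  · rw [norm_sub_rev, ← ha]
    have := H.pos
    field_simp

/-- The frequency density of the part linear in `κ_*` is integrable. -/
theorem exists_hasRegularizedIntegral_one (hΩ_open : IsOpen Ω) (hΩ_bdd : Bornology.IsBounded Ω)
    (hΩ_convex : Convex ℝ Ω) (hΩ_smooth : HasSmoothBoundary Ω) (hε : 0 < ε) (hc : 0 < c)
    (hk : 0 ≤ k) (hκs : Continuous κs) (hκs2 : MemLp κs 2 volume) :
    ∃ C : ℝ, ∀ x ∈ innerDomain Ω ε, ∀ y ∈ innerDomain Ω ε, x ≠ y → ∃ L,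
      HasRegularizedIntegral
        (fun ω => ∫ ξ, splitIntegrand c k κs 1 x y ω ξ ∂(surfaceMeasure Ω)) L (C / ‖x - y‖) := by
  obtain ⟨D, hD0, hD⟩ := exists_diam_bound hΩ_bdd
  have hsq : Integrable fun ω => ‖κs ω‖ ^ 2 :=
    (memLp_two_iff_integrable_sq_norm hκs.aestronglyMeasurable).1 hκs2
  set B := 2 * Real.pi * (D / ε) * D with hBdef
  -- The arithmetic-geometric inequality separates κ_* from the waves. Its square contributes a
  -- constant, multiplied by D ≥ |x - y|; the squares of the waves contribute (2π/l) B · 2B with l =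
  -- |x - y|/c.
  refine ⟨D * (∫ ω, ‖κs ω‖ ^ 2) + 2 * Real.pi * c * B * (2 * B), fun x hx y hy hxy => ?_⟩
  obtain ⟨b, m, a, H, rfl, rfl, ha⟩ :=
    exists_bipolarFrame hΩ_open hΩ_bdd hΩ_convex hΩ_smooth hε hx hy hxy
  have hpos := H.pos
  have hfin := H.isFiniteMeasure_surfaceMeasure
  have hl : 0 < 2 * a / c := by positivity
  have hE : ∀ ξ : E3, Real.exp (-k * (‖ξ - (m + a • b 0)‖ + ‖ξ - (m - a • b 0)‖)) ≤ 1 := fun ξ => by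
    rw [Real.exp_le_one_iff]
    have : 0 ≤ k * (‖ξ - (m + a • b 0)‖ + ‖ξ - (m - a • b 0)‖) := by positivity
    linarith
  -- Once κ_* is taken out of the surface integral, the factor |ξ - z| with z = y or z = x is
  -- absorbed into the bounded amplitude, and the L² bound for waves applies.
  have key : ∀ z ∈ innerDomain Ω ε, ∃ W : ℝ → ℂ, Continuous W ∧ Integrable (fun ω => ‖W ω‖ ^ 2) ∧
      ∫ ω, ‖W ω‖ ^ 2 ≤ 2 * Real.pi / (2 * a / c) * B * (2 * B) ∧
      ∀ ω, ∫ ξ, phaseFactor c k (m - a • b 0) (m + a • b 0) ω ξ * (‖ξ - z‖ : ℂ)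
        ∂(surfaceMeasure Ω) = W ω := by
    intro z hz
    set F : E3 → ℂ := fun ξ =>
      ((Real.exp (-k * (‖ξ - (m + a • b 0)‖ + ‖ξ - (m - a • b 0)‖)) : ℝ) : ℂ) * (‖ξ - z‖ : ℂ) with hFk
    have hF : ContinuousOn F (frontier Ω) := Continuous.continuousOn (by fun_prop)
    have hM : ∀ ξ ∈ frontier Ω, ‖F ξ‖ ≤ D := fun ξ hξ => by
      rw [hFk, norm_mul, Complex.norm_of_nonneg (Real.exp_pos _).le, Complex.norm_real, norm_norm]
      exact (mul_le_of_le_one_left (norm_nonneg _) (hE ξ)).trans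
        (hD _ (frontier_subset_closure hξ) _ (subset_closure hz.1))
    have hB := H.norm_amplitude_le hD0.le hD hD0.le hM
    have hi := H.integrable_amplitude hF
    obtain ⟨h1, h2⟩ := integrable_norm_sq_wave hl hi hB
    refine ⟨wave (2 * a / c) (amplitude Ω b m a F), continuous_wave hi, h1, h2.trans ?_, fun ω => ?_⟩
    · have h3 := BipolarFrame.integral_norm_amplitude_le hB
      have h4 : 0 ≤ 2 * Real.pi / (2 * a / c) * B := by positivity
      exact mul_le_mul_of_nonneg_left h3 h4
    · rw [← H.integral_phase_mul_eq_wave hF]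
      refine integral_congr_ae (Eventually.of_forall fun ξ => ?_)
      simp only [phaseFactor, hFk, mul_assoc]
  obtain ⟨W, hWc, hW2, hWle, hW⟩ := key _ hy
  obtain ⟨V, hVc, hV2, hVle, hV⟩ := key _ hx
  have hphase : ∀ z ∈ innerDomain Ω ε, ∀ ω,
      Integrable (fun ξ => phaseFactor c k (m - a • b 0) (m + a • b 0) ω ξ * (‖ξ - z‖ : ℂ))
        (surfaceMeasure Ω) := by
    intro z hz ω
    refine integrable_surfaceMeasure_of_bdd (C := (ε * ε)⁻¹ * D) ?_ fun ξ hξ => ?_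
    · unfold phaseFactor; fun_prop
    · rw [norm_mul, Complex.norm_real, norm_norm]
      exact mul_le_mul (norm_phaseFactor_le hε hx hy hξ hk)
        (hD _ (frontier_subset_closure hξ) _ (subset_closure hz.1)) (norm_nonneg _) (by positivity)
  have hA : (fun ω => ∫ ξ, splitIntegrand c k κs 1 (m - a • b 0) (m + a • b 0) ω ξ
      ∂(surfaceMeasure Ω)) =
      fun ω => Complex.I * κs ω * W ω - Complex.I * conj (κs ω) * V ω := by
    ext ω
    rw [← hW, ← hV, ← integral_const_mul, ← integral_const_mul,
      ← integral_sub ((hphase _ hy ω).const_mul _) ((hphase _ hx ω).const_mul _)]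
    refine integral_congr_ae (Eventually.of_forall fun ξ => ?_)
    simp only [splitIntegrand_eq, splitFactor, Matrix.cons_val, linearTerm]
    ring
  have hle : ∀ ω, ‖Complex.I * κs ω * W ω - Complex.I * conj (κs ω) * V ω‖ ≤
      ‖κs ω‖ ^ 2 + (‖W ω‖ ^ 2 / 2 + ‖V ω‖ ^ 2 / 2) := by
    intro ω
    refine (norm_sub_le _ _).trans ?_
    simp only [norm_mul, Complex.norm_I, one_mul, RCLike.norm_conj]
    nlinarith [sq_nonneg (‖κs ω‖ - ‖W ω‖), sq_nonneg (‖κs ω‖ - ‖V ω‖)]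
  have hdom : Integrable fun ω => ‖κs ω‖ ^ 2 + (‖W ω‖ ^ 2 / 2 + ‖V ω‖ ^ 2 / 2) :=
    hsq.add ((hW2.div_const 2).add (hV2.div_const 2))
  have hint : Integrable fun ω => Complex.I * κs ω * W ω - Complex.I * conj (κs ω) * V ω := by
    refine hdom.mono' (Continuous.aestronglyMeasurable ?_) (Eventually.of_forall hle)
    have := Complex.continuous_conj.comp hκs
    exact ((continuous_const.mul hκs).mul hWc).sub ((continuous_const.mul this).mul hVc)
  rw [hA]
  refine ⟨_, (HasRegularizedIntegral.of_integrable hint).mono ?_⟩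
  have h1 := integral_mono hint.norm hdom hle
  have hsum : ∫ ω, (‖κs ω‖ ^ 2 + (‖W ω‖ ^ 2 / 2 + ‖V ω‖ ^ 2 / 2)) =
      (∫ ω, ‖κs ω‖ ^ 2) + ((∫ ω, ‖W ω‖ ^ 2) / 2 + (∫ ω, ‖V ω‖ ^ 2) / 2) := by
    rw [integral_add hsq (g := fun ω => ‖W ω‖ ^ 2 / 2 + ‖V ω‖ ^ 2 / 2)
      ((hW2.div_const 2).add (hV2.div_const 2)),
      integral_add (hW2.div_const 2) (hV2.div_const 2), integral_div, integral_div]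
  rw [hsum] at h1
  refine h1.trans ?_
  have h2 : ‖m - a • b 0 - (m + a • b 0)‖ = 2 * a := by rw [norm_sub_rev, ← ha]
  rw [h2, le_div_iff₀ (by positivity)]
  have h3 : 2 * a ≤ D := h2 ▸ hD _ (subset_closure hx.1) _ (subset_closure hy.1)
  have h4 : 0 ≤ ∫ ω, ‖κs ω‖ ^ 2 := integral_nonneg fun _ => by positivity
  have h5 : 2 * Real.pi / (2 * a / c) * B * (2 * B) * (2 * a) = 2 * Real.pi * c * B * (2 * B) := by
    field_simp
  nlinarith

/-- The frequency density of the part of higher order in `κ_*` is integrable. -/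
theorem exists_hasRegularizedIntegral_two [IsFiniteMeasure (surfaceMeasure Ω)]
    (hΩ_bdd : Bornology.IsBounded Ω) (hε : 0 < ε)
    (hk : 0 ≤ k) (hκs : Continuous κs) (hκs2 : MemLp κs 2 volume) {M : ℝ} (hM : ∀ ω, ‖κs ω‖ ≤ M) :
    ∃ C : ℝ, ∀ x ∈ innerDomain Ω ε, ∀ y ∈ innerDomain Ω ε, x ≠ y → ∃ L,
      HasRegularizedIntegral
        (fun ω => ∫ ξ, splitIntegrand c k κs 2 x y ω ξ ∂(surfaceMeasure Ω)) L (C / ‖x - y‖) := by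
  obtain ⟨D, hD0, hD⟩ := exists_diam_bound hΩ_bdd
  have hsq : Integrable fun ω => ‖κs ω‖ ^ 2 :=
    (memLp_two_iff_integrable_sq_norm hκs.aestronglyMeasurable).1 hκs2
  set φ : ℝ → ℝ := fun ω => (ε * ε)⁻¹ * ((2 * D) ^ 2 * Real.exp (2 * D * M)) * ‖κs ω‖ ^ 2 with hφ
  have hφi : Integrable φ := hsq.const_mul _
  have hφ0 : 0 ≤ (surfaceMeasure Ω).real univ * ∫ ω, φ ω :=
    mul_nonneg measureReal_nonneg (integral_nonneg fun ω => by positivity)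
  refine ⟨(surfaceMeasure Ω).real univ * (∫ ω, φ ω) * D, fun x hx y hy hxy => ⟨_,
    (HasRegularizedIntegral.of_dominated (φ := φ) ?_ hφi fun ω ξ hξ => ?_).mono ?_⟩⟩
  · exact measurable_uncurry_of_measurable (f := splitIntegrand c k κs 2)
      (measurable_splitIntegrand c k hκs.measurable 2) x y
  · have h1 := norm_linearTerm_le (κs := κs) (ω := ω)
      (hD _ (frontier_subset_closure hξ) _ (subset_closure hx.1))
      (hD _ (frontier_subset_closure hξ) _ (subset_closure hy.1))
    have h2 : ‖splitFactor κs x y ω ξ 2‖ ≤ (2 * D) ^ 2 * Real.exp (2 * D * M) * ‖κs ω‖ ^ 2 := by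
      -- The second order Taylor remainder is at most |z|² exp|z|; with |z| ≤ 2D|κ_*| ≤ 2DM it is
      -- dominated by a multiple of |κ_*|², which is integrable.
      have h3 := Complex.norm_exp_sub_sum_le_norm_mul_exp (linearTerm κs x y ω ξ) 2
      have h4 : splitFactor κs x y ω ξ 2 = Complex.exp (linearTerm κs x y ω ξ) -
          ∑ i ∈ Finset.range 2, linearTerm κs x y ω ξ ^ i / i.factorial := by
        simp only [splitFactor, Matrix.cons_val, Finset.sum_range_succ, Finset.sum_range_zero]
        simp only [pow_zero, pow_one, Nat.factorial, Nat.cast_one]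
        ring_nf
      rw [h4]
      refine h3.trans ?_
      have h5 : 2 * D * ‖κs ω‖ ≤ 2 * D * M := by have := hM ω; gcongr
      calc _ ≤ (2 * D * ‖κs ω‖) ^ 2 * Real.exp (2 * D * M) := by
            gcongr
            exact h1.trans h5
        _ = _ := by ring
    rw [splitIntegrand_eq, norm_mul]
    calc _ ≤ (ε * ε)⁻¹ * ((2 * D) ^ 2 * Real.exp (2 * D * M) * ‖κs ω‖ ^ 2) :=
          mul_le_mul (norm_phaseFactor_le hε hx hy hξ hk) h2 (norm_nonneg _) (by positivity)
      _ = φ ω := by rw [hφ]; ring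
  · have hpos : 0 < ‖x - y‖ := norm_pos_iff.2 (sub_ne_zero.2 hxy)
    rw [le_div_iff₀ hpos]
    exact mul_le_mul_of_nonneg_left (hD _ (subset_closure hx.1) _ (subset_closure hy.1)) hφ0

theorem integrable_splitIntegrand [IsFiniteMeasure (surfaceMeasure Ω)]
    (hΩ_bdd : Bornology.IsBounded Ω) (hε : 0 < ε) (hk : 0 ≤ k) (hκs : Measurable κs) (j : Fin 3)
    {x y : E3} (hx : x ∈ innerDomain Ω ε) (hy : y ∈ innerDomain Ω ε) (ω : ℝ) :
    Integrable (splitIntegrand c k κs j x y ω) (surfaceMeasure Ω) := by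
  obtain ⟨D, hD0, hD⟩ := exists_diam_bound hΩ_bdd
  set N := 2 * D * ‖κs ω‖
  have hN : 0 ≤ N := by positivity
  refine integrable_surfaceMeasure_of_bdd (C := (ε * ε)⁻¹ * (Real.exp N + N + 1)) ?_ fun ξ hξ => ?_
  · exact (measurable_uncurry_of_measurable (f := splitIntegrand c k κs j)
      (measurable_splitIntegrand c k hκs j) x y).of_uncurry_left
  · have h1 : ‖linearTerm κs x y ω ξ‖ ≤ N := norm_linearTerm_le
      (hD _ (frontier_subset_closure hξ) _ (subset_closure hx.1))
      (hD _ (frontier_subset_closure hξ) _ (subset_closure hy.1))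
    rw [splitIntegrand_eq, norm_mul]
    refine mul_le_mul (norm_phaseFactor_le hε hx hy hξ hk) ?_ (norm_nonneg _) (by positivity)
    have h2 := Real.exp_pos N
    have h3 := (Complex.norm_exp_le_exp_norm (linearTerm κs x y ω ξ)).trans (Real.exp_le_exp.2 h1)
    fin_cases j
    · simp only [splitFactor]
      simp
      linarith
    · simp only [splitFactor]
      simp
      linarith
    · simp only [splitFactor]
      refine (norm_sub_le _ _).trans ?_
      rw [norm_one]
      have := norm_sub_le (Complex.exp (linearTerm κs x y ω ξ)) (linearTerm κs x y ω ξ)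
      linarith

end Parts


/-! ### Hilbert-Schmidt operators -/

section HilbertSchmidt

universe u

/-- The truncations of the basis expansion have finite rank. By the Cauchy-Schwarz and Bessel
inequalities, their distance to T in operator norm is controlled by the tail of the sum of ‖T bᵢ‖²,
so T is a norm limit of compact operators. -/
theorem IsHilbertSchmidt.isCompactOperator {H : Type u} [NormedAddCommGroup H]
    [InnerProductSpace ℂ H] [CompleteSpace H] {T : H →L[ℂ] H} (hT : IsHilbertSchmidt T) :
    IsCompactOperator T := by
  classical
  obtain ⟨w, b, -⟩ := exists_hilbertBasis ℂ H
  have hsum := hT w b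
  set F : Finset w → H →L[ℂ] H := fun s => ∑ i ∈ s, (innerSL ℂ (b i)).smulRight (T (b i)) with hF
  have hFapply : ∀ s x, F s x = ∑ i ∈ s, ⟪b i, x⟫_ℂ • T (b i) := fun s x => by
    simp [hF]
  have hcompact : ∀ s, IsCompactOperator (F s) := fun s => by
    have : F s ∈ compactOperator (RingHom.id ℂ) H H :=
      Submodule.sum_mem _ fun i _ =>
        (isCompactOperator_of_locallyCompactSpace_dom (innerSL ℂ (b i))).clm_comp
          (ContinuousLinearMap.toSpanSingleton ℂ (T (b i)))
    exact this
  have htail : ∀ s t : Finset w, s ⊆ t → ∀ x, ‖F t x - F s x‖ ≤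
      √(∑ i ∈ t \ s, ‖T (b i)‖ ^ 2) * ‖x‖ := by
    intro s t hst x
    rw [hFapply, hFapply, ← Finset.sum_sdiff hst, add_sub_cancel_right]
    refine (norm_sum_le _ _).trans ?_
    simp_rw [norm_smul]
    refine (Real.le_sqrt_of_sq_le (Finset.sum_mul_sq_le_sq_mul_sq _ _ _)).trans ?_
    rw [mul_comm, Real.sqrt_mul (Finset.sum_nonneg fun _ _ => by positivity)]
    refine mul_le_mul_of_nonneg_left ?_ (Real.sqrt_nonneg _)
    exact Real.sqrt_le_iff.2 ⟨norm_nonneg x, b.orthonormal.sum_inner_products_le x⟩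
  have hlim : ∀ x, Tendsto (fun s => F s x) atTop (𝓝 (T x)) := fun x => by
    have h := (b.hasSum_repr x).mapL T
    simp only [map_smul, b.repr_apply_apply] at h
    simpa only [HasSum, SummationFilter.unconditional_filter, hFapply] using h
  refine isCompactOperator_of_tendsto (l := atTop) (F := F) ?_ (Eventually.of_forall hcompact)
  refine Metric.tendsto_atTop.2 fun δ hδ => ?_
  obtain ⟨s, hs⟩ := summable_iff_vanishing_norm.1 hsum ((δ / 2) ^ 2) (by positivity)
  refine ⟨s, fun s' hs' => ?_⟩
  rw [dist_eq_norm, norm_sub_rev]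
  refine lt_of_le_of_lt (ContinuousLinearMap.opNorm_le_bound _ (by positivity : 0 ≤ δ / 2)
    fun x => ?_) (by linarith)
  refine le_of_tendsto ((hlim x).sub_const (F s' x)).norm ?_
  filter_upwards [eventually_ge_atTop s'] with t ht
  refine (htail s' t ht x).trans (mul_le_mul_of_nonneg_right ?_ (norm_nonneg x))
  refine Real.sqrt_le_iff.2 ⟨by positivity, ?_⟩
  have h := hs (t \ s') (Finset.disjoint_of_subset_right hs' Finset.sdiff_disjoint)
  rw [Real.norm_of_nonneg (Finset.sum_nonneg fun _ _ => by positivity)] at h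
  exact h.le

theorem norm_sq_eq_integral {α : Type*} [MeasurableSpace α] {μ : Measure α} (f : Lp ℂ 2 μ) :
    ‖f‖ ^ 2 = ∫ x, ‖f x‖ ^ 2 ∂μ := by
  have h := inner_self_eq_norm_sq_to_K (𝕜 := ℂ) f
  rw [L2.inner_def] at h
  simp_rw [inner_self_eq_norm_sq_to_K] at h
  have h2 : ∫ x, ((‖f x‖ : ℂ)) ^ 2 ∂μ = ((∫ x, ‖f x‖ ^ 2 ∂μ : ℝ) : ℂ) := by
    rw [← integral_complex_ofReal]
    push_cast; rfl
  have h3 := h2.symm.trans h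
  exact Complex.ofReal_injective ((Complex.ofReal_pow _ _).trans h3.symm)

/-- An operator on `L²` with a square integrable kernel is Hilbert-Schmidt. -/
theorem isHilbertSchmidt_of_kernel {α : Type u} [MeasurableSpace α] {μ : Measure α}
    [IsFiniteMeasure μ] {K : α → α → ℂ} (hK : MemLp (Function.uncurry K) 2 (μ.prod μ))
    {T : Lp ℂ 2 μ →L[ℂ] Lp ℂ 2 μ} (hT : ∀ h : Lp ℂ 2 μ, T h =ᵐ[μ] fun x => ∫ y, K x y * h y ∂μ) :
    IsHilbertSchmidt T := by
  intro ι b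
  have hsq : Integrable (fun p : α × α => ‖K p.1 p.2‖ ^ 2) (μ.prod μ) :=
    (memLp_two_iff_integrable_sq_norm hK.1).1 hK
  refine summable_of_sum_le (c := ∫ x, ∫ y, ‖K x y‖ ^ 2 ∂μ ∂μ) (fun i => by positivity) fun s => ?_
  have hint : ∀ i, Integrable (fun x => ‖T (b i) x‖ ^ 2) μ := fun i =>
    (memLp_two_iff_integrable_sq_norm (Lp.aestronglyMeasurable _)).1 (Lp.memLp (T (b i)))
  simp_rw [norm_sq_eq_integral]
  rw [← integral_finsetSum _ fun i _ => hint i]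
  refine integral_mono_ae (integrable_finsetSum _ fun i _ => hint i) hsq.integral_prod_left ?_
  have hae : ∀ᵐ x ∂μ, ∀ i ∈ s, T (b i) x = ∫ y, K x y * b i y ∂μ :=
    (Finset.eventually_all s).2 fun i _ => hT (b i)
  filter_upwards [hae, hsq.prod_right_ae, hK.1.prodMk_left] with x hx hx2 hxm
  -- For almost every x the values T bᵢ(x) are the coefficients of the conjugated section K(x, ·).
  -- Bessel's inequality bounds their square sum, and integration in x finishes.
  have hmem : MemLp (fun y => conj (K x y)) 2 μ :=
    (memLp_two_iff_integrable_sq_norm (Complex.continuous_conj.comp_aestronglyMeasurable hxm)).2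
      (by simpa only [RCLike.norm_conj, Function.uncurry] using hx2)
  set f := hmem.toLp with hf
  have hinner : ∀ i, ⟪f, b i⟫_ℂ = ∫ y, K x y * b i y ∂μ := fun i => by
    rw [L2.inner_def]
    refine integral_congr_ae ?_
    filter_upwards [hmem.coeFn_toLp] with y hy
    rw [hf, hy]
    simp [mul_comm]
  have hnorm : ‖f‖ ^ 2 = ∫ y, ‖K x y‖ ^ 2 ∂μ := by
    rw [norm_sq_eq_integral]
    refine integral_congr_ae ?_
    filter_upwards [hmem.coeFn_toLp] with y hy
    rw [hf, hy, RCLike.norm_conj]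
  calc ∑ i ∈ s, ‖T (b i) x‖ ^ 2 = ∑ i ∈ s, ‖⟪b i, f⟫_ℂ‖ ^ 2 := by
        refine Finset.sum_congr rfl fun i hi => ?_
        rw [hx i hi, ← hinner, norm_inner_symm]
    _ ≤ ‖f‖ ^ 2 := b.orthonormal.sum_inner_products_le f
    _ = ∫ y, ‖K x y‖ ^ 2 ∂μ := hnorm

end HilbertSchmidt


/-! ### Integral operators whose squares have a regularizable kernel -/

section RegularizedKernel

open Function

variable {Z X : Type*} [MeasurableSpace Z] [MeasurableSpace X]

/-- A bounded kernel `k`, for which the kernels `∫ ρ n z * (k z y * conj (k z x))` obtained with the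
help of cutoff functions `ρ n` converge to `K`, and are dominated by the square integrable function
`B`. -/
structure IsRegularizable (ν : Measure Z) (μ : Measure X) (k : Z → X → ℂ) (ρ : ℕ → Z → ℝ)
    (B : X × X → ℝ) (K : X → X → ℂ) : Prop where
  measurable : Measurable (uncurry k)
  bounded : ∃ M : ℝ, 0 ≤ M ∧ ∃ (S : Set Z) (U : Set X), (∀ᵐ z ∂ν, z ∈ S) ∧ (∀ᵐ x ∂μ, x ∈ U) ∧
    ∀ z ∈ S, ∀ x ∈ U, ‖k z x‖ ≤ M
  integrable_cutoff : ∀ n, Integrable (ρ n) ν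
  cutoff_nonneg : ∀ n z, 0 ≤ ρ n z
  cutoff_le_one : ∀ n z, ρ n z ≤ 1
  tendsto_cutoff : ∀ z, Tendsto (fun n => ρ n z) atTop (𝓝 1)
  measurable_cutoff : ∀ n, Measurable (ρ n)
  memLp_bound : MemLp B 2 (μ.prod μ)
  norm_le_bound : ∀ n, ∀ᵐ p ∂(μ.prod μ), ‖∫ z, (ρ n z : ℂ) * (k z p.2 * conj (k z p.1)) ∂ν‖ ≤ B p
  tendsto : ∀ᵐ p ∂(μ.prod μ),
    Tendsto (fun n => ∫ z, (ρ n z : ℂ) * (k z p.2 * conj (k z p.1)) ∂ν) atTop (𝓝 (K p.1 p.2))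

/-- The integral operator with kernel `k`. -/
def transform (μ : Measure X) (k : Z → X → ℂ) (h : X → ℂ) (z : Z) : ℂ := ∫ y, k z y * h y ∂μ

namespace IsRegularizable

variable {ν : Measure Z} {μ : Measure X} {k : Z → X → ℂ}
  {ρ : ℕ → Z → ℝ} {B : X × X → ℝ} {K : X → X → ℂ} {g h : X → ℂ}

theorem ae_integrable (H : IsRegularizable ν μ k ρ B K) (hh : Integrable h μ) :
    ∀ᵐ z ∂ν, Integrable (fun y => k z y * h y) μ := by
  obtain ⟨M, -, S, U, hS, hU, hM⟩ := H.bounded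
  filter_upwards [hS] with z hz
  refine hh.bdd_mul (c := M) H.measurable.of_uncurry_left.aestronglyMeasurable ?_
  filter_upwards [hU] with y hy using hM z hz y hy

theorem ae_norm_transform_le (H : IsRegularizable ν μ k ρ B K) (hh : Integrable h μ) :
    ∃ C, ∀ᵐ z ∂ν, ‖transform μ k h z‖ ≤ C := by
  obtain ⟨M, hM0, S, U, hS, hU, hM⟩ := H.bounded
  refine ⟨∫ y, M * ‖h y‖ ∂μ, ?_⟩
  filter_upwards [hS] with z hz
  refine norm_integral_le_of_norm_le (hh.norm.const_mul M) ?_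
  filter_upwards [hU] with y hy
  rw [norm_mul]
  exact mul_le_mul_of_nonneg_right (hM z hz y hy) (norm_nonneg _)

theorem aestronglyMeasurable_regularized [SFinite ν] (H : IsRegularizable ν μ k ρ B K) (n : ℕ) :
    AEStronglyMeasurable (fun p : X × X => ∫ z, (ρ n z : ℂ) * (k z p.2 * conj (k z p.1)) ∂ν)
      (μ.prod μ) := by
  have h1 : Measurable fun q : (X × X) × Z => (ρ n q.2 : ℂ) *
      (k q.2 q.1.2 * conj (k q.2 q.1.1)) :=
    (Complex.measurable_ofReal.comp ((H.measurable_cutoff n).comp measurable_snd)).mul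
      ((H.measurable.comp (measurable_snd.prodMk (measurable_snd.comp measurable_fst))).mul
        (Complex.continuous_conj.measurable.comp
          (H.measurable.comp (measurable_snd.prodMk (measurable_fst.comp measurable_fst)))))
  exact h1.stronglyMeasurable.integral_prod_right'.aestronglyMeasurable

theorem memLp_kernel [SFinite ν] (H : IsRegularizable ν μ k ρ B K) :
    MemLp (uncurry K) 2 (μ.prod μ) := by
  refine H.memLp_bound.mono (aestronglyMeasurable_of_tendsto_ae atTop
    H.aestronglyMeasurable_regularized H.tendsto) ?_
  filter_upwards [H.tendsto, ae_all_iff.2 H.norm_le_bound] with p h1 h2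
  exact le_of_tendsto h1.norm (Eventually.of_forall fun n => (h2 n).trans (le_abs_self _))

variable [IsFiniteMeasure μ]

theorem aestronglyMeasurable_transform (H : IsRegularizable ν μ k ρ B K)
    (hh : AEStronglyMeasurable h μ) : AEStronglyMeasurable (transform μ k h) ν :=
  (H.measurable.aestronglyMeasurable.mul hh.comp_snd).integral_prod_right'

variable [SFinite ν]

/-- Fubini is legitimate because the cutoff is integrable in z, g and h are integrable, and k is
bounded almost everywhere; without the cutoff it could fail. -/
theorem integral_cutoff_mul (H : IsRegularizable ν μ k ρ B K) (hg : Integrable g μ)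
    (hh : Integrable h μ) (n : ℕ) :
    ∫ z, (ρ n z : ℂ) * (transform μ k h z * conj (transform μ k g z)) ∂ν =
      ∫ p, (∫ z, (ρ n z : ℂ) * (k z p.2 * conj (k z p.1)) ∂ν) * (conj (g p.1) * h p.2)
        ∂(μ.prod μ) := by
  obtain ⟨M, hM0, S, U, hS, hU, hM⟩ := H.bounded
  have hk2 : Measurable fun q : Z × X × X => k q.1 q.2.2 :=
    H.measurable.comp (measurable_fst.prodMk (measurable_snd.comp measurable_snd))
  have hk1 : Measurable fun q : Z × X × X => conj (k q.1 q.2.1) :=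
    Complex.continuous_conj.measurable.comp
      (H.measurable.comp (measurable_fst.prodMk (measurable_fst.comp measurable_snd)))
  have hgh : Integrable (fun p : X × X => conj (g p.1) * h p.2) (μ.prod μ) :=
    (Complex.conjCLE.toContinuousLinearMap.integrable_comp hg).mul_prod hh
  have hint : Integrable (uncurry fun (z : Z) (p : X × X) =>
      (ρ n z : ℂ) * (k z p.2 * conj (k z p.1)) * (conj (g p.1) * h p.2)) (ν.prod (μ.prod μ)) := by
    have h1 : Integrable (fun q : Z × X × X => (ρ n q.1 : ℂ) * (conj (g q.2.1) * h q.2.2))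
        (ν.prod (μ.prod μ)) := (H.integrable_cutoff n).ofReal.mul_prod hgh
    refine (h1.bdd_mul (c := M * M) (hk2.mul hk1).aestronglyMeasurable ?_).congr
      (Eventually.of_forall fun q => ?_)
    · filter_upwards [Measure.quasiMeasurePreserving_fst.ae hS,
        Measure.quasiMeasurePreserving_snd.ae (Measure.quasiMeasurePreserving_fst.ae hU),
        Measure.quasiMeasurePreserving_snd.ae (Measure.quasiMeasurePreserving_snd.ae hU)]
        with q h1 h2 h3
      rw [Pi.mul_apply, norm_mul, RCLike.norm_conj]
      exact mul_le_mul (hM _ h1 _ h3) (hM _ h1 _ h2) (norm_nonneg _) hM0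
    · simp only [uncurry, Pi.mul_apply]
      ring
  simp_rw [← integral_mul_const]
  rw [← integral_integral_swap hint]
  refine integral_congr_ae (Eventually.of_forall fun z => ?_)
  simp only [transform]
  rw [← integral_conj, mul_comm (∫ y, k z y * h y ∂μ), ← integral_prod_mul, ← integral_const_mul]
  refine integral_congr_ae (Eventually.of_forall fun p => ?_)
  simp only [map_mul]
  ring

theorem memLp_two_mul_prod {g h : X → ℂ} (hg : MemLp g 2 μ) (hh : MemLp h 2 μ) :
    MemLp (fun p : X × X => conj (g p.1) * h p.2) 2 (μ.prod μ) ∧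
      ∫ p : X × X, ‖conj (g p.1) * h p.2‖ ^ 2 ∂(μ.prod μ) =
        (∫ x, ‖g x‖ ^ 2 ∂μ) * ∫ x, ‖h x‖ ^ 2 ∂μ := by
  have hg2 := (memLp_two_iff_integrable_sq_norm hg.1).1 hg
  have hh2 := (memLp_two_iff_integrable_sq_norm hh.1).1 hh
  have hm : AEStronglyMeasurable (fun p : X × X => conj (g p.1) * h p.2) (μ.prod μ) :=
    (Complex.continuous_conj.comp_aestronglyMeasurable hg.1.comp_fst).mul hh.1.comp_snd
  simp only [memLp_two_iff_integrable_sq_norm hm, norm_mul, RCLike.norm_conj, mul_pow]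
  exact ⟨hg2.mul_prod hh2, integral_prod_mul (fun x => ‖g x‖ ^ 2) (fun x => ‖h x‖ ^ 2)⟩

/-- Cauchy-Schwarz on the product space against the common majorant B, so the bound is independent
of n. -/
theorem norm_integral_cutoff_mul_le (H : IsRegularizable ν μ k ρ B K) (hh : MemLp h 2 μ) (n : ℕ) :
    ‖∫ z, (ρ n z : ℂ) * (transform μ k h z * conj (transform μ k h z)) ∂ν‖ ≤
      √(∫ p, ‖B p‖ ^ 2 ∂(μ.prod μ)) * ∫ x, ‖h x‖ ^ 2 ∂μ := by
  have hi := hh.integrable one_le_two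
  obtain ⟨hm, hval⟩ := memLp_two_mul_prod hh hh
  rw [H.integral_cutoff_mul hi hi]
  have hprod : Integrable (fun p : X × X => ‖B p‖ * ‖conj (h p.1) * h p.2‖) (μ.prod μ) :=
    H.memLp_bound.norm.integrable_mul hm.norm
  refine (norm_integral_le_of_norm_le hprod ?_).trans ?_
  · filter_upwards [H.norm_le_bound n] with p hp
    rw [norm_mul]
    exact mul_le_mul_of_nonneg_right (hp.trans (le_abs_self _)) (norm_nonneg _)
  · have h2 : ENNReal.ofReal 2 = 2 := by norm_num
    have hCS := integral_mul_le_Lp_mul_Lq_of_nonneg (μ := μ.prod μ) Real.HolderConjugate.two_two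
      (f := fun p => ‖B p‖) (g := fun p : X × X => ‖conj (h p.1) * h p.2‖)
      (Eventually.of_forall fun p => norm_nonneg _) (Eventually.of_forall fun p => norm_nonneg _)
      (by rw [h2]; exact H.memLp_bound.norm) (by rw [h2]; exact hm.norm)
    simp only [Real.rpow_two, ← Real.sqrt_eq_rpow] at hCS
    refine hCS.trans_eq ?_
    rw [hval, Real.sqrt_mul_self (integral_nonneg fun x => by positivity)]

/-- The uniform bound for the cut-off quadratic form passes to the full integral of |transform|² by
Fatou's lemma. This yields boundedness of the operator. -/
theorem transform_sq_integrable (H : IsRegularizable ν μ k ρ B K) (hh : MemLp h 2 μ) :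
    MemLp (transform μ k h) 2 ν ∧ ∫ z, ‖transform μ k h z‖ ^ 2 ∂ν ≤
      √(∫ p, ‖B p‖ ^ 2 ∂(μ.prod μ)) * ∫ x, ‖h x‖ ^ 2 ∂μ := by
  have hi := hh.integrable one_le_two
  have hm := H.aestronglyMeasurable_transform hh.1
  set R := √(∫ p, ‖B p‖ ^ 2 ∂(μ.prod μ)) * ∫ x, ‖h x‖ ^ 2 ∂μ with hR
  have hR0 : 0 ≤ R := mul_nonneg (Real.sqrt_nonneg _) (integral_nonneg fun x => by positivity)
  obtain ⟨C, hC⟩ := H.ae_norm_transform_le hi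
  have hcut : ∀ n, Integrable (fun z => ρ n z * ‖transform μ k h z‖ ^ 2) ν := fun n => by
    refine (H.integrable_cutoff n).mul_bdd (c := C ^ 2) (hm.norm.pow 2) ?_
    filter_upwards [hC] with z hz
    rw [norm_pow, norm_norm]
    exact pow_le_pow_left₀ (norm_nonneg _) hz 2
  have hle : ∀ n, ∫ z, ρ n z * ‖transform μ k h z‖ ^ 2 ∂ν ≤ R := fun n => by
    refine le_trans (le_of_eq ?_) (H.norm_integral_cutoff_mul_le hh n)
    have h1 : ∫ z, (ρ n z : ℂ) * (transform μ k h z * conj (transform μ k h z)) ∂ν =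
        ((∫ z, ρ n z * ‖transform μ k h z‖ ^ 2 ∂ν : ℝ) : ℂ) := by
      rw [← integral_complex_ofReal]
      refine integral_congr_ae (Eventually.of_forall fun z => ?_)
      simp only [Complex.mul_conj']
      push_cast; rfl
    rw [h1, Complex.norm_of_nonneg (integral_nonneg fun z =>
      mul_nonneg (H.cutoff_nonneg n z) (by positivity))]
  have hlin : ∫⁻ z, ENNReal.ofReal (‖transform μ k h z‖ ^ 2) ∂ν ≤ ENNReal.ofReal R := by
    have hlim : ∀ z, liminf (fun n : ℕ => ENNReal.ofReal (ρ n z * ‖transform μ k h z‖ ^ 2)) atTop =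
        ENNReal.ofReal (‖transform μ k h z‖ ^ 2) := fun z => by
      have := (H.tendsto_cutoff z).mul_const (‖transform μ k h z‖ ^ 2)
      rw [one_mul] at this
      exact ((ENNReal.continuous_ofReal.tendsto _).comp this).liminf_eq
    simp_rw [← hlim]
    refine (lintegral_liminf_le' fun n => (hcut n).1.aemeasurable.ennreal_ofReal).trans ?_
    refine liminf_le_of_frequently_le' (Frequently.of_forall fun n => ?_)
    rw [← ofReal_integral_eq_lintegral_ofReal (hcut n) (Eventually.of_forall fun z =>
      mul_nonneg (H.cutoff_nonneg n z) (by positivity))]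
    exact ENNReal.ofReal_le_ofReal (hle n)
  have hint : Integrable (fun z => ‖transform μ k h z‖ ^ 2) ν := by
    refine ⟨hm.norm.pow 2, ?_⟩
    rw [hasFiniteIntegral_iff_ofReal (Eventually.of_forall fun z => by positivity)]
    exact hlin.trans_lt ENNReal.ofReal_lt_top
  refine ⟨(memLp_two_iff_integrable_sq_norm hm).2 hint, ?_⟩
  rw [← ofReal_integral_eq_lintegral_ofReal hint (Eventually.of_forall fun z => by positivity)]
    at hlin
  exact (ENNReal.ofReal_le_ofReal_iff hR0).1 hlin

/-- The integral operator as a bounded operator, multiplied by a constant. -/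
theorem exists_operator (H : IsRegularizable ν μ k ρ B K) (c : ℂ) :
    ∃ P : Lp ℂ 2 μ →L[ℂ] Lp ℂ 2 ν, ∀ h : Lp ℂ 2 μ,
      P h =ᵐ[ν] fun z => c * transform μ k h z := by
  have hmem : ∀ h : Lp ℂ 2 μ, MemLp (fun z => c * transform μ k h z) 2 ν := fun h =>
    (H.transform_sq_integrable (Lp.memLp h)).1.const_mul c
  have hi : ∀ h : Lp ℂ 2 μ, Integrable h μ := fun h => (Lp.memLp h).integrable one_le_two
  let L : Lp ℂ 2 μ →ₗ[ℂ] Lp ℂ 2 ν :=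
    { toFun := fun h => (hmem h).toLp
      map_add' := fun g h => by
        refine Lp.ext ?_
        filter_upwards [(hmem (g + h)).coeFn_toLp, (hmem g).coeFn_toLp, (hmem h).coeFn_toLp,
          Lp.coeFn_add (hmem g).toLp (hmem h).toLp, H.ae_integrable (hi g), H.ae_integrable (hi h)]
          with z h1 h2 h3 h4 h5 h6
        rw [h1, h4, Pi.add_apply, h2, h3, ← mul_add]
        congr 1
        rw [transform, transform, transform, ← integral_add h5 h6]
        refine integral_congr_ae ?_
        filter_upwards [Lp.coeFn_add g h] with y hy
        rw [hy, Pi.add_apply, mul_add]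
      map_smul' := fun r h => by
        refine Lp.ext ?_
        filter_upwards [(hmem (r • h)).coeFn_toLp, (hmem h).coeFn_toLp,
          Lp.coeFn_smul r (hmem h).toLp] with z h1 h2 h3
        rw [h1, RingHom.id_apply, h3, Pi.smul_apply, h2, smul_eq_mul, mul_left_comm]
        congr 1
        rw [transform, transform, ← integral_const_mul]
        refine integral_congr_ae ?_
        filter_upwards [Lp.coeFn_smul r h] with y hy
        rw [hy, Pi.smul_apply, smul_eq_mul, mul_left_comm] }
  refine ⟨L.mkContinuous (‖c‖ * √(√(∫ p, ‖B p‖ ^ 2 ∂(μ.prod μ)))) fun h => ?_, fun h =>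
    (hmem h).coeFn_toLp⟩
  refine abs_le_of_sq_le_sq' ?_ (by positivity) |>.2
  rw [mul_pow, mul_pow, Real.sq_sqrt (Real.sqrt_nonneg _), norm_sq_eq_integral,
    norm_sq_eq_integral, mul_assoc]
  have h1 : ∫ z, ‖L h z‖ ^ 2 ∂ν = ‖c‖ ^ 2 * ∫ z, ‖transform μ k h z‖ ^ 2 ∂ν := by
    rw [← integral_const_mul]
    refine integral_congr_ae ?_
    filter_upwards [(hmem h).coeFn_toLp] with z hz
    rw [← mul_pow, ← norm_mul]
    exact congrArg (fun w : ℂ => ‖w‖ ^ 2) hz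
  rw [h1]
  exact mul_le_mul_of_nonneg_left (H.transform_sq_integrable (Lp.memLp h)).2 (by positivity)

/-- Both sides are limits of the cut-off identity by dominated convergence: on the left the product
of two L² functions dominates, on the right B times the tensor product of g and h. -/
theorem integral_transform_mul (H : IsRegularizable ν μ k ρ B K) (hg : MemLp g 2 μ)
    (hh : MemLp h 2 μ) :
    ∫ z, transform μ k h z * conj (transform μ k g z) ∂ν =
      ∫ p, K p.1 p.2 * (conj (g p.1) * h p.2) ∂(μ.prod μ) := by
  have hgi := hg.integrable one_le_two
  have hhi := hh.integrable one_le_two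
  have hgt := (H.transform_sq_integrable hg).1
  have hht := (H.transform_sq_integrable hh).1
  have hprod : Integrable (fun z => transform μ k h z * conj (transform μ k g z)) ν :=
    hht.integrable_mul (hgt.star)
  have h1 : Tendsto (fun n => ∫ z, (ρ n z : ℂ) * (transform μ k h z * conj (transform μ k g z)) ∂ν)
      atTop (𝓝 (∫ z, transform μ k h z * conj (transform μ k g z) ∂ν)) := by
    refine tendsto_integral_of_dominated_convergence _ (fun n => ?_) hprod.norm
      (fun n => Eventually.of_forall fun z => ?_) (Eventually.of_forall fun z => ?_)
    · exact (Complex.measurable_ofReal.comp (H.measurable_cutoff n)).aestronglyMeasurable.mul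
        hprod.1
    · rw [norm_mul, Complex.norm_of_nonneg (H.cutoff_nonneg n z)]
      exact mul_le_of_le_one_left (norm_nonneg _) (H.cutoff_le_one n z)
    · have := ((Complex.continuous_ofReal.tendsto _).comp (H.tendsto_cutoff z)).mul_const
        (transform μ k h z * conj (transform μ k g z))
      rwa [Complex.ofReal_one, one_mul] at this
  simp_rw [H.integral_cutoff_mul hgi hhi] at h1
  obtain ⟨hm, -⟩ := memLp_two_mul_prod hg hh
  refine tendsto_nhds_unique h1 (tendsto_integral_of_dominated_convergence
    (fun p => ‖B p‖ * ‖conj (g p.1) * h p.2‖) (fun n => ?_)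
    (H.memLp_bound.norm.integrable_mul hm.norm) (fun n => ?_) ?_)
  · exact (H.aestronglyMeasurable_regularized n).mul hm.1
  · filter_upwards [H.norm_le_bound n] with p hp
    rw [norm_mul]
    exact mul_le_mul_of_nonneg_right (hp.trans (le_abs_self _)) (norm_nonneg _)
  · filter_upwards [H.tendsto] with p hp using hp.mul_const _

/-- The kernel of `P* P`. -/
theorem adjoint_comp_self_apply (H : IsRegularizable ν μ k ρ B K) {c : ℂ}
    {P : Lp ℂ 2 μ →L[ℂ] Lp ℂ 2 ν} (hP : ∀ h : Lp ℂ 2 μ, P h =ᵐ[ν] fun z => c * transform μ k h z)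
    (h : Lp ℂ 2 μ) :
    (ContinuousLinearMap.adjoint P ∘L P) h =ᵐ[μ]
      fun x => ∫ y, (conj c * c) * K x y * h y ∂μ := by
  set T := ContinuousLinearMap.adjoint P ∘L P with hT
  have hKh : Integrable (fun p : X × X => (conj c * c) * K p.1 p.2 * h p.2) (μ.prod μ) :=
    (H.memLp_kernel.const_mul (conj c * c)).integrable_mul ((Lp.memLp h).comp_snd μ)
  -- On a finite measure space both sides are integrable, so it suffices to integrate over sets. The
  -- integral of P* P h over s is the inner product of P 1_s with P h.
  refine Integrable.ae_eq_of_forall_setIntegral_eq _ _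
    ((Lp.memLp (T h)).integrable one_le_two) hKh.integral_prod_left fun s hs hμs => ?_
  have h1 : ⟪indicatorConstLp 2 hs hμs.ne (1 : ℂ), T h⟫_ℂ = ∫ x in s, T h x ∂μ :=
    L2.inner_indicatorConstLp_one hs hμs.ne (T h)
  rw [← h1, hT, ContinuousLinearMap.comp_apply, ContinuousLinearMap.adjoint_inner_right,
    L2.inner_def]
  set g := indicatorConstLp 2 hs hμs.ne (1 : ℂ) with hg
  have h2 : ∫ z, ⟪P g z, P h z⟫_ℂ ∂ν =
      (conj c * c) * ∫ z, transform μ k h z * conj (transform μ k g z) ∂ν := by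
    rw [← integral_const_mul]
    refine integral_congr_ae ?_
    filter_upwards [hP g, hP h] with z hz1 hz2
    rw [hz1, hz2, RCLike.inner_apply, map_mul]
    ring
  rw [h2, H.integral_transform_mul (Lp.memLp g) (Lp.memLp h), ← integral_indicator hs,
    ← integral_const_mul]
  have h3 : ∫ p, (conj c * c) * (K p.1 p.2 * (conj (g p.1) * h p.2)) ∂(μ.prod μ) =
      ∫ p : X × X, s.indicator (fun _ => (1 : ℂ)) p.1 * ((conj c * c) * K p.1 p.2 * h p.2)
        ∂(μ.prod μ) := by
    refine integral_congr_ae ?_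
    filter_upwards [Measure.quasiMeasurePreserving_fst.ae
      (indicatorConstLp_coeFn (p := 2) (hs := hs) (hμs := hμs.ne) (c := (1 : ℂ)))] with p hp
    rw [hg, hp]
    by_cases hps : p.1 ∈ s
    · rw [Set.indicator_of_mem hps, map_one]; ring
    · rw [Set.indicator_of_notMem hps, map_zero]; ring
  rw [h3, integral_prod]
  · refine integral_congr_ae (Eventually.of_forall fun x => ?_)
    simp only
    by_cases hx : x ∈ s
    · simp only [Set.indicator_of_mem hx, one_mul]
    · simp only [Set.indicator_of_notMem hx, zero_mul, integral_zero]
  · refine hKh.bdd_mul (c := 1) ?_ (Eventually.of_forall fun p => ?_)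
    · exact (((measurable_const (a := (1 : ℂ))).indicator hs).comp
        measurable_fst).aestronglyMeasurable
    · by_cases hx : p.1 ∈ s
      · rw [Set.indicator_of_mem hx, norm_one]
      · rw [Set.indicator_of_notMem hx, norm_zero]; exact zero_le_one

end IsRegularizable

end RegularizedKernel


/-! ### The kernel of the photoacoustic operator -/

section Kernel

open Set

variable {Ω : Set E3} {ε : ℝ} {κ κs : ℝ → ℂ}

theorem isOpen_innerDomain (hΩ : IsOpen Ω) (ε : ℝ) : IsOpen (innerDomain Ω ε) :=
  hΩ.inter (isOpen_lt continuous_const (Metric.continuous_infDist_pt _))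

theorem isFiniteMeasure_restrict_innerDomain (hΩ : Bornology.IsBounded Ω) :
    IsFiniteMeasure ((volume : Measure E3).restrict (innerDomain Ω ε)) :=
  isFiniteMeasure_restrict.2 ((hΩ.subset fun _ h => h.1).measure_lt_top.ne)

/-- In polar coordinates of dimension three the Jacobian r² cancels the singularity exactly. -/
theorem integrableOn_inv_norm_sq (R : ℝ) :
    IntegrableOn (fun z : E3 => (‖z‖ ^ 2)⁻¹) (Metric.ball 0 R) := by
  refine (integrableOn_fun_norm_addHaar (μ := volume) (f := fun r : ℝ => (r ^ 2)⁻¹)).2 ?_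
  have : IntegrableOn (fun _ : ℝ => (1 : ℝ)) (Ioo 0 R) := integrableOn_const (by simp)
  refine this.congr_fun (fun r hr => ?_) measurableSet_Ioo
  simp only [finrank_euclideanSpace, Fintype.card_fin, smul_eq_mul]
  exact (mul_inv_cancel₀ (pow_pos hr.1 2).ne').symm

theorem ae_mem_innerDomain (hΩ : IsOpen Ω) :
    ∀ᵐ x ∂((volume : Measure E3).restrict (innerDomain Ω ε)), x ∈ innerDomain Ω ε :=
  ae_restrict_mem (isOpen_innerDomain hΩ ε).measurableSet

theorem ae_mem_ne (hΩ : IsOpen Ω) :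
    ∀ᵐ p ∂(((volume : Measure E3).restrict (innerDomain Ω ε)).prod
      ((volume : Measure E3).restrict (innerDomain Ω ε))),
      p.1 ∈ innerDomain Ω ε ∧ p.2 ∈ innerDomain Ω ε ∧ p.1 ≠ p.2 := by
  have hne : ∀ᵐ p ∂(((volume : Measure E3).restrict (innerDomain Ω ε)).prod
      ((volume : Measure E3).restrict (innerDomain Ω ε))), p.1 ≠ p.2 := by
    refine (Measure.ae_prod_iff_ae_ae
      (measurableSet_eq_fun measurable_fst measurable_snd).compl).2 (Eventually.of_forall fun x => ?_)
    have hx : ({x} : Set E3)ᶜ ∈ ae ((volume : Measure E3).restrict (innerDomain Ω ε)) :=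
      compl_mem_ae_iff.2 (measure_singleton x)
    filter_upwards [hx] with y hy h using hy h.symm
  filter_upwards [Measure.quasiMeasurePreserving_fst.ae (ae_mem_innerDomain hΩ),
    Measure.quasiMeasurePreserving_snd.ae (ae_mem_innerDomain hΩ), hne] with p h1 h2 h3
  exact ⟨h1, h2, h3⟩

theorem memLp_div_norm_sub (hΩ_open : IsOpen Ω) (hΩ_bdd : Bornology.IsBounded Ω) (C : ℝ) :
    MemLp (fun p : E3 × E3 => C / ‖p.1 - p.2‖) 2
      (((volume : Measure E3).restrict (innerDomain Ω ε)).prod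
        ((volume : Measure E3).restrict (innerDomain Ω ε))) := by
  have hfin := isFiniteMeasure_restrict_innerDomain (ε := ε) hΩ_bdd
  obtain ⟨D, hD0, hD⟩ := exists_diam_bound hΩ_bdd
  refine (memLp_two_iff_integrable_sq_norm (Measurable.aestronglyMeasurable (by fun_prop))).2 ?_
  have hg : Integrable ((Metric.ball (0 : E3) (D + 1)).indicator fun z => (‖z‖ ^ 2)⁻¹) :=
    (integrable_indicator_iff Metric.isOpen_ball.measurableSet).2 (integrableOn_inv_norm_sq _)
  -- The square of the kernel is a convolution integrand of a constant with |z|⁻² truncated to a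
  -- ball; the radius D + 1 exceeds every difference of two points of Ω.
  have h1 := Integrable.convolution_integrand (ContinuousLinearMap.mul ℝ ℝ)
    (integrable_const (C ^ 2) : Integrable (fun _ : E3 => C ^ 2)
      ((volume : Measure E3).restrict (innerDomain Ω ε))) hg
  have h2 := h1.restrict (s := innerDomain Ω ε ×ˢ univ)
  rw [← Measure.prod_restrict, Measure.restrict_univ] at h2
  refine h2.congr ?_
  filter_upwards [ae_mem_ne hΩ_open] with p hp
  have h3 : p.1 - p.2 ∈ Metric.ball (0 : E3) (D + 1) := by
    rw [mem_ball_zero_iff]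
    have := hD _ (subset_closure hp.1.1) _ (subset_closure hp.2.1.1)
    linarith
  rw [indicator_of_mem h3, norm_div, norm_norm, div_pow, Real.norm_eq_abs, sq_abs]
  rfl

/-- The regularized integrals depend measurably on the two points. -/
theorem aestronglyMeasurable_cutoff_integral [IsFiniteMeasure (surfaceMeasure Ω)]
    {a : E3 → E3 → ℝ → E3 → ℂ}
    (ha : Measurable fun q : (E3 × E3) × ℝ × E3 => a q.1.1 q.1.2 q.2.1 q.2.2) (n : ℕ)
    (μ : Measure (E3 × E3)) :
    AEStronglyMeasurable (fun p : E3 × E3 => ∫ ω, (cutoff n ω : ℂ) *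
      ∫ ξ, a p.1 p.2 ω ξ ∂(surfaceMeasure Ω)) μ := by
  have h1 : StronglyMeasurable fun q : (E3 × E3) × ℝ =>
      ∫ ξ, a q.1.1 q.1.2 q.2 ξ ∂(surfaceMeasure Ω) := by
    have h0 : StronglyMeasurable fun r : ((E3 × E3) × ℝ) × E3 => a r.1.1.1 r.1.1.2 r.1.2 r.2 :=
      (ha.comp (g := fun q : (E3 × E3) × ℝ × E3 => a q.1.1 q.1.2 q.2.1 q.2.2)
        (f := fun r : ((E3 × E3) × ℝ) × E3 => (r.1.1, r.1.2, r.2)) (by fun_prop)).stronglyMeasurable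
    exact h0.integral_prod_right'
  have h2 : StronglyMeasurable fun q : (E3 × E3) × ℝ => (cutoff n q.2 : ℂ) *
      ∫ ξ, a q.1.1 q.1.2 q.2 ξ ∂(surfaceMeasure Ω) :=
    (Complex.measurable_ofReal.comp
      ((continuous_cutoff n).measurable.comp measurable_snd)).stronglyMeasurable.mul h1
  exact h2.integral_prod_right'.aestronglyMeasurable

/-- Measurability in (x, y) is obtained from the sequence of Gaussian regularizations, whose limit
agrees with the improper integral. -/
theorem memLp_iteratedIntegral [IsFiniteMeasure (surfaceMeasure Ω)] (hΩ_open : IsOpen Ω)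
    (hΩ_bdd : Bornology.IsBounded Ω) {a : E3 → E3 → ℝ → E3 → ℂ}
    (ha : Measurable fun q : (E3 × E3) × ℝ × E3 => a q.1.1 q.1.2 q.2.1 q.2.2) {C : ℝ}
    (h : ∀ x ∈ innerDomain Ω ε, ∀ y ∈ innerDomain Ω ε, x ≠ y → ∃ L, HasRegularizedIntegral
      (fun ω => ∫ ξ, a x y ω ξ ∂(surfaceMeasure Ω)) L (C / ‖x - y‖)) :
    MemLp (fun p : E3 × E3 => iteratedIntegral Ω (a p.1 p.2)) 2
      (((volume : Measure E3).restrict (innerDomain Ω ε)).prod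
        ((volume : Measure E3).restrict (innerDomain Ω ε))) := by
  refine (memLp_div_norm_sub hΩ_open hΩ_bdd C).mono (aestronglyMeasurable_of_tendsto_ae atTop
    (fun n => aestronglyMeasurable_cutoff_integral (Ω := Ω) ha n _) ?_) ?_
  · filter_upwards [ae_mem_ne hΩ_open] with p hp
    obtain ⟨L, hL⟩ := h p.1 hp.1 p.2 hp.2.1 hp.2.2
    rw [hL.iteratedIntegral_eq]
    exact hL.regularized
  · filter_upwards [ae_mem_ne hΩ_open] with p hp
    obtain ⟨L, hL⟩ := h p.1 hp.1 p.2 hp.2.1 hp.2.2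
    rw [hL.iteratedIntegral_eq]
    exact hL.norm_le.trans (le_abs_self _)

theorem norm_kernelIntegrand_le (hε : 0 < ε) {x y ξ : E3} (hx : x ∈ innerDomain Ω ε)
    (hy : y ∈ innerDomain Ω ε) (hξ : ξ ∈ frontier Ω) (ω : ℝ) (hκ : 0 ≤ (κ ω).im) :
    ‖kernelIntegrand κ x y ω ξ‖ ≤ (ε * ε)⁻¹ * Real.exp (-(2 * ε * (κ ω).im)) := by
  have h1 := (lt_norm_sub_of_mem_innerDomain hx hξ).le
  have h2 := (lt_norm_sub_of_mem_innerDomain hy hξ).le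
  rw [kernelIntegrand, norm_div, Complex.norm_exp, norm_mul, Complex.norm_real, Complex.norm_real,
    norm_norm, norm_norm, div_eq_inv_mul]
  refine mul_le_mul (inv_norm_mul_norm_le hε hx hy hξ) (Real.exp_le_exp.2 ?_) (Real.exp_pos _).le
    (by positivity)
  simp
  nlinarith

/-- For |ω| ≥ ω₀ the growth condition gives decay like exp(-2εκ₀|ω|^β) with β > 0; for smaller
frequencies Im κ ≥ 0 gives the bound 1. -/
theorem integrable_exp_neg_im (hε : 0 < ε) (hκ : IsStrongAttenuation κ) :
    Integrable fun ω => (ε * ε)⁻¹ * Real.exp (-(2 * ε * (κ ω).im)) := by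
  obtain ⟨hatt, κ₀, β, ω₀, hκ₀, hβ, hω₀, hle⟩ := hκ
  have hc := hatt.smooth.continuous
  refine Integrable.const_mul ?_ _
  have h1 : Integrable fun ω : ℝ => Real.exp (-(2 * ε * κ₀) * |ω| ^ β) := by
    have h0 := integrableOn_rpow_mul_exp_neg_mul_rpow (s := 0) (p := β) (b := 2 * ε * κ₀)
      (by norm_num) hβ (by positivity)
    simp only [Real.rpow_zero, one_mul] at h0
    have h3 := (integrable_fun_norm_addHaar (E := ℝ) (μ := volume)
      (f := fun r => Real.exp (-(2 * ε * κ₀) * r ^ β))).2 (by simpa using h0)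
    simpa only [Real.norm_eq_abs] using h3
  have h2 : Integrable ((Icc (-ω₀) ω₀).indicator fun _ => (1 : ℝ)) :=
    (integrable_indicator_iff measurableSet_Icc).2 (integrableOn_const (by simp))
  refine (h2.add h1).mono' (Continuous.aestronglyMeasurable (by fun_prop))
    (Eventually.of_forall fun ω => ?_)
  rw [Real.norm_of_nonneg (Real.exp_pos _).le, Pi.add_apply]
  by_cases hω : ω ∈ Icc (-ω₀) ω₀
  · rw [indicator_of_mem hω]
    have h3 : Real.exp (-(2 * ε * (κ ω).im)) ≤ 1 := by
      rw [Real.exp_le_one_iff]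
      have := mul_nonneg (mul_nonneg zero_le_two hε.le) (hatt.im_nonneg ω)
      linarith
    have h4 := Real.exp_pos (-(2 * ε * κ₀) * |ω| ^ β)
    linarith
  · rw [indicator_of_notMem hω, zero_add, Real.exp_le_exp]
    have h3 : ω₀ ≤ |ω| := by
      by_contra h
      exact hω (abs_le.1 (not_le.1 h).le)
    have h4 := mul_le_mul_of_nonneg_left (hle ω h3) (by positivity : 0 ≤ 2 * ε)
    linarith

theorem exists_hasRegularizedIntegral_split [IsFiniteMeasure (surfaceMeasure Ω)]
    (hΩ_open : IsOpen Ω) (hΩ_bdd : Bornology.IsBounded Ω) (hΩ_convex : Convex ℝ Ω)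
    (hΩ_smooth : HasSmoothBoundary Ω) (hε : 0 < ε) {c κinf : ℝ}
    (h : IsWeakRepresentation κ c κinf κs) (j : Fin 3) :
    ∃ C : ℝ, ∀ x ∈ innerDomain Ω ε, ∀ y ∈ innerDomain Ω ε, x ≠ y → ∃ L,
      HasRegularizedIntegral
        (fun ω => ∫ ξ, splitIntegrand c κinf κs j x y ω ξ ∂(surfaceMeasure Ω)) L
        (C / ‖x - y‖) := by
  obtain ⟨M, hM⟩ := h.bounded
  have hc := h.smooth.continuous
  fin_cases j
  · obtain ⟨C, hC⟩ := exists_hasRegularizedIntegral_zero hΩ_open hΩ_bdd hΩ_convex hΩ_smooth hε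
      h.c_pos h.κinf_nonneg κs
    exact ⟨C, fun x hx y hy hxy => ⟨_, (hC x hx y hy hxy).2⟩⟩
  · exact exists_hasRegularizedIntegral_one hΩ_open hΩ_bdd hΩ_convex hΩ_smooth hε
      h.c_pos h.κinf_nonneg hc h.square_integrable
  · exact exists_hasRegularizedIntegral_two hΩ_bdd hε h.κinf_nonneg hc h.square_integrable hM

theorem hasRegularizedIntegral_kernel_of_strong [IsFiniteMeasure (surfaceMeasure Ω)]
    (hε : 0 < ε) (hκ : IsStrongAttenuation κ) {x y : E3} (hx : x ∈ innerDomain Ω ε)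
    (hy : y ∈ innerDomain Ω ε) :
    HasRegularizedIntegral (fun ω => ∫ ξ, kernelIntegrand κ x y ω ξ ∂(surfaceMeasure Ω))
      (∫ ω, ∫ ξ, kernelIntegrand κ x y ω ξ ∂(surfaceMeasure Ω))
      ((surfaceMeasure Ω).real univ * ∫ ω, (ε * ε)⁻¹ * Real.exp (-(2 * ε * (κ ω).im))) :=
  HasRegularizedIntegral.of_dominated
    (measurable_uncurry_of_measurable (f := kernelIntegrand κ)
      (measurable_kernelIntegrand hκ.1.smooth.continuous.measurable) x y)
    (integrable_exp_neg_im hε hκ)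
    fun ω _ hξ => norm_kernelIntegrand_le hε hx hy hξ ω (hκ.1.im_nonneg ω)

theorem integral_kernelIntegrand_eq [IsFiniteMeasure (surfaceMeasure Ω)]
    (hΩ_bdd : Bornology.IsBounded Ω) (hε : 0 < ε) {c κinf : ℝ}
    (h : IsWeakRepresentation κ c κinf κs) {x y : E3} (hx : x ∈ innerDomain Ω ε)
    (hy : y ∈ innerDomain Ω ε) (ω : ℝ) :
    ∫ ξ, kernelIntegrand κ x y ω ξ ∂(surfaceMeasure Ω) =
      (∫ ξ, splitIntegrand c κinf κs 0 x y ω ξ ∂(surfaceMeasure Ω)) +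
        (∫ ξ, splitIntegrand c κinf κs 1 x y ω ξ ∂(surfaceMeasure Ω)) +
        ∫ ξ, splitIntegrand c κinf κs 2 x y ω ξ ∂(surfaceMeasure Ω) := by
  have hi := fun j => integrable_splitIntegrand (c := c) hΩ_bdd hε h.κinf_nonneg
    h.smooth.continuous.measurable j hx hy ω
  rw [← Fin.sum_univ_three fun j => ∫ ξ, splitIntegrand c κinf κs j x y ω ξ ∂(surfaceMeasure Ω),
    ← integral_finsetSum _ fun j _ => hi j]
  exact integral_congr_ae (Eventually.of_forall fun ξ => kernelIntegrand_eq_sum h)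

/-- Weak attenuation adds the three parts. For strong attenuation the integral is bounded uniformly,
and D ≥ |x - y| casts the bound into the same form C/|x - y|. -/
theorem exists_hasRegularizedIntegral_kernel [IsFiniteMeasure (surfaceMeasure Ω)]
    (hΩ_open : IsOpen Ω) (hΩ_bdd : Bornology.IsBounded Ω) (hΩ_convex : Convex ℝ Ω)
    (hΩ_smooth : HasSmoothBoundary Ω) (hε : 0 < ε)
    (hκ : IsWeakAttenuation κ ∨ IsStrongAttenuation κ) :
    ∃ C : ℝ, ∀ x ∈ innerDomain Ω ε, ∀ y ∈ innerDomain Ω ε, x ≠ y → ∃ L,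
      HasRegularizedIntegral
        (fun ω => ∫ ξ, kernelIntegrand κ x y ω ξ ∂(surfaceMeasure Ω)) L (C / ‖x - y‖) := by
  rcases hκ with ⟨hatt, c, κinf, κs, h⟩ | hκ
  · choose C hC using exists_hasRegularizedIntegral_split hΩ_open hΩ_bdd hΩ_convex hΩ_smooth hε h
    refine ⟨C 0 + C 1 + C 2, fun x hx y hy hxy => ?_⟩
    choose L hL using fun j => hC j x hx y hy hxy
    refine ⟨L 0 + L 1 + L 2, ?_⟩
    convert ((hL 0).add (hL 1)).add (hL 2) using 1
    · ext ω
      exact integral_kernelIntegrand_eq hΩ_bdd hε h hx hy ω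
    · ring
  · obtain ⟨D, hD0, hD⟩ := exists_diam_bound hΩ_bdd
    set R := (surfaceMeasure Ω).real univ * ∫ ω, (ε * ε)⁻¹ * Real.exp (-(2 * ε * (κ ω).im)) with hR
    have hR0 : 0 ≤ R := mul_nonneg measureReal_nonneg (integral_nonneg fun ω => by positivity)
    refine ⟨R * D, fun x hx y hy hxy => ⟨_,
      (hasRegularizedIntegral_kernel_of_strong hε hκ hx hy).mono ?_⟩⟩
    rw [le_div_iff₀ (norm_pos_iff.2 (sub_ne_zero.2 hxy))]
    exact mul_le_mul_of_nonneg_left (hD _ (subset_closure hx.1) _ (subset_closure hy.1)) hR0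

theorem integrable_kernelIntegrand [IsFiniteMeasure (surfaceMeasure Ω)] (hε : 0 < ε)
    (hκ : IsAttenuationCoefficient κ) {x y : E3} (hx : x ∈ innerDomain Ω ε)
    (hy : y ∈ innerDomain Ω ε) (ω : ℝ) :
    Integrable (kernelIntegrand κ x y ω) (surfaceMeasure Ω) :=
  integrable_surfaceMeasure_of_bdd ((measurable_uncurry_of_measurable (f := kernelIntegrand κ)
    (measurable_kernelIntegrand hκ.smooth.continuous.measurable) x y).of_uncurry_left)
    fun _ hξ => norm_kernelIntegrand_le hε hx hy hξ ω (hκ.im_nonneg ω)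

/-- The kernel of the integrated photoacoustic operator, without the constant. -/
def photoacousticKernel (κ : ℝ → ℂ) (p : ℝ × E3) (y : E3) : ℂ :=
  Complex.exp (Complex.I * κ p.1 * (‖p.2 - y‖ : ℂ)) / (‖p.2 - y‖ : ℂ)

theorem photoacousticKernel_mul_conj (p : ℝ × E3) (x y : E3) :
    photoacousticKernel κ p y * conj (photoacousticKernel κ p x) =
      kernelIntegrand κ x y p.1 p.2 := by
  simp only [photoacousticKernel, kernelIntegrand, map_div₀, ← Complex.exp_conj, map_mul,
    Complex.conj_I, Complex.conj_ofReal]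
  rw [div_mul_div_comm, ← Complex.exp_add]
  congr 2
  ring

theorem norm_photoacousticKernel_le (hε : 0 < ε) (hκ : IsAttenuationCoefficient κ) {p : ℝ × E3}
    {y : E3} (hp : p.2 ∈ frontier Ω) (hy : y ∈ innerDomain Ω ε) :
    ‖photoacousticKernel κ p y‖ ≤ ε⁻¹ := by
  have h1 := (lt_norm_sub_of_mem_innerDomain hy hp).le
  rw [photoacousticKernel, norm_div, Complex.norm_exp, Complex.norm_real, norm_norm,
    div_eq_inv_mul]
  refine (mul_le_of_le_one_right (by positivity) (Real.exp_le_one_iff.2 ?_)).trans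
    (inv_anti₀ hε h1)
  have := mul_nonneg (hκ.im_nonneg p.1) (norm_nonneg (p.2 - y))
  simp
  linarith

/-- The cutoffs act on the frequency alone, so Fubini rewrites the regularized kernels as the
Gaussian regularizations of the frequency density. The bound ε⁻¹ on the kernel holds only for ξ ∈ ∂Ω
and y in the inner domain, which is why boundedness is required merely on sets of full measure. -/
theorem isRegularizable_photoacousticKernel [IsFiniteMeasure (surfaceMeasure Ω)]
    (hΩ_open : IsOpen Ω) (hΩ_bdd : Bornology.IsBounded Ω) (hε : 0 < ε)
    (hκ : IsAttenuationCoefficient κ) {C : ℝ}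
    (hC : ∀ x ∈ innerDomain Ω ε, ∀ y ∈ innerDomain Ω ε, x ≠ y → ∃ L,
      HasRegularizedIntegral
        (fun ω => ∫ ξ, kernelIntegrand κ x y ω ξ ∂(surfaceMeasure Ω)) L (C / ‖x - y‖)) :
    IsRegularizable ((volume : Measure ℝ).prod (surfaceMeasure Ω))
      ((volume : Measure E3).restrict (innerDomain Ω ε)) (photoacousticKernel κ)
      (fun n p => cutoff n p.1) (fun p => C / ‖p.1 - p.2‖)
      (fun x y => iteratedIntegral Ω (kernelIntegrand κ x y)) := by
  have hmeas := hκ.smooth.continuous.measurable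
  have key : ∀ n, ∀ x ∈ innerDomain Ω ε, ∀ y ∈ innerDomain Ω ε,
      ∫ p, (cutoff n p.1 : ℂ) * (photoacousticKernel κ p y * conj (photoacousticKernel κ p x))
        ∂((volume : Measure ℝ).prod (surfaceMeasure Ω)) =
      ∫ ω, (cutoff n ω : ℂ) * ∫ ξ, kernelIntegrand κ x y ω ξ ∂(surfaceMeasure Ω) := by
    intro n x hx y hy
    simp_rw [photoacousticKernel_mul_conj, ← integral_const_mul]
    refine integral_prod _ ?_
    refine integrable_prod_of_dominated (a := fun ω ξ => (cutoff n ω : ℂ) * kernelIntegrand κ x y ω ξ)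
      (φ := fun ω => cutoff n ω * (ε * ε)⁻¹) ?_ ((integrable_cutoff n).mul_const _)
      fun ω ξ hξ => ?_
    · exact (Complex.measurable_ofReal.comp
        ((continuous_cutoff n).measurable.comp measurable_fst)).mul
        (measurable_uncurry_of_measurable (f := kernelIntegrand κ)
          (measurable_kernelIntegrand hmeas) x y)
    · rw [norm_mul, Complex.norm_of_nonneg (cutoff_pos n ω).le]
      refine mul_le_mul_of_nonneg_left ?_ (cutoff_pos n ω).le
      refine (norm_kernelIntegrand_le hε hx hy hξ ω (hκ.im_nonneg ω)).trans
        (mul_le_of_le_one_right (by positivity) (Real.exp_le_one_iff.2 ?_))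
      have := mul_nonneg (mul_nonneg zero_le_two hε.le) (hκ.im_nonneg ω)
      linarith
  refine ⟨?_, ⟨ε⁻¹, by positivity, {p | p.2 ∈ frontier Ω}, innerDomain Ω ε, ?_,
    ae_mem_innerDomain hΩ_open, fun p hp y hy => norm_photoacousticKernel_le hε hκ hp hy⟩,
    fun n => ?_, fun n p => (cutoff_pos n _).le, fun n p => cutoff_le_one n _,
    fun p => tendsto_gaussian_one p.1, fun n => (continuous_cutoff n).measurable.comp measurable_fst,
    memLp_div_norm_sub hΩ_open hΩ_bdd C, fun n => ?_, ?_⟩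
  · have : Measurable fun q : (ℝ × E3) × E3 => κ q.1.1 :=
      hmeas.comp (measurable_fst.comp measurable_fst)
    exact ((measurable_const.mul this).mul (by fun_prop)).cexp.div (by fun_prop)
  · exact Measure.quasiMeasurePreserving_snd.ae
      (ae_restrict_mem (isClosed_frontier (s := Ω)).measurableSet)
  · exact (integrable_cutoff n).comp_fst _
  · filter_upwards [ae_mem_ne hΩ_open] with p hp
    obtain ⟨L, hL⟩ := hC p.1 hp.1 p.2 hp.2.1 hp.2.2
    rw [key n p.1 hp.1 p.2 hp.2.1]
    exact hL.bound n
  · filter_upwards [ae_mem_ne hΩ_open] with p hp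
    obtain ⟨L, hL⟩ := hC p.1 hp.1 p.2 hp.2.1 hp.2.2
    simp_rw [key _ p.1 hp.1 p.2 hp.2.1]
    rw [hL.iteratedIntegral_eq]
    exact hL.regularized

end Kernel

end AttenuatedPAT

end

/-! ### Assembly of the main theorem -/

open AttenuatedPAT
theorem mainTheorem5 (Ω : Set E3) (hΩ_open : IsOpen Ω) (hΩ_ne : Ω.Nonempty)
    (hΩ_bdd : Bornology.IsBounded Ω) (hΩ_convex : Convex ℝ Ω) (hΩ_smooth : HasSmoothBoundary Ω)
    (ε : ℝ) (hε : 0 < ε) (κ : ℝ → ℂ) (hκ : IsWeakAttenuation κ ∨ IsStrongAttenuation κ) :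
    -- the operator is well defined and bounded
    (∃! P : L2Inner Ω ε →L[ℂ] L2Data Ω, IsIntegratedPhotoacousticOperator Ω ε κ P) ∧
    -- the kernel is well defined off the diagonal, and square integrable
    (∀ x ∈ innerDomain Ω ε, ∀ y ∈ innerDomain Ω ε, x ≠ y →
      IteratedIntegralConverges Ω (kernelIntegrand κ x y)) ∧
    MemLp (fun p : E3 × E3 => kernel Ω κ p.1 p.2) 2
      (((volume : Measure E3).restrict (innerDomain Ω ε)).prod
        ((volume : Measure E3).restrict (innerDomain Ω ε))) ∧
    -- the operator `P* P`
    (∀ P : L2Inner Ω ε →L[ℂ] L2Data Ω, IsIntegratedPhotoacousticOperator Ω ε κ P →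
      IsSelfAdjoint (ContinuousLinearMap.adjoint P ∘L P) ∧
      (∀ h : L2Inner Ω ε,
        ((ContinuousLinearMap.adjoint P ∘L P) h : E3 → ℂ)
          =ᵐ[(volume : Measure E3).restrict (innerDomain Ω ε)]
            fun x => ∫ y in innerDomain Ω ε, kernel Ω κ x y * h y) ∧
      IsHilbertSchmidt (ContinuousLinearMap.adjoint P ∘L P) ∧
      IsCompactOperator (ContinuousLinearMap.adjoint P ∘L P)) ∧
    -- for strong attenuation the kernel is an absolutely convergent integral
    (IsStrongAttenuation κ → ∀ x ∈ innerDomain Ω ε, ∀ y ∈ innerDomain Ω ε,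
      Integrable (fun p : ℝ × E3 => kernelIntegrand κ x y p.1 p.2)
        ((volume : Measure ℝ).prod (surfaceMeasure Ω)) ∧
      kernel Ω κ x y = ((1 / (32 * Real.pi ^ 3) : ℝ) : ℂ) *
        ∫ ω : ℝ, ∫ ξ, kernelIntegrand κ x y ω ξ ∂(surfaceMeasure Ω)) ∧
    -- for weak attenuation: splitting of the kernel, formula and bound for the principal part
    (∀ (c κinf : ℝ) (κs : ℝ → ℂ), IsWeakRepresentation κ c κinf κs →
      (∀ j : Fin 3, ∀ x ∈ innerDomain Ω ε, ∀ y ∈ innerDomain Ω ε, x ≠ y →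
        IteratedIntegralConverges Ω (splitIntegrand c κinf κs j x y)) ∧
      (∀ x ∈ innerDomain Ω ε, ∀ y ∈ innerDomain Ω ε, x ≠ y →
        kernel Ω κ x y = ∑ j : Fin 3, splitKernel Ω c κinf κs j x y) ∧
      (∀ j : Fin 3, MemLp (fun p : E3 × E3 => splitKernel Ω c κinf κs j p.1 p.2) 2
        (((volume : Measure E3).restrict (innerDomain Ω ε)).prod
          ((volume : Measure E3).restrict (innerDomain Ω ε)))) ∧
      (∀ x ∈ innerDomain Ω ε, ∀ y ∈ innerDomain Ω ε, x ≠ y →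
        Integrable (sectionIntegrand Ω κinf x y) (sectionMeasure Ω x y) ∧
        splitKernel Ω c κinf κs 0 x y =
          ((c / (16 * Real.pi ^ 2 * ‖y - x‖) *
            ∫ ξ, sectionIntegrand Ω κinf x y ξ ∂(sectionMeasure Ω x y) : ℝ) : ℂ)) ∧
      ∃ A : ℝ, 0 < A ∧ ∀ x ∈ innerDomain Ω ε, ∀ y ∈ innerDomain Ω ε, x ≠ y →
        ‖splitKernel Ω c κinf κs 0 x y‖ ≤ A / ‖x - y‖) := by
  have hfin := isFiniteMeasure_surfaceMeasure hΩ_open hΩ_ne hΩ_bdd hΩ_convex hΩ_smooth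
  have hfinΩ := isFiniteMeasure_restrict_innerDomain (ε := ε) hΩ_bdd
  have hatt : IsAttenuationCoefficient κ := hκ.elim (fun h => h.1) fun h => h.1
  have hmeas := hatt.smooth.continuous.measurable
  obtain ⟨C, hC⟩ := exists_hasRegularizedIntegral_kernel hΩ_open hΩ_bdd hΩ_convex hΩ_smooth hε hκ
  have hreg := isRegularizable_photoacousticKernel hΩ_open hΩ_bdd hε hatt hC
  -- The normalization of the kernel is the square of that of the operator: (4π√(2π))² = 32π³.
  have hconst : conj (((1 / (4 * Real.pi * Real.sqrt (2 * Real.pi)) : ℝ) : ℂ)) *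
      ((1 / (4 * Real.pi * Real.sqrt (2 * Real.pi)) : ℝ) : ℂ) =
      ((1 / (32 * Real.pi ^ 3) : ℝ) : ℂ) := by
    rw [Complex.conj_ofReal, ← Complex.ofReal_mul, div_mul_div_comm, mul_mul_mul_comm,
      Real.mul_self_sqrt (by positivity)]
    congr 2
    · norm_num
    · ring
  have hkernel : MemLp (fun p : E3 × E3 => kernel Ω κ p.1 p.2) 2
      (((volume : Measure E3).restrict (innerDomain Ω ε)).prod
        ((volume : Measure E3).restrict (innerDomain Ω ε))) :=
    hreg.memLp_kernel.const_mul _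
  refine ⟨?_, fun x hx y hy hxy => ?_, hkernel, fun P hP => ?_, fun hs x hx y hy => ?_,
    fun c κinf κs h => ?_⟩
  · obtain ⟨P, hP⟩ := hreg.exists_operator ((1 / (4 * Real.pi * Real.sqrt (2 * Real.pi)) : ℝ) : ℂ)
    exact ⟨P, hP, fun Q hQ => ContinuousLinearMap.ext fun h => Lp.ext ((hQ h).trans (hP h).symm)⟩
  · obtain ⟨L, hL⟩ := hC x hx y hy hxy
    exact hL.iteratedIntegralConverges (integrable_kernelIntegrand hε hatt hx hy)
  · have hT : ∀ h : L2Inner Ω ε, ((ContinuousLinearMap.adjoint P ∘L P) h : E3 → ℂ)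
        =ᵐ[(volume : Measure E3).restrict (innerDomain Ω ε)]
          fun x => ∫ y in innerDomain Ω ε, kernel Ω κ x y * h y := by
      intro h
      have h1 := hreg.adjoint_comp_self_apply hP h
      rw [hconst] at h1
      exact h1
    have hHS := isHilbertSchmidt_of_kernel (K := kernel Ω κ) hkernel hT
    exact ⟨(ContinuousLinearMap.isPositive_adjoint_comp_self P).isSelfAdjoint, hT, hHS,
      hHS.isCompactOperator⟩
  · have hreg := hasRegularizedIntegral_kernel_of_strong hε hs hx hy
    refine ⟨?_, ?_⟩
    · exact integrable_prod_of_dominated (measurable_uncurry_of_measurable (f := kernelIntegrand κ)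
        (measurable_kernelIntegrand hmeas) x y) (integrable_exp_neg_im hε hs)
        fun ω _ hξ => norm_kernelIntegrand_le hε hx hy hξ ω (hatt.im_nonneg ω)
    · rw [kernel, hreg.iteratedIntegral_eq]
  · have hκs := h.smooth.continuous.measurable
    have hsplit := exists_hasRegularizedIntegral_split hΩ_open hΩ_bdd hΩ_convex hΩ_smooth hε h
    choose B hB using hsplit
    obtain ⟨A, hA⟩ := exists_hasRegularizedIntegral_zero hΩ_open hΩ_bdd hΩ_convex hΩ_smooth hε
      h.c_pos h.κinf_nonneg κs
    -- The sign of `A` is not known here, so the absolute value and the summand 1 ensure a positive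
    -- constant.
    refine ⟨fun j x hx y hy hxy => ?_, fun x hx y hy hxy => ?_, fun j => ?_,
      fun x hx y hy hxy => ?_, |1 / (32 * Real.pi ^ 3) * A| + 1, by positivity,
      fun x hx y hy hxy => ?_⟩
    · obtain ⟨L, hL⟩ := hB j x hx y hy hxy
      exact hL.iteratedIntegralConverges
        (integrable_splitIntegrand hΩ_bdd hε h.κinf_nonneg hκs j hx hy)
    · choose L hL using fun j => hB j x hx y hy hxy
      have hsum := ((hL 0).add (hL 1)).add (hL 2)
      have heq : (fun ω => ∫ ξ, kernelIntegrand κ x y ω ξ ∂(surfaceMeasure Ω)) =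
          fun ω => (∫ ξ, splitIntegrand c κinf κs 0 x y ω ξ ∂(surfaceMeasure Ω)) +
            (∫ ξ, splitIntegrand c κinf κs 1 x y ω ξ ∂(surfaceMeasure Ω)) +
            ∫ ξ, splitIntegrand c κinf κs 2 x y ω ξ ∂(surfaceMeasure Ω) :=
        funext fun ω => integral_kernelIntegrand_eq hΩ_bdd hε h hx hy ω
      rw [← heq] at hsum
      simp only [kernel, splitKernel, ← Finset.mul_sum, Fin.sum_univ_three]
      rw [hsum.iteratedIntegral_eq, (hL 0).iteratedIntegral_eq, (hL 1).iteratedIntegral_eq,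
        (hL 2).iteratedIntegral_eq]
    · exact (memLp_iteratedIntegral hΩ_open hΩ_bdd (a := splitIntegrand c κinf κs j)
        (measurable_splitIntegrand c κinf hκs j) (hB j)).const_mul _
    · obtain ⟨h1, h2⟩ := hA x hx y hy hxy
      refine ⟨h1, ?_⟩
      -- The constants combine as (1 / 32π³) · 2πc / |y - x| = c / (16π² |y - x|).
      rw [splitKernel, h2.iteratedIntegral_eq, ← Complex.ofReal_mul]
      congr 1
      have hpos : 0 < ‖y - x‖ := norm_pos_iff.2 (sub_ne_zero.2 hxy.symm)
      have hc := h.c_pos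
      have hpi := Real.pi_pos
      field_simp
      ring
    · obtain ⟨-, h2⟩ := hA x hx y hy hxy
      rw [splitKernel, h2.iteratedIntegral_eq, norm_mul, Complex.norm_of_nonneg (by positivity)]
      have hpos : 0 < ‖x - y‖ := norm_pos_iff.2 (sub_ne_zero.2 hxy)
      refine (mul_le_mul_of_nonneg_left h2.norm_le (by positivity)).trans ?_
      rw [← mul_div_assoc]
      refine div_le_div_of_nonneg_right ?_ hpos.le
      linarith [le_abs_self (1 / (32 * Real.pi ^ 3) * A)]
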